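/- Let $N\ge 3$ be an integer and $1<p<N$; write $\mathbb R_+=(0,+\infty)$. Assume: * $(\mathbf A)$ $A:\mathbb R_+\to\mathbb R_+$ is continuous and there are $a_0,a_\infty\in(p-N,p]$ and $c_0,c_\infty>0$ such that $$c_0\le\liminf_{r\to0^+}\frac{A(r)}{r^{a_0}}\le\limsup_{r\to0^+}\frac{A(r)}{r^{a_0}}<+\infty,\qquad c_\infty\le\liminf_{r\to+\infty}\frac{A(r)}{r^{a_\infty}}\le\limsup_{r\to+\infty}\frac{A(r)}{r^{a_\infty}}<+\infty .$$ * $(\mathbf V)$ $V:\mathbb R_+\to[0,+\infty)$ is measurable and $V\in L^1_{\mathrm{loc}}(\mathbb R_+)$. * $(\mathbf K)$ $K:\mathbb R_+\to\mathbb R_+$ is measurable and $K\in L^s_{\mathrm{loc}}(\mathbb R_+)$ for some $s>1$. * $(f_0)$ $f:\mathbb R\to\mathbb R$ is continuous and $f(0)=0$; put $F(t)=\int_0^t f(s)\,ds$. * $(f_1)$ There is $\theta>p$ such that $\theta F(t)\le f(t)t$ for all $t\ge0$. * $(f_2)$ There is $t_0>0$ such that $F(t_0)>0$. Let $S_A$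 be the space of the radial functions $\varphi\in C_c^\infty(\mathbb R^N)$ with $\|\varphi\|_A:=\big(\int_{\mathbb R^N}A(|x|)|\nabla\varphi|^p\,dx\big)^{1/p}<\infty$. Let $D_A$ be the completion of $S_A$ with respect to $\|\cdot\|_A$, realized as the space of the functions $u$ on $\mathbb R^N$ that are almost everywhere limits of $\|\cdot\|_A$-Cauchy sequences in $S_A$; such $u$ have a weak gradient $\nabla u$ in $\mathbb R^N\setminus\{0\}$. Let $X:=D_A\cap L^p(\mathbb R^N,V(|x|)\,dx)$. For real $a,\alpha,\beta,\gamma$ define $$q_*(\alpha,\beta,\gamma)=p\,\frac{\alpha-\gamma\beta+N}{N-\gamma},\qquad q_{**}(a,\alpha,\beta,\gamma)=p\,\frac{p\alpha+(1-p\beta)\gamma+p(N-1)+a}{p(N-1)-\gamma(p-1)+a}$$ (whenever the denominators do not vanish). For $a>p-N$, $\beta\in[0,1]$ and $\gamma\ge p-a$ let $\gamma_c=\frac{p(N-1)+a}{p-1}$ (note $\gamma_c>N$) and let $\mathcal A_{a,\beta,\gamma}$ be the set of the pairs $(\alpha,q)\in\mathbb R^2$ such that, with $q_*=q_*(\alpha,\beta,\gamma)$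 and $q_{**}=q_{**}(a,\alpha,\beta,\gamma)$, * $\max\{1,p\beta\}<q<\min\{q_*,q_{**}\}$, if $p-a\le\gamma<N$; * $\max\{1,p\beta\}<q<q_{**}$ and $\alpha>-(1-\beta)N$, if $\gamma=N$; * $\max\{1,p\beta,q_*\}<q<q_{**}$, if $N<\gamma<\gamma_c$; * $\max\{1,p\beta,q_*\}<q$ and $\alpha>-(1-\beta)\gamma$, if $\gamma=\gamma_c$; * $\max\{1,p\beta,q_*,q_{**}\}<q$, if $\gamma>\gamma_c$. Assume that there are $R_1,R_2>0$, $\beta_0,\beta_\infty\in[0,1]$, $\alpha_0,\alpha_\infty\in\mathbb R$, $\gamma_0\ge p-a_0$ and $\gamma_\infty\le p-a_\infty$ such that $$\operatorname*{ess\,sup}_{r\in(0,R_1)}\frac{K(r)}{r^{\alpha_0}V(r)^{\beta_0}}<+\infty,\qquad \operatorname*{ess\,inf}_{r\in(0,R_1)}r^{\gamma_0}V(r)>0,$$ $$\operatorname*{ess\,sup}_{r>R_2}\frac{K(r)}{r^{\alpha_\infty}V(r)^{\beta_\infty}}<+\infty,\qquad \operatorname*{ess\,inf}_{r>R_2}r^{\gamma_\infty}V(r)>0,$$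 where $V(r)^0$ means $1$. Assume furthermore that there are $q_1,q_2>p$ such that * $(\alpha_0,q_1)\in\mathcal A_{a_0,\beta_0,\gamma_0}$; * $q_2>\max\{1,\,p\beta_\infty,\,q_*(\alpha_\infty,\beta_\infty,\gamma_\infty),\,q_{**}(a_\infty,\alpha_\infty,\beta_\infty,\gamma_\infty)\}$; * $(f_{q_1,q_2})$ there is $M>0$ such that $0\le f(t)\le M\min\{t^{q_1-1},t^{q_2-1}\}$ for all $t\ge0$. Then there is $u\in X$ with $u\ge0$ almost everywhere and $u\not\equiv0$ (that is, $u$ does not vanish almost everywhere) which is a weak solution of $$-\mathrm{div}\big(A(|x|)|\nabla u|^{p-2}\nabla u\big)+V(|x|)|u|^{p-2}u=K(|x|)f(u)\quad\text{in }\mathbb R^N,$$ i.e. for every $h\in X$ the following three integrals converge absolutely and $$\int_{\mathbb R^N}A(|x|)|\nabla u|^{p-2}\nabla u\cdot\nabla h\,dx+\int_{\mathbb R^N}V(|x|)|u|^{p-2}uh\,dx=\int_{\mathbb R^N}K(|x|)f(u)h\,dx .$$ -/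

import Mathlib

open MeasureTheory Filter Topology Set
open scoped ContDiff

noncomputable section

namespace RadialQuasilinear

/-! ### The potentials -/

/-- Hypothesis `(A)` with the exponents `a₀`, `a∞`. The lower and upper limits are taken in
`[0, ∞]`. Only the values of `A` on `(0, ∞)` matter. -/
def HypA (N : ℕ) (p : ℝ) (A : ℝ → ℝ) (a₀ aInf : ℝ) : Prop :=
  ContinuousOn A (Ioi 0) ∧ (∀ r, 0 < r → 0 < A r) ∧
  a₀ ∈ Ioc (p - N) p ∧ aInf ∈ Ioc (p - N) p ∧
  (∃ c₀ : ℝ, 0 < c₀ ∧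
    ENNReal.ofReal c₀ ≤ liminf (fun r : ℝ => ENNReal.ofReal (A r / r ^ a₀)) (𝓝[>] 0) ∧
    limsup (fun r : ℝ => ENNReal.ofReal (A r / r ^ a₀)) (𝓝[>] 0) < ⊤) ∧
  (∃ cInf : ℝ, 0 < cInf ∧
    ENNReal.ofReal cInf ≤ liminf (fun r : ℝ => ENNReal.ofReal (A r / r ^ aInf)) atTop ∧
    limsup (fun r : ℝ => ENNReal.ofReal (A r / r ^ aInf)) atTop < ⊤)

/-- Hypothesis `(V)`: `V : (0, ∞) → [0, ∞)` is (Lebesgue) measurable and locally integrable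
on `(0, ∞)`. -/
def HypV (V : ℝ → ℝ) : Prop :=
  (∀ r, 0 < r → 0 ≤ V r) ∧ AEMeasurable V (volume.restrict (Ioi 0)) ∧
  LocallyIntegrableOn V (Ioi 0)

/-- Hypothesis `(K)`: `K : (0, ∞) → (0, ∞)` is (Lebesgue) measurable and belongs to
`L^s_loc(0, ∞)` for some `s > 1`. -/
def HypK (K : ℝ → ℝ) : Prop :=
  (∀ r, 0 < r → 0 < K r) ∧ AEMeasurable K (volume.restrict (Ioi 0)) ∧
  ∃ s : ℝ, 1 < s ∧ LocallyIntegrableOn (fun r => K r ^ s) (Ioi 0)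

/-- `ess sup_{r ∈ J} K(r) / (r^α V(r)^β) < ∞`, the quotient being formed in `[0, ∞]`
(so that it is `∞` where the denominator vanishes); `V(r)^0 = 1`. -/
def RatioBound (K V : ℝ → ℝ) (α β : ℝ) (J : Set ℝ) : Prop :=
  essSup (fun r : ℝ => ENNReal.ofReal (K r) / ENNReal.ofReal (r ^ α * V r ^ β))
    (volume.restrict J) < ⊤

/-- `ess inf_{r ∈ J} r^γ V(r) > 0`. -/
def LowerBound (V : ℝ → ℝ) (γ : ℝ) (J : Set ℝ) : Prop :=
  0 < essInf (fun r : ℝ => ENNReal.ofReal (r ^ γ * V r)) (volume.restrict J)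

/-! ### The exponents -/

/-- `q_*(α, β, γ)`, to be used for `γ ≠ N` only. -/
def qStar (N : ℕ) (p α β γ : ℝ) : ℝ :=
  p * ((α - γ * β + N) / (N - γ))

/-- `q_{**}(a, α, β, γ)`, to be used for `γ ≠ (p (N - 1) + a) / (p - 1)` only. -/
def qStarStar (N : ℕ) (p a α β γ : ℝ) : ℝ :=
  p * ((p * α + (1 - p * β) * γ + p * ((N : ℝ) - 1) + a) /
    (p * ((N : ℝ) - 1) - γ * (p - 1) + a))

/-- The critical value `(p (N - 1) + a) / (p - 1)` of `γ`. -/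
def gammaCrit (N : ℕ) (p a : ℝ) : ℝ := (p * ((N : ℝ) - 1) + a) / (p - 1)

/-- The region `𝒜_{a, β, γ}` of the `(α, q)`-plane. -/
def regionA (N : ℕ) (p a β γ : ℝ) : Set (ℝ × ℝ) :=
  {x | let α := x.1
       let q := x.2
       (p - a ≤ γ ∧ γ < N ∧
          max 1 (p * β) < q ∧ q < min (qStar N p α β γ) (qStarStar N p a α β γ)) ∨
       (γ = N ∧
          max 1 (p * β) < q ∧ q < qStarStar N p a α β γ ∧ -(1 - β) * N < α) ∨
       (N < γ ∧ γ < gammaCrit N p a ∧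
          max (max 1 (p * β)) (qStar N p α β γ) < q ∧ q < qStarStar N p a α β γ) ∨
       (γ = gammaCrit N p a ∧
          max (max 1 (p * β)) (qStar N p α β γ) < q ∧ -(1 - β) * γ < α) ∨
       (gammaCrit N p a < γ ∧
          max (max (max 1 (p * β)) (qStar N p α β γ)) (qStarStar N p a α β γ) < q)}

/-! ### The nonlinearity -/

/-- The primitive `F(t) = ∫₀ᵗ f(s) ds`. -/
def primitive (f : ℝ → ℝ) (t : ℝ) : ℝ := ∫ s in (0 : ℝ)..t, f s

/-- Hypothesis `(f₀)`. -/
def HypF0 (f : ℝ → ℝ) : Prop := Continuous f ∧ f 0 = 0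

/-- Hypothesis `(f₁)`. -/
def HypF1 (p : ℝ) (f : ℝ → ℝ) : Prop :=
  ∃ θ : ℝ, p < θ ∧ ∀ t, 0 ≤ t → θ * primitive f t ≤ f t * t

/-- Hypothesis `(f₂)`. -/
def HypF2 (f : ℝ → ℝ) : Prop := ∃ t₀ : ℝ, 0 < t₀ ∧ 0 < primitive f t₀

/-- The double-power growth condition `(f_{q₁, q₂})`. -/
def HypFq (f : ℝ → ℝ) (q₁ q₂ : ℝ) : Prop :=
  ∃ M : ℝ, 0 < M ∧ ∀ t, 0 ≤ t → 0 ≤ f t ∧ f t ≤ M * min (t ^ (q₁ - 1)) (t ^ (q₂ - 1))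

/-! ### The function spaces -/

/-- `S_A`: smooth, compactly supported, radial functions on `ℝ^N` with
`∫ A(|x|) |∇φ|^p dx < ∞`. -/
def SA (N : ℕ) (p : ℝ) (A : ℝ → ℝ) : Set (EuclideanSpace ℝ (Fin N) → ℝ) :=
  {φ | ContDiff ℝ ∞ φ ∧ HasCompactSupport φ ∧ (∀ x y, ‖x‖ = ‖y‖ → φ x = φ y) ∧
    Integrable (fun x => A ‖x‖ * ‖gradient φ x‖ ^ p)}

/-- `‖φ‖_A = (∫ A(|x|) |∇φ|^p dx)^{1/p}` on `S_A`. -/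
def normA {N : ℕ} (p : ℝ) (A : ℝ → ℝ) (φ : EuclideanSpace ℝ (Fin N) → ℝ) : ℝ :=
  (∫ x, A ‖x‖ * ‖gradient φ x‖ ^ p) ^ (1 / p)

/-- `D_A`: the completion of `S_A` with respect to `‖·‖_A`, realized as a space of functions:
`u ∈ D_A` iff `u` is the almost everywhere limit of a `‖·‖_A`-Cauchy sequence in `S_A`.
(Under `(A)`, a `‖·‖_A`-Cauchy sequence in `S_A` converges pointwise on `ℝ^N ∖ {0}`, and two
Cauchy sequences are equivalent exactly when their limits agree almost everywhere.) -/
def DA (N : ℕ) (p : ℝ) (A : ℝ → ℝ) : Set (EuclideanSpace ℝ (Fin N) → ℝ) :=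
  {u | ∃ φ : ℕ → EuclideanSpace ℝ (Fin N) → ℝ, (∀ n, φ n ∈ SA N p A) ∧
    (∀ ε : ℝ, 0 < ε → ∃ n₀ : ℕ, ∀ m n, n₀ ≤ m → n₀ ≤ n → normA p A (φ m - φ n) < ε) ∧
    ∀ᵐ x, Tendsto (fun n => φ n x) atTop (𝓝 (u x))}

/-- `X = D_A ∩ L^p(ℝ^N, V(|x|) dx)`. -/
def spaceX (N : ℕ) (p : ℝ) (A V : ℝ → ℝ) : Set (EuclideanSpace ℝ (Fin N) → ℝ) :=
  {u | u ∈ DA N p A ∧ Integrable (fun x => V ‖x‖ * |u x| ^ p)}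

/-- `G` is the weak gradient of `u` in the open set `ℝ^N ∖ {0}`. -/
def HasWeakGradient {N : ℕ} (u : EuclideanSpace ℝ (Fin N) → ℝ)
    (G : EuclideanSpace ℝ (Fin N) → EuclideanSpace ℝ (Fin N)) : Prop :=
  LocallyIntegrableOn u {0}ᶜ ∧ LocallyIntegrableOn G {0}ᶜ ∧
  ∀ φ : EuclideanSpace ℝ (Fin N) → ℝ, ContDiff ℝ ∞ φ → HasCompactSupport φ →
    tsupport φ ⊆ {0}ᶜ → ∀ i : Fin N,
      ∫ x, u x * fderiv ℝ φ x (EuclideanSpace.single i 1) = - ∫ x, G x i * φ x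

open Classical in
/-- The weak gradient `∇u` in `ℝ^N ∖ {0}` (unique up to null sets; it exists for every
`u ∈ D_A` under `(A)`). -/
def weakGrad {N : ℕ} (u : EuclideanSpace ℝ (Fin N) → ℝ) :
    EuclideanSpace ℝ (Fin N) → EuclideanSpace ℝ (Fin N) :=
  if h : ∃ G, HasWeakGradient u G then h.choose else 0

/-- `u ∈ X` is a weak solution of
`-div (A(|x|) |∇u|^{p-2} ∇u) + V(|x|) |u|^{p-2} u = K(|x|) f(u)` in `ℝ^N`: for all `h ∈ X` the
three integrals of the weak formulation converge absolutely and the identity holds. -/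
def IsWeakSolution (N : ℕ) (p : ℝ) (A V K f : ℝ → ℝ)
    (u : EuclideanSpace ℝ (Fin N) → ℝ) : Prop :=
  u ∈ spaceX N p A V ∧ ∀ h ∈ spaceX N p A V,
    Integrable (fun x => A ‖x‖ * ‖weakGrad u x‖ ^ (p - 2) *
      inner ℝ (weakGrad u x) (weakGrad h x)) ∧
    Integrable (fun x => V ‖x‖ * |u x| ^ (p - 2) * u x * h x) ∧
    Integrable (fun x => K ‖x‖ * f (u x) * h x) ∧
    (∫ x, A ‖x‖ * ‖weakGrad u x‖ ^ (p - 2) * inner ℝ (weakGrad u x) (weakGrad h x)) +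
      (∫ x, V ‖x‖ * |u x| ^ (p - 2) * u x * h x) =
      ∫ x, K ‖x‖ * f (u x) * h x

end RadialQuasilinear

end

/-! For a radial function with profile `U` put `σ = (A r^(N-1))^(-1/p)`, `κ = (V r^(N-1))^(1/p)` and
`G = U'/σ`. In polar coordinates the two energies that define `X` become, up to the area of the
sphere, the integrals over `(0, ∞)` of `|G|^p` and `|κ U|^p`. Since `aInf > p - N`, `σ` lies in
`L^(p/(p-1))` away from the origin, so `U(r) = -∫_r^∞ σ G` is well defined, and `X` becomes the
closed subspace `RadialWeight.space` of `L^p × L^p` made of the pairs `(G, κ U)`. The equation is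
then the Euler equation of `energy - potential` on that space, with `potential = ∫ K r^(N-1) F(U)`.

Compactness comes from a pointwise decay. On a window `[r, r + l]` the derivative controls the
oscillation of `U`, and the lower bound on `V` controls its size. The length `l = r^((γ+a)/p)`,
which the conditions on `γ` keep below `r`, balances the two and gives `|U(r)| ≤ C r^(-ν) ‖u‖` with
`p² ν = p(N-1) + a - γ(p-1)` (`exists_abs_eval_le_rpow`). Hence `K r^(N-1) |U|^q` is at most a
constant times `r^(α + γ(1-β) - ν(q-p)) κ^p |U|^p` for `u` in a ball. Comparing `q` with `q_**`
amounts to fixing the sign of this exponent: positive at `0` for `q₁`, negative at infinity for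
`q₂`. The double power growth allows a different power at each end, so both tails of the potential
energy are uniformly small (`IsSubcritical`). On compact intervals bounded sequences have pointwise
convergent subsequences, and dominated convergence does the rest.

The critical point is a mountain pass (`exists_critical_of_mountainPass`). Only convexity of the
energy is used in the minimax part: Ekeland's principle on the space of paths yields almost critical
points in the sense of a variational inequality. The Ambrosetti–Rabinowitz condition bounds them,
and uniform convexity together with compactness of the potential's derivative makes a subsequence
converge.

For the sign, `f` is replaced by `f (max t 0)`. Testing with the positive part then shows that the
critical point is nonnegative (`exists_posPart`), so the truncation is invisible. The return to
`ℝ^N` rests on the density of smooth profiles, which identifies `DA` and the weak gradient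
(`IsRadialFor.exists_of_mem_DA`, `IsRadialFor.radialFun_mem_DA`, `IsRadialFor.hasWeakGradient`). -/

/-! ### Ekeland's variational principle. -/

/-- A weak form of **Ekeland's variational principle**. -/
theorem LowerSemicontinuous.exists_forall_le_add_dist {X : Type*} [MetricSpace X] [CompleteSpace X]
    {f : X → ℝ} (hf : LowerSemicontinuous f) {m : ℝ} (hm : ∀ x, m ≤ f x) {ε : ℝ} (hε : 0 < ε)
    (x₀ : X) : ∃ v, f v ≤ f x₀ ∧ ∀ w, f v ≤ f w + ε * dist v w := by
  -- `S x` is the set of points below `x` in Ekeland's order. The triangle inequality makes the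
  -- order transitive, and `v` will be the limit of a descending sequence that nearly minimises `f`
  -- on each `S (x n)`.
  set S : X → Set X := fun x => {y | f y + ε * dist x y ≤ f x} with hS
  have hself : ∀ x, x ∈ S x := fun x => by simp [hS]
  have htrans : ∀ {x y z}, y ∈ S x → z ∈ S y → z ∈ S x := by
    intro x y z hy hz
    simp only [hS, mem_ofPred_eq] at hy hz ⊢
    have := mul_le_mul_of_nonneg_left (dist_triangle x y z) hε.le
    linarith
  have hnext : ∀ (n : ℕ) (x : X), ∃ y ∈ S x, ∀ z ∈ S x, f y ≤ f z + (1 / 2) ^ n := by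
    intro n x
    have hne : (f '' S x).Nonempty := ⟨_, x, hself x, rfl⟩
    obtain ⟨_, ⟨y, hy, rfl⟩, hlt⟩ := exists_lt_of_csInf_lt hne
      (lt_add_of_pos_right (sInf (f '' S x)) (by positivity : (0 : ℝ) < (1 / 2) ^ n))
    refine ⟨y, hy, fun z hz => hlt.le.trans ?_⟩
    gcongr
    exact csInf_le ⟨m, by rintro _ ⟨a, -, rfl⟩; exact hm a⟩ ⟨z, hz, rfl⟩
  choose next hnextS hnextle using hnext
  let x : ℕ → X := fun n => Nat.rec x₀ next n
  have hx : ∀ n, x (n + 1) = next n (x n) := fun n => rfl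
  have hmem : ∀ n k, x (n + k) ∈ S (x n) := by
    intro n k
    induction k with
    | zero => exact hself _
    | succ k ih => exact htrans ih (by rw [← add_assoc, hx]; exact hnextS _ _)
  have hanti : Antitone fun n => f (x n) := by
    refine antitone_nat_of_succ_le fun n => ?_
    have := hmem n 1
    simp only [hS, mem_ofPred_eq] at this
    nlinarith [dist_nonneg (x := x n) (y := x (n + 1))]
  have hconv : CauchySeq fun n => f (x n) :=
    (tendsto_atTop_ciInf hanti ⟨m, by rintro _ ⟨n, rfl⟩; exact hm _⟩).cauchySeq
  have hcauchy : CauchySeq x := by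
    rw [Metric.cauchySeq_iff'] at hconv ⊢
    intro δ hδ
    obtain ⟨n, hn⟩ := hconv (ε * δ) (by positivity)
    refine ⟨n, fun k hk => ?_⟩
    obtain ⟨j, rfl⟩ := Nat.exists_eq_add_of_le hk
    have h1 := hmem n j
    have h2 := hn (n + j) (by omega)
    simp only [hS, mem_ofPred_eq] at h1
    rw [Real.dist_eq, abs_sub_comm] at h2
    have h3 := le_abs_self (f (x n) - f (x (n + j)))
    rw [dist_comm]
    by_contra hcon
    push Not at hcon
    nlinarith
  obtain ⟨v, hv⟩ := cauchySeq_tendsto_of_complete hcauchy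
  have hvS : ∀ n, v ∈ S (x n) := by
    intro n
    simp only [hS, mem_ofPred_eq]
    suffices f v ≤ f (x n) - ε * dist (x n) v by linarith
    -- Lower semicontinuity enters here: any `y' < f v` is eventually below `f (x k)`.
    refine le_of_forall_lt fun y hy => ?_
    obtain ⟨y', hyy', hy'⟩ := exists_between hy
    refine hyy'.trans_le ?_
    have hev : ∀ᶠ k in atTop, y' + ε * dist (x n) (x k) ≤ f (x n) := by
      filter_upwards [hv.eventually (hf v y' hy'), eventually_ge_atTop n] with k hk hnk
      obtain ⟨j, rfl⟩ := Nat.exists_eq_add_of_le hnk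
      have := hmem n j
      simp only [hS, mem_ofPred_eq] at this
      linarith
    have hlim : Tendsto (fun k => y' + ε * dist (x n) (x k)) atTop
        (𝓝 (y' + ε * dist (x n) v)) :=
      ((tendsto_const_nhds.dist hv).const_mul ε).const_add y'
    linarith [le_of_tendsto hlim hev]
  refine ⟨v, ?_, fun w => ?_⟩
  · have := hvS 0
    simp only [hS, mem_ofPred_eq] at this
    have h0 : f (x 0) = f x₀ := rfl
    nlinarith [dist_nonneg (x := x 0) (y := v)]
  · by_contra hcon
    push Not at hcon
    have hw : w ∈ S v := hcon.le
    -- A point `w` strictly below `v` lies in every `S (x n)`. Since `x (n + 1)` nearly minimises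
    -- there, its distance to `w` tends to zero, which forces `w = v`.
    have hle : ∀ n, ε * dist (x (n + 1)) w ≤ (1 / 2) ^ n := by
      intro n
      have h1 : w ∈ S (x n) := htrans (hvS n) hw
      have h2 : w ∈ S (x (n + 1)) := htrans (hvS (n + 1)) hw
      have h3 := hnextle n (x n) w h1
      rw [← hx] at h3
      simp only [hS, mem_ofPred_eq] at h2
      linarith
    have hlim : Tendsto (fun n => ε * dist (x (n + 1)) w) atTop (𝓝 (ε * dist v w)) :=
      (((hv.comp (tendsto_add_atTop_nat 1)).dist tendsto_const_nhds).const_mul ε)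
    have h0 := le_of_tendsto_of_tendsto' hlim
      (tendsto_pow_atTop_nhds_zero_of_lt_one (by norm_num) (by norm_num : (1 / 2 : ℝ) < 1)) hle
    have : 0 ≤ dist v w := dist_nonneg
    have hdist : dist v w = 0 := by nlinarith
    rw [dist_eq_zero] at hdist
    subst hdist
    simp at hcon

/-! ### Almost critical points by a minimax over paths. -/

/-- The derivative `D` of `g` is attained uniformly along convergent sequences. -/
def HasSeqStrictDeriv {E : Type*} [NormedAddCommGroup E] [NormedSpace ℝ E] (g : E → ℝ)
    (D : E → E →ₗ[ℝ] ℝ) : Prop :=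
  ∀ (u z : E) (us zs : ℕ → E) (h : ℕ → ℝ), Tendsto us atTop (𝓝 u) → Tendsto zs atTop (𝓝 z) →
    (∀ n, 0 < h n) → Tendsto h atTop (𝓝 0) →
    Tendsto (fun n => (g (us n + h n • zs n) - g (us n)) / h n) atTop (𝓝 (D u z))

section Minimax

variable {E : Type*} [NormedAddCommGroup E] [NormedSpace ℝ E]

open unitInterval in
-- Suppose every maximum point of `Φ - g` on the path admitted a `w` that lowers the linearised
-- functional by more than `ε L`. Such `w` form convex sets, so they can be chosen continuously
-- along the path, and a small move of `γ` towards them contradicts its near optimality `hopt`.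
theorem exists_argmax_almost_critical {Φ g : E → ℝ} {D : E → E →ₗ[ℝ] ℝ}
    (hΦc : Continuous Φ) (hΦ : ConvexOn ℝ univ Φ) (hg : Continuous g)
    (hDc : Continuous fun x : E × E => D x.1 x.2) (hD : HasSeqStrictDeriv g D)
    (γ : C(I, E)) {m : ℝ} (hm : ∀ t, Φ (γ t) - g (γ t) ≤ m)
    (h0 : Φ (γ 0) - g (γ 0) < m) (h1 : Φ (γ 1) - g (γ 1) < m) {ε L : ℝ} (hL : 0 < L)
    (hε : 0 < ε)
    (hopt : ∀ χ : C(I, E), χ 0 = γ 0 → χ 1 = γ 1 →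
      ∃ t, m ≤ Φ (χ t) - g (χ t) + ε * dist γ χ) :
    ∃ t, Φ (γ t) - g (γ t) = m ∧
      ∀ w, ‖w - γ t‖ < L → -(ε * L) ≤ Φ w - Φ (γ t) - D (γ t) (w - γ t) := by
  by_contra hcon
  push Not at hcon
  have hγD : ∀ w : E, Continuous fun t => D (γ t) (w - γ t) := fun w =>
    hDc.comp (γ.continuous.prodMk (continuous_const.sub γ.continuous))
  -- Only maximum points of the path carry a constraint, apart from the endpoints, which are pinned
  -- so that the perturbed path keeps them.
  let W : I → Set E := fun t => {w | (Φ (γ t) - g (γ t) = m →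
    ‖w - γ t‖ < L ∧ Φ w - Φ (γ t) - D (γ t) (w - γ t) < -(ε * L)) ∧
    (t = 0 → w = γ 0) ∧ (t = 1 → w = γ 1)}
  have hWconv : ∀ t, Convex ℝ (W t) := by
    intro t a ha b hb x y hx hy hxy
    refine ⟨fun ht => ⟨?_, ?_⟩, fun ht => ?_, fun ht => ?_⟩
    · have hc : Convex ℝ (Metric.ball (γ t) L) := convex_ball _ _
      have := hc (by simpa [dist_eq_norm] using (ha.1 ht).1)
        (by simpa [dist_eq_norm] using (hb.1 ht).1) hx hy hxy
      simpa [dist_eq_norm] using this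
    · have e1 : x • a + y • b - γ t = x • (a - γ t) + y • (b - γ t) := by
        have : γ t = (x + y) • γ t := by rw [hxy, one_smul]
        nth_rewrite 1 [this]
        module
      have e2 := hΦ.2 (mem_univ a) (mem_univ b) hx hy hxy
      rw [e1, map_add, map_smul, map_smul]
      simp only [smul_eq_mul] at e2 ⊢
      have a1 := (ha.1 ht).2
      have b1 := (hb.1 ht).2
      have hx1 : Φ (γ t) = x * Φ (γ t) + y * Φ (γ t) := by rw [← add_mul, hxy, one_mul]
      have hx2 : ε * L = x * (ε * L) + y * (ε * L) := by rw [← add_mul, hxy, one_mul]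
      rcases hx.eq_or_lt with rfl | hx'
      · have : y = 1 := by linarith
        subst this
        linarith
      · nlinarith
    · rw [ha.2.1 ht, hb.2.1 ht, ← add_smul, hxy, one_smul]
    · rw [ha.2.2 ht, hb.2.2 ht, ← add_smul, hxy, one_smul]
  have hIc : Continuous fun t => Φ (γ t) - g (γ t) :=
    (hΦc.comp γ.continuous).sub (hg.comp γ.continuous)
  have hWloc : ∀ t, ∃ c : E, ∀ᶠ s in 𝓝 t, c ∈ W s := by
    intro t
    by_cases ht : Φ (γ t) - g (γ t) = m
    · obtain ⟨w, hw1, hw2⟩ := hcon t ht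
      refine ⟨w, ?_⟩
      have n0 : t ≠ 0 := by rintro rfl; linarith
      have n1 : t ≠ 1 := by rintro rfl; linarith
      have c1 : Continuous fun s => ‖w - γ s‖ := (continuous_const.sub γ.continuous).norm
      have c2 : Continuous fun s => Φ w - Φ (γ s) - D (γ s) (w - γ s) :=
        (continuous_const.sub (hΦc.comp γ.continuous)).sub (hγD w)
      filter_upwards [c1.continuousAt.eventually_lt continuousAt_const hw1,
        c2.continuousAt.eventually_lt continuousAt_const hw2,
        isOpen_ne.mem_nhds n0, isOpen_ne.mem_nhds n1] with s h1 h2 h3 h4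
      exact ⟨fun _ => ⟨h1, h2⟩, fun h => absurd h h3, fun h => absurd h h4⟩
    · refine ⟨γ t, ?_⟩
      have hne : ∀ᶠ s in 𝓝 t, Φ (γ s) - g (γ s) ≠ m := hIc.continuousAt.eventually_ne ht
      have h0' : ∀ᶠ s in 𝓝 t, s = 0 → γ t = γ 0 := by
        by_cases h : t = 0
        · exact .of_forall fun s _ => by rw [h]
        · filter_upwards [isOpen_ne.mem_nhds h] with s hs h' using absurd h' hs
      have h1' : ∀ᶠ s in 𝓝 t, s = 1 → γ t = γ 1 := by
        by_cases h : t = 1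
        · exact .of_forall fun s _ => by rw [h]
        · filter_upwards [isOpen_ne.mem_nhds h] with s hs h' using absurd h' hs
      filter_upwards [hne, h0', h1'] with s a b c
      exact ⟨fun h => absurd h a, b, c⟩
  -- A single vector is locally admissible: the same `w` near a maximum point, the value `γ t`
  -- elsewhere. Convexity lets these local choices be glued.
  obtain ⟨w, hw⟩ := exists_continuous_forall_mem_convex_of_local_const hWconv hWloc
  let d : C(I, E) := w - γ
  let h : ℕ → ℝ := fun n => 1 / ((n : ℝ) + 1)
  have hpos : ∀ n, 0 < h n := fun n => by positivity
  have hle : ∀ n, h n ≤ 1 := fun n => by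
    simp only [h]; rw [div_le_one (by positivity)]; linarith [n.cast_nonneg (α := ℝ)]
  have hlim : Tendsto h atTop (𝓝 0) := tendsto_one_div_add_atTop_nhds_zero_nat
  -- truncate the displacement so that its norm is controlled everywhere
  let K : Set I := {t | Φ (γ t) - g (γ t) = m}
  let τ : I → ℝ := fun t => min 1 (L / max L ‖d t‖)
  have hτc : Continuous τ := by
    refine continuous_const.min (continuous_const.div (continuous_const.max d.continuous.norm) ?_)
    intro t; exact (lt_of_lt_of_le hL (le_max_left _ _)).ne'
  have hτ0 : ∀ t, 0 ≤ τ t := fun t => by positivity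
  have hτ1 : ∀ t, τ t ≤ 1 := fun t => min_le_left _ _
  have hτd : ∀ t, ‖τ t • d t‖ ≤ L := by
    intro t
    rw [norm_smul, Real.norm_of_nonneg (hτ0 t)]
    have hM : 0 < max L ‖d t‖ := lt_of_lt_of_le hL (le_max_left _ _)
    calc τ t * ‖d t‖ ≤ (L / max L ‖d t‖) * max L ‖d t‖ := by
          gcongr
          · exact min_le_right _ _
          · exact le_max_right _ _
      _ = L := by field_simp
  have hτK : ∀ t ∈ K, τ t = 1 := by
    intro t ht
    have : ‖d t‖ ≤ L := ((hw t).1 ht).1.le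
    simp only [τ, max_eq_left this, div_self hL.ne', min_self]
  let z : C(I, E) := ⟨fun t => τ t • d t, hτc.smul d.continuous⟩
  have hz : ∀ t, z t = τ t • d t := fun t => rfl
  have hznorm : ‖z‖ ≤ L := (ContinuousMap.norm_le _ hL.le).2 hτd
  have hex : ∀ n, ∃ t, m ≤ Φ (γ t + h n • z t) - g (γ t + h n • z t) + ε * (h n * L) := by
    intro n
    obtain ⟨t, ht⟩ := hopt (γ + h n • z)
      (by simp [hz, d, (hw 0).2.1 rfl]) (by simp [hz, d, (hw 1).2.2 rfl])
    refine ⟨t, ht.trans ?_⟩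
    simp only [ContinuousMap.add_apply, ContinuousMap.smul_apply, dist_self_add_right, norm_smul,
      Real.norm_of_nonneg (hpos n).le]
    gcongr
  choose t ht using hex
  obtain ⟨s, -, φ, hφ, hts⟩ := isCompact_univ.tendsto_subseq (fun n => mem_univ (t n))
  have hγs : Tendsto (fun n => γ (t (φ n))) atTop (𝓝 (γ s)) := (γ.continuous.tendsto s).comp hts
  have hzs : Tendsto (fun n => z (t (φ n))) atTop (𝓝 (z s)) := (z.continuous.tendsto s).comp hts
  have hhs : Tendsto (fun n => h (φ n)) atTop (𝓝 0) := hlim.comp hφ.tendsto_atTop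
  -- The points supplied by near optimality accumulate at a maximum point of the original path,
  -- where the descent property of `w` is available.
  have hsK : s ∈ K := by
    refine le_antisymm (hm s) ?_
    have e1 : Tendsto (fun n => γ (t (φ n)) + h (φ n) • z (t (φ n))) atTop (𝓝 (γ s)) := by
      simpa using hγs.add (hhs.smul hzs)
    have e2 : Tendsto (fun n => Φ (γ (t (φ n)) + h (φ n) • z (t (φ n)))
        - g (γ (t (φ n)) + h (φ n) • z (t (φ n))) + ε * (h (φ n) * L)) atTop
        (𝓝 (Φ (γ s) - g (γ s) + ε * (0 * L))) :=
      (((hΦc.tendsto _).comp e1).sub ((hg.tendsto _).comp e1)).add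
        ((hhs.mul_const L).const_mul ε)
    simpa using ge_of_tendsto' e2 fun n => ht (φ n)
  have hquot := hD (γ s) (z s) _ _ (fun n => h (φ n)) hγs hzs (fun n => hpos _) hhs
  have hkey : ∀ n, -(ε * L) ≤ Φ (γ (t (φ n)) + z (t (φ n))) - Φ (γ (t (φ n)))
      - (g (γ (t (φ n)) + h (φ n) • z (t (φ n))) - g (γ (t (φ n)))) / h (φ n) := by
    intro n
    have a1 := ht (φ n)
    have a2 := hm (t (φ n))
    have a3 := hΦ.2 (mem_univ (γ (t (φ n)))) (mem_univ (γ (t (φ n)) + z (t (φ n))))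
      (sub_nonneg.2 (hle (φ n))) (hpos (φ n)).le (by ring)
    -- The perturbed point is a convex combination, so `Φ` increases by at most `h (Φ (γ + z) - Φ
    -- γ)`. After division by `h` only `g` needs differentiability.
    have e : (1 - h (φ n)) • γ (t (φ n)) + h (φ n) • (γ (t (φ n)) + z (t (φ n)))
        = γ (t (φ n)) + h (φ n) • z (t (φ n)) := by module
    rw [e] at a3
    simp only [smul_eq_mul] at a3
    have hp := hpos (φ n)
    rw [le_sub_iff_add_le, ← le_sub_iff_add_le', div_le_iff₀ hp]
    nlinarith
  have hlimkey := ge_of_tendsto' ((((hΦc.tendsto _).comp (hγs.add hzs)).sub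
    ((hΦc.tendsto _).comp hγs)).sub hquot) hkey
  have hfin := ((hw s).1 hsK).2
  have hzs' : z s = w s - γ s := by rw [hz, hτK s hsK, one_smul]; rfl
  rw [hzs', add_sub_cancel] at hlimkey
  linarith

open unitInterval in
/-- **Mountain pass**: existence of almost critical points of `Φ - g`, with `Φ` convex and `g`
differentiable. -/
theorem exists_almost_critical [CompleteSpace E] {Φ g : E → ℝ} {D : E → E →ₗ[ℝ] ℝ}
    (hΦc : Continuous Φ) (hΦ : ConvexOn ℝ univ Φ) (hg : Continuous g)
    (hDc : Continuous fun x : E × E => D x.1 x.2) (hD : HasSeqStrictDeriv g D)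
    {e : E} {ρ α : ℝ} (hα : 0 < α) (hsphere : ∀ u, ‖u‖ = ρ → α ≤ Φ u - g u)
    (hρ : 0 ≤ ρ) (hρe : ρ ≤ ‖e‖) (h0 : Φ 0 - g 0 ≤ 0) (he : Φ e - g e ≤ 0) :
    ∃ c, α ≤ c ∧ ∀ η > 0, ∀ L : ℝ, ∃ u, c ≤ Φ u - g u ∧ Φ u - g u ≤ c + η ∧
      ∀ w, ‖w - u‖ < L → -η ≤ Φ w - Φ u - D u (w - u) := by
  let Γ : Set C(I, E) := {γ | γ 0 = 0 ∧ γ 1 = e}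
  have hΓ : IsClosed Γ := by
    refine (isClosed_eq (by fun_prop) continuous_const).inter
      (isClosed_eq (by fun_prop) continuous_const)
  have : CompleteSpace Γ := hΓ.completeSpace_coe
  let Ic : E → ℝ := fun u => Φ u - g u
  have hIc : Continuous Ic := hΦc.sub hg
  -- The maximum of the functional along a path. It is at least `α`, because every path crosses the
  -- sphere of radius `ρ`, so it is never attained at an endpoint. As a supremum of continuous
  -- functions it is lower semicontinuous.
  let J : Γ → ℝ := fun γ => ⨆ t, Ic (γ.1 t)
  have hbdd : ∀ γ : C(I, E), BddAbove (range fun t => Ic (γ t)) := fun γ =>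
    (isCompact_range (hIc.comp γ.continuous)).bddAbove
  have hJα : ∀ γ, α ≤ J γ := by
    intro γ
    have hc : Continuous fun t => ‖γ.1 t‖ := γ.1.continuous.norm
    have : ρ ∈ range fun t => ‖γ.1 t‖ := by
      refine mem_range_of_exists_le_of_exists_ge hc ⟨0, ?_⟩ ⟨1, ?_⟩
      · simpa [γ.2.1] using hρ
      · simpa [γ.2.2] using hρe
    obtain ⟨t, ht⟩ := this
    exact (hsphere _ ht).trans (le_ciSup (hbdd γ.1) t)
  have hJlsc : LowerSemicontinuous J := by
    refine lowerSemicontinuous_ciSup (fun γ => hbdd γ.1) fun t => Continuous.lowerSemicontinuous ?_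
    exact hIc.comp ((continuous_eval_const t).comp continuous_subtype_val)
  have hne : Nonempty Γ := ⟨⟨⟨fun t => (t : ℝ) • e, by fun_prop⟩, by simp [Γ]⟩⟩
  refine ⟨⨅ γ, J γ, le_ciInf hJα, fun η hη L' => ?_⟩
  have hbelow : BddBelow (range J) := ⟨α, by rintro _ ⟨γ, rfl⟩; exact hJα γ⟩
  set L := max L' 1 with hL
  have hL1 : 1 ≤ L := le_max_right _ _
  obtain ⟨γ₀, hγ₀⟩ := exists_lt_of_ciInf_lt (lt_add_of_pos_right (⨅ γ, J γ) hη)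
  -- With the slope `η / L`, the tolerance on the ball of radius `L` is exactly `η`.
  obtain ⟨γ, hγ, hγopt⟩ := hJlsc.exists_forall_le_add_dist hJα
    (by positivity : 0 < η / L) γ₀
  have hsupmem : ∀ χ : Γ, ∃ t, Ic (χ.1 t) = J χ := by
    intro χ
    obtain ⟨t, -, ht⟩ := isCompact_univ.exists_isMaxOn (univ_nonempty (α := I))
      (hIc.comp χ.1.continuous).continuousOn
    exact ⟨t, le_antisymm (le_ciSup (hbdd χ.1) t) (ciSup_le fun s => ht (mem_univ s))⟩
  have hm : ∀ t, Φ (γ.1 t) - g (γ.1 t) ≤ J γ := fun t => le_ciSup (hbdd γ.1) t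
  obtain ⟨t, ht1, ht2⟩ := exists_argmax_almost_critical hΦc hΦ hg hDc hD γ.1 hm
    (by rw [γ.2.1]; linarith [hJα γ]) (by rw [γ.2.2]; linarith [hJα γ])
    (L := L) (ε := η / L) (by positivity) (by positivity) (by
      intro χ s0 s1
      let χ' : Γ := ⟨χ, by rw [s0, γ.2.1], by rw [s1, γ.2.2]⟩
      obtain ⟨t, ht⟩ := hsupmem χ'
      have := hγopt χ'
      rw [← ht] at this
      exact ⟨t, this⟩)
  refine ⟨γ.1 t, ?_, ?_, fun w hw => ?_⟩
  · rw [ht1]; exact ciInf_le hbelow γ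
  · rw [ht1]; linarith
  · have := ht2 w (hw.trans_le (le_max_left _ _))
    rwa [div_mul_cancel₀ _ (by positivity)] at this

end Minimax

/-! ### Convexity inequalities for powers. -/

section PowerConvexity

theorem abs_half_add_rpow_le {p : ℝ} (hp : 1 ≤ p) (a b : ℝ) :
    2 * |(a + b) / 2| ^ p ≤ |a| ^ p + |b| ^ p := by
  have h1 : |(a + b) / 2| ≤ (1 / 2) * |a| + (1 / 2) * |b| := by
    rw [abs_div, abs_two]
    linarith [abs_add_le a b]
  have h2 := (convexOn_rpow hp).2 (abs_nonneg a) (abs_nonneg b) (by norm_num : (0 : ℝ) ≤ 1 / 2)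
    (by norm_num : (0 : ℝ) ≤ 1 / 2) (by norm_num)
  simp only [smul_eq_mul] at h2
  have h3 := Real.rpow_le_rpow (abs_nonneg _) h1 (by linarith : 0 ≤ p)
  linarith

theorem abs_half_add_rpow_lt {p : ℝ} (hp : 1 < p) {a b : ℝ} (hab : a ≠ b) :
    2 * |(a + b) / 2| ^ p < |a| ^ p + |b| ^ p := by
  have h1 : |(a + b) / 2| ≤ (1 / 2) * |a| + (1 / 2) * |b| := by
    rw [abs_div, abs_two]
    linarith [abs_add_le a b]
  by_cases h : |a| = |b|
  · have hlt : |(a + b) / 2| < |b| := by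
      rcases abs_eq_abs.1 h with h' | h'
      · exact absurd h' hab
      · subst h'
        have : b ≠ 0 := by rintro rfl; simp at hab
        simpa using this
    rw [h]
    linarith [Real.rpow_lt_rpow (abs_nonneg _) hlt (by linarith : 0 < p)]
  · have h2 := (strictConvexOn_rpow hp).2 (abs_nonneg a) (abs_nonneg b) h
      (by norm_num : (0 : ℝ) < 1 / 2) (by norm_num : (0 : ℝ) < 1 / 2) (by norm_num)
    simp only [smul_eq_mul] at h2
    have h3 := Real.rpow_le_rpow (abs_nonneg _) h1 (by linarith : 0 ≤ p)
    linarith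

/-- A quantitative form of the uniform convexity of `t ↦ |t| ^ p`. -/
theorem exists_abs_sub_rpow_le {p : ℝ} (hp : 1 < p) {η : ℝ} (hη : 0 < η) :
    ∃ C, 0 ≤ C ∧ ∀ a b : ℝ, |a - b| ^ p ≤ η * (|a| ^ p + |b| ^ p) +
      C * (|a| ^ p + |b| ^ p - 2 * |(a + b) / 2| ^ p) := by
  have hp0 : 0 < p := by linarith
  have hcont : ∀ {f : ℝ × ℝ → ℝ}, Continuous f → Continuous fun x => |f x| ^ p := fun hf =>
    hf.abs.rpow_const fun _ => Or.inr hp0.le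
  -- By homogeneity the pair may be normalised. On the compact set of normalised pairs with `|a - b|
  -- ^ p ≥ η`, strict convexity keeps the midpoint defect `d` away from zero; for all other pairs
  -- the `η` term suffices.
  let S : Set (ℝ × ℝ) := {x | |x.1| ^ p + |x.2| ^ p = 1 ∧ η ≤ |x.1 - x.2| ^ p}
  have hSclosed : IsClosed S :=
    (isClosed_eq ((hcont continuous_fst).add (hcont continuous_snd)) continuous_const).inter
      (isClosed_le continuous_const (hcont (continuous_fst.sub continuous_snd)))
  have hScpt : IsCompact S := by
    refine (isCompact_Icc (a := ((-1 : ℝ), (-1 : ℝ))) (b := ((1 : ℝ), (1 : ℝ)))).of_isClosed_subset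
      hSclosed ?_
    rintro ⟨a, b⟩ ⟨h, -⟩
    simp only at h
    have ha : |a| ≤ 1 := by
      by_contra hc
      push Not at hc
      linarith [Real.one_lt_rpow hc hp0, Real.rpow_nonneg (abs_nonneg b) p]
    have hb : |b| ≤ 1 := by
      by_contra hc
      push Not at hc
      linarith [Real.one_lt_rpow hc hp0, Real.rpow_nonneg (abs_nonneg a) p]
    exact ⟨⟨(abs_le.1 ha).1, (abs_le.1 hb).1⟩, ⟨(abs_le.1 ha).2, (abs_le.1 hb).2⟩⟩
  let d : ℝ × ℝ → ℝ := fun x => |x.1| ^ p + |x.2| ^ p - 2 * |(x.1 + x.2) / 2| ^ p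
  have hdc : Continuous d := ((hcont continuous_fst).add (hcont continuous_snd)).sub
    ((hcont ((continuous_fst.add continuous_snd).div_const 2)).const_mul 2)
  have hdpos : ∀ x ∈ S, 0 < d x := by
    rintro ⟨a, b⟩ ⟨-, h⟩
    have hab : a ≠ b := by
      rintro rfl
      simp only [sub_self, abs_zero, Real.zero_rpow hp0.ne'] at h
      linarith
    exact sub_pos.2 (abs_half_add_rpow_lt hp hab)
  obtain ⟨C, hC⟩ := hScpt.bddAbove_image (f := fun x => |x.1 - x.2| ^ p / d x)
    (((hcont (continuous_fst.sub continuous_snd)).continuousOn).div hdc.continuousOn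
      fun x hx => (hdpos x hx).ne')
  refine ⟨max C 0, le_max_right _ _, fun a b => ?_⟩
  have hd0 : 0 ≤ d (a, b) := sub_nonneg.2 (abs_half_add_rpow_le hp.le a b)
  set s := |a| ^ p + |b| ^ p with hs
  have hs0 : 0 ≤ s := by positivity
  have hmain : |a - b| ^ p ≤ η * s + max C 0 * d (a, b) := by
    by_cases hle : |a - b| ^ p ≤ η * s
    · have := mul_nonneg (le_max_right C 0) hd0
      linarith
    push Not at hle
    have hs1 : 0 < s := by
      refine lt_of_le_of_ne hs0 fun h0 => ?_
      have ha : |a| ^ p = 0 := by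
        linarith [Real.rpow_nonneg (abs_nonneg a) p, Real.rpow_nonneg (abs_nonneg b) p]
      have hb : |b| ^ p = 0 := by
        linarith [Real.rpow_nonneg (abs_nonneg a) p, Real.rpow_nonneg (abs_nonneg b) p]
      rw [Real.rpow_eq_zero (abs_nonneg _) hp0.ne', abs_eq_zero] at ha hb
      rw [ha, hb, ← h0] at hle
      simp [Real.zero_rpow hp0.ne'] at hle
    set t := s ^ (1 / p) with ht
    have ht0 : 0 < t := Real.rpow_pos_of_pos hs1 _
    have htp : t ^ p = s := by rw [ht, ← Real.rpow_mul hs0, one_div_mul_cancel hp0.ne', Real.rpow_one]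
    have hscale : ∀ x : ℝ, |x / t| ^ p = |x| ^ p / s := fun x => by
      rw [abs_div, abs_of_pos ht0, Real.div_rpow (abs_nonneg x) ht0.le, htp]
    have hdscale : d (a / t, b / t) = d (a, b) / s := by
      simp only [d]
      rw [hscale, hscale, show (a / t + b / t) / 2 = ((a + b) / 2) / t by ring, hscale]
      ring
    have hmem : (a / t, b / t) ∈ S := by
      refine ⟨?_, ?_⟩
      · simp only [hscale]; rw [← add_div, ← hs, div_self hs1.ne']
      · simp only [← sub_div, hscale]; rw [le_div_iff₀ hs1]; exact hle.le
    have h1 := hC ⟨_, hmem, rfl⟩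
    have h2 := hdpos _ hmem
    simp only at h1
    rw [div_le_iff₀ h2, hdscale, ← sub_div, hscale, ← mul_div_assoc,
      div_le_div_iff_of_pos_right hs1] at h1
    have h3 := mul_le_mul_of_nonneg_right (le_max_left C 0) hd0
    have h4 : 0 ≤ η * s := by positivity
    linarith
  exact hmain

/-- The slope of `(1 + τ) ^ p` at `0` is `p < θ`. This serves to test almost criticality of `u` at
`(1 + τ) • u` when the energy is homogeneous of degree `p`. -/
theorem exists_one_add_rpow_le {p θ : ℝ} (hθ : p < θ) :
    ∃ τ₀, 0 < τ₀ ∧ ∀ τ, 0 < τ → τ ≤ τ₀ → (1 + τ) ^ p ≤ 1 + θ * τ := by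
  have hd : HasDerivAt (fun τ : ℝ => (1 + τ) ^ p) p 0 := by
    have := ((hasDerivAt_id (0 : ℝ)).const_add 1).rpow_const (p := p) (Or.inl (by simp))
    simpa using this
  have hs := hd.tendsto_slope_zero_right.eventually (gt_mem_nhds hθ)
  rw [eventually_nhdsWithin_iff, Metric.eventually_nhds_iff] at hs
  obtain ⟨δ, hδ, h⟩ := hs
  refine ⟨δ / 2, by positivity, fun τ h0 hτ => ?_⟩
  have := h (y := τ) (by rw [Real.dist_eq, sub_zero, abs_of_pos h0]; linarith) h0
  simp only [zero_add, add_zero, Real.one_rpow, smul_eq_mul] at this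
  rw [inv_mul_lt_iff₀ h0] at this
  linarith

end PowerConvexity

/-! ### Boundedness and convergence of almost critical sequences. -/

section PalaisSmale

variable {E : Type*} [NormedAddCommGroup E] [NormedSpace ℝ E]

/-- The Ambrosetti–Rabinowitz bound on almost critical points. -/
theorem exists_norm_le_of_almost_critical {p θ κ : ℝ} (hp : 1 < p) (hθ : p < θ) (hκ : 0 < κ)
    {Φ g : E → ℝ} {D : E → E →ₗ[ℝ] ℝ}
    (hhom : ∀ (s : ℝ) (u : E), 0 < s → Φ (s • u) = s ^ p * Φ u)
    (hcoer : ∀ u, κ * ‖u‖ ^ p ≤ Φ u) (hAR : ∀ u, θ * g u ≤ D u u) (c : ℝ) :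
    ∃ B, ∀ u, Φ u - g u ≤ c → (∀ w, ‖w - u‖ < 1 → -1 ≤ Φ w - Φ u - D u (w - u)) → ‖u‖ ≤ B := by
  -- The midpoint of `p` and `θ` leaves a gap `(θ - p) / 2` on the side of `θ`, which becomes the
  -- coefficient of the energy in the final bound.
  obtain ⟨τ₀, hτ₀, hτ⟩ := exists_one_add_rpow_le (show p < (p + θ) / 2 by linarith)
  set κ' := (θ - p) / 2 * κ with hκ'
  have hκ'0 : 0 < κ' := by have := sub_pos.2 hθ; positivity
  set C := |θ * c| + 1 / τ₀ + 2 with hC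
  refine ⟨max 1 (((C + 2) / κ') ^ (1 / (p - 1))), fun u hu hcrit => ?_⟩
  rcases le_or_gt ‖u‖ 1 with h1 | h1
  · exact h1.trans (le_max_left _ _)
  refine le_trans ?_ (le_max_right _ _)
  -- `τ` is small enough for `(1 + τ) • u` to lie at distance less than `1` from `u`. The cost `1 /
  -- τ` is then at most linear in `‖u‖` and is absorbed by `‖u‖ ^ p`.
  set τ := min τ₀ (1 / (2 * (‖u‖ + 1))) with hτdef
  have hn : 0 ≤ ‖u‖ := norm_nonneg u
  have hτ0 : 0 < τ := lt_min hτ₀ (by positivity)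
  have hτinv : 1 / τ ≤ 1 / τ₀ + 2 * (‖u‖ + 1) := by
    rcases min_choice τ₀ (1 / (2 * (‖u‖ + 1))) with h | h
    · rw [hτdef, h]; linarith
    · rw [hτdef, h, one_div_one_div]; linarith [one_div_pos.2 hτ₀]
  have hlt : ‖(1 + τ) • u - u‖ < 1 := by
    rw [add_smul, one_smul, add_sub_cancel_left, norm_smul, Real.norm_of_nonneg hτ0.le]
    calc τ * ‖u‖ ≤ 1 / (2 * (‖u‖ + 1)) * ‖u‖ := by gcongr; exact min_le_right _ _
      _ < 1 := by rw [div_mul_eq_mul_div, div_lt_one (by positivity)]; linarith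
  have h2 := hcrit _ hlt
  rw [hhom _ _ (by linarith), show (1 + τ) • u - u = τ • u by module, map_smul, smul_eq_mul] at h2
  have hΦ0 : 0 ≤ Φ u := le_trans (by positivity) (hcoer u)
  have h3 := mul_le_mul_of_nonneg_right (hτ τ hτ0 (min_le_left _ _)) hΦ0
  have h4 : D u u ≤ (p + θ) / 2 * Φ u + 1 / τ := by
    rw [← mul_le_mul_iff_right₀ hτ0, mul_add, mul_one_div_cancel hτ0.ne']
    linarith
  have h5 := hAR u
  have h6 : κ' * ‖u‖ ^ p ≤ C + 2 * ‖u‖ := by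
    have := mul_le_mul_of_nonneg_left (hcoer u) (by linarith : 0 ≤ (θ - p) / 2)
    have h7 := mul_le_mul_of_nonneg_left hu (by linarith : 0 ≤ θ)
    have := le_abs_self (θ * c)
    rw [hκ', hC, mul_assoc]
    linarith
  have h8 : κ' * ‖u‖ ^ (p - 1) ≤ C + 2 := by
    have e : ‖u‖ ^ p = ‖u‖ ^ (p - 1) * ‖u‖ := by
      rw [← Real.rpow_add_one (by positivity), sub_add_cancel]
    rw [e, ← mul_assoc] at h6
    have hC0 : 0 ≤ C := by positivity
    by_contra hcon
    push Not at hcon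
    nlinarith
  have h9 : ‖u‖ ^ (p - 1) ≤ (C + 2) / κ' := by rw [le_div_iff₀ hκ'0]; linarith
  calc ‖u‖ = (‖u‖ ^ (p - 1)) ^ (1 / (p - 1)) := by
        rw [← Real.rpow_mul hn, mul_one_div_cancel (by linarith), Real.rpow_one]
    _ ≤ _ := Real.rpow_le_rpow (by positivity) h9 (one_div_nonneg.2 (by linarith))

/-- The mountain pass theorem for `Φ - g`, with `Φ` homogeneous and uniformly convex on bounded
sets and `g` satisfying the Ambrosetti–Rabinowitz condition and having a compact derivative. -/
theorem exists_critical_of_mountainPass [CompleteSpace E] {p θ κ : ℝ} (hp : 1 < p) (hθ : p < θ)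
    (hκ : 0 < κ) {Φ g : E → ℝ} {D : E → E →ₗ[ℝ] ℝ}
    (hΦc : Continuous Φ) (hΦ : ConvexOn ℝ univ Φ)
    (hhom : ∀ (s : ℝ) (u : E), 0 < s → Φ (s • u) = s ^ p * Φ u)
    (hcoer : ∀ u, κ * ‖u‖ ^ p ≤ Φ u)
    (huc : ∀ B ε : ℝ, 0 < ε → ∃ δ > 0, ∀ u v : E, ‖u‖ ≤ B → ‖v‖ ≤ B →
      Φ u + Φ v - 2 * Φ ((1 / 2 : ℝ) • (u + v)) ≤ δ → ‖u - v‖ ≤ ε)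
    (hg : Continuous g) (hDc : Continuous fun x : E × E => D x.1 x.2) (hD : HasSeqStrictDeriv g D)
    (hAR : ∀ u, θ * g u ≤ D u u)
    (hcpt : ∀ (us : ℕ → E) (B : ℝ), (∀ n, ‖us n‖ ≤ B) → ∃ φ : ℕ → ℕ, StrictMono φ ∧
      ∀ ε > 0, ∃ n₀, ∀ n ≥ n₀, ∀ m ≥ n₀, |D (us (φ n)) (us (φ m) - us (φ n))| ≤ ε)
    {e : E} {ρ α : ℝ} (hα : 0 < α) (hsphere : ∀ u, ‖u‖ = ρ → α ≤ Φ u - g u)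
    (hρ : 0 ≤ ρ) (hρe : ρ ≤ ‖e‖) (h0 : Φ 0 - g 0 ≤ 0) (he : Φ e - g e ≤ 0) :
    ∃ u, 0 < Φ u - g u ∧ ∀ w, D u (w - u) ≤ Φ w - Φ u := by
  obtain ⟨c, hc, hseq⟩ := exists_almost_critical hΦc hΦ hg hDc hD hα hsphere hρ hρe h0 he
  -- The tolerance tends to zero while the radius tends to infinity, so every fixed test point is
  -- eventually admissible.
  choose us hus1 hus2 hus3 using fun n : ℕ =>
    hseq (1 / ((n : ℝ) + 1)) (by positivity) ((n : ℝ) + 1)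
  have hη1 : ∀ n : ℕ, 1 / ((n : ℝ) + 1) ≤ 1 := fun n => by
    rw [div_le_one (by positivity)]; linarith [n.cast_nonneg (α := ℝ)]
  obtain ⟨B, hB⟩ := exists_norm_le_of_almost_critical hp hθ hκ hhom hcoer hAR (c + 1)
  have husB : ∀ n, ‖us n‖ ≤ B := fun n => hB _ (by linarith [hus2 n, hη1 n]) fun w hw => by
    have := hus3 n w (hw.trans_le (by linarith [n.cast_nonneg (α := ℝ)]))
    linarith [hη1 n]
  have hB0 : 0 ≤ B := (norm_nonneg _).trans (husB 0)
  obtain ⟨φ, hφ, hφD⟩ := hcpt us B husB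
  have hη0 : Tendsto (fun n : ℕ => 1 / ((φ n : ℝ) + 1)) atTop (𝓝 0) :=
    tendsto_one_div_add_atTop_nhds_zero_nat.comp hφ.tendsto_atTop
  have hLtop : Tendsto (fun n : ℕ => (φ n : ℝ) + 1) atTop atTop :=
    tendsto_atTop_add_const_right _ _ (tendsto_natCast_atTop_atTop.comp hφ.tendsto_atTop)
  have hcauchy : CauchySeq fun n => us (φ n) := by
    rw [Metric.cauchySeq_iff]
    intro ε hε
    obtain ⟨δ, hδ, hucδ⟩ := huc B (ε / 2) (by positivity)
    obtain ⟨n₀, hn₀⟩ := hφD (δ / 4) (by positivity)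
    obtain ⟨n₁, hn₁⟩ := eventually_atTop.1 (hη0.eventually (gt_mem_nhds (show 0 < δ / 4 by positivity)))
    obtain ⟨n₂, hn₂⟩ := eventually_atTop.1 (hLtop.eventually_gt_atTop (2 * B))
    refine ⟨max n₀ (max n₁ n₂), fun n hn m hm => ?_⟩
    simp only [ge_iff_le, max_le_iff] at hn hm
    rw [dist_eq_norm]
    -- Each of two almost critical points is tested at their midpoint. The derivative terms are
    -- small by compactness, so the sum of the two estimates bounds the midpoint defect by `δ`, and
    -- uniform convexity gives closeness.
    have key : ∀ i j, n₀ ≤ i ∧ n₁ ≤ i ∧ n₂ ≤ i → n₀ ≤ j ∧ n₁ ≤ j ∧ n₂ ≤ j →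
        Φ (us (φ i)) - Φ ((1 / 2 : ℝ) • (us (φ i) + us (φ j))) ≤ δ / 2 := by
      intro i j hi hj
      have e1 : (1 / 2 : ℝ) • (us (φ i) + us (φ j)) - us (φ i)
          = (1 / 2 : ℝ) • (us (φ j) - us (φ i)) := by module
      have h1 : ‖(1 / 2 : ℝ) • (us (φ i) + us (φ j)) - us (φ i)‖ < (φ i : ℝ) + 1 := by
        rw [e1, norm_smul, Real.norm_of_nonneg (by norm_num)]
        have := norm_sub_le (us (φ j)) (us (φ i))
        linarith [hn₂ i hi.2.2, husB (φ i), husB (φ j)]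
      have h2 := hus3 (φ i) _ h1
      rw [e1, map_smul, smul_eq_mul] at h2
      have h3 := (abs_le.1 (hn₀ i hi.1 j hj.1)).1
      have h4 := hn₁ i hi.2.1
      linarith
    have k1 := key n m hn hm
    have k2 := key m n hm hn
    rw [add_comm (us (φ m))] at k2
    exact (hucδ _ _ (husB _) (husB _) (by linarith)).trans_lt (by linarith)
  obtain ⟨u, hu⟩ := cauchySeq_tendsto_of_complete hcauchy
  refine ⟨u, ?_, fun w => ?_⟩
  · refine lt_of_lt_of_le (hα.trans_le hc) ?_
    exact ge_of_tendsto' (((hΦc.sub hg).tendsto u).comp hu) fun n => hus1 (φ n)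
  · have hev : ∀ᶠ n in atTop, -(1 / ((φ n : ℝ) + 1)) ≤
        Φ w - Φ (us (φ n)) - D (us (φ n)) (w - us (φ n)) := by
      filter_upwards [hLtop.eventually_gt_atTop (‖w‖ + B)] with n hn
      refine hus3 (φ n) w ?_
      linarith [norm_sub_le w (us (φ n)), husB (φ n)]
    have hlim : Tendsto (fun n => Φ w - Φ (us (φ n)) - D (us (φ n)) (w - us (φ n))) atTop
        (𝓝 (Φ w - Φ u - D u (w - u))) :=
      (tendsto_const_nhds.sub ((hΦc.tendsto u).comp hu)).sub
        ((hDc.tendsto (u, w - u)).comp (hu.prodMk_nhds (tendsto_const_nhds.sub hu)))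
    have := le_of_tendsto_of_tendsto hη0.neg hlim hev
    linarith

end PalaisSmale

/-! ### Real `L^p` spaces: uniform convexity and differentiation of the norm. -/

section LpReal

variable {α : Type*} [MeasurableSpace α] {μ : Measure α} {p : ℝ}

instance fact_one_le_ofReal [hp : Fact (1 < p)] : Fact (1 ≤ ENNReal.ofReal p) :=
  ⟨by simpa using ENNReal.ofReal_le_ofReal hp.out.le⟩

theorem ofReal_ne_zero_of_one_lt (hp : 1 < p) : ENNReal.ofReal p ≠ 0 := by
  simpa using lt_trans zero_lt_one hp

theorem integrable_abs_rpow_iff {f : α → ℝ} (hp : 1 < p) (hf : AEStronglyMeasurable f μ) :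
    Integrable (fun x => |f x| ^ p) μ ↔ MemLp f (ENNReal.ofReal p) μ := by
  rw [← integrable_norm_rpow_iff hf (ofReal_ne_zero_of_one_lt hp) ENNReal.ofReal_ne_top,
    ENNReal.toReal_ofReal (by linarith)]
  rfl

theorem MeasureTheory.MemLp.integrable_abs_rpow {f : α → ℝ} (hp : 1 < p)
    (hf : MemLp f (ENNReal.ofReal p) μ) : Integrable (fun x => |f x| ^ p) μ :=
  (integrable_abs_rpow_iff hp hf.1).2 hf

theorem abs_mul_abs_rpow_sub_two (hp : 1 < p) (x : ℝ) : |(|x| ^ (p - 2) * x)| = |x| ^ (p - 1) := by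
  rcases eq_or_ne x 0 with rfl | hx
  · simp [Real.zero_rpow (by linarith : p - 1 ≠ 0)]
  · have hx' : 0 < |x| := abs_pos.2 hx
    rw [abs_mul, abs_of_nonneg (by positivity), ← Real.rpow_add_one hx'.ne']
    ring_nf

/-- A crude replacement for Young's inequality: with `s = |f| + |g|`, a single `p`-th power
dominates the mixed products that occur in derivatives. -/
theorem rpow_sub_one_mul_le (hp : 1 < p) {a b s : ℝ} (ha : 0 ≤ a) (hb : 0 ≤ b) (has : a ≤ s)
    (hbs : b ≤ s) : a ^ (p - 1) * b ≤ s ^ p := by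
  have hs : 0 ≤ s := ha.trans has
  calc a ^ (p - 1) * b ≤ s ^ (p - 1) * s :=
        mul_le_mul (Real.rpow_le_rpow ha has (by linarith)) hbs hb (by positivity)
    _ = s ^ p := by
        rcases hs.eq_or_lt with h | h
        · rw [← h, mul_zero, Real.zero_rpow (by linarith)]
        · rw [← Real.rpow_add_one h.ne', sub_add_cancel]

/-- Hölder's inequality. -/
theorem integrable_mul_and_integral_abs_mul_le {f g : α → ℝ} (hp : 1 < p)
    (hf : MemLp f (ENNReal.ofReal (p / (p - 1))) μ) (hg : MemLp g (ENNReal.ofReal p) μ) :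
    Integrable (fun x => f x * g x) μ ∧
      ∫ x, |f x * g x| ∂μ ≤ (∫ x, |f x| ^ (p / (p - 1)) ∂μ) ^ ((p - 1) / p) *
        (∫ x, |g x| ^ p ∂μ) ^ (1 / p) := by
  have hpq : (p / (p - 1)).HolderConjugate p := (Real.HolderConjugate.conjExponent hp).symm
  constructor
  · have : ENNReal.HolderConjugate (ENNReal.ofReal (p / (p - 1))) (ENNReal.ofReal p) :=
      hpq.ennrealOfReal
    exact memLp_one_iff_integrable.1 (hg.mul hf)
  · have := integral_mul_le_Lp_mul_Lq_of_nonneg hpq (f := fun x => |f x|) (g := fun x => |g x|)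
      (.of_forall fun _ => abs_nonneg _) (.of_forall fun _ => abs_nonneg _) hf.norm hg.norm
    simpa only [abs_mul, one_div_div] using this

theorem integrable_abs_rpow_sub_one_mul {f g : α → ℝ} (hp : 1 < p)
    (hf : MemLp f (ENNReal.ofReal p) μ) (hg : MemLp g (ENNReal.ofReal p) μ) :
    Integrable (fun x => |f x| ^ (p - 2) * f x * g x) μ := by
  have hm := hf.norm.add hg.norm
  refine (hm.integrable_abs_rpow hp).mono' ?_ (.of_forall fun x => ?_)
  · exact (((hf.1.aemeasurable.abs.pow_const _).mul hf.1.aemeasurable).mul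
      hg.1.aemeasurable).aestronglyMeasurable
  · simp only [Pi.add_apply, Real.norm_eq_abs]
    rw [abs_mul, abs_mul_abs_rpow_sub_two hp, abs_of_nonneg (by positivity : 0 ≤ |f x| + |g x|)]
    exact rpow_sub_one_mul_le hp (abs_nonneg _) (abs_nonneg _)
      (le_add_of_nonneg_right (abs_nonneg _)) (le_add_of_nonneg_left (abs_nonneg _))

section

variable [hp : Fact (1 < p)]

theorem MeasureTheory.Lp.norm_rpow_eq_integral (f : Lp ℝ (ENNReal.ofReal p) μ) :
    ‖f‖ ^ p = ∫ x, |f x| ^ p ∂μ := by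
  have hp0 : 0 < p := by linarith [hp.out]
  have hI : 0 ≤ ∫ x, |f x| ^ p ∂μ := integral_nonneg fun x => by positivity
  rw [Lp.norm_def, (Lp.memLp f).eLpNorm_eq_integral_rpow_norm (ofReal_ne_zero_of_one_lt hp.out)
    ENNReal.ofReal_ne_top, ENNReal.toReal_ofReal hp0.le]
  simp only [Real.norm_eq_abs]
  rw [ENNReal.toReal_ofReal (by positivity), ← Real.rpow_mul hI, inv_mul_cancel₀ hp0.ne',
    Real.rpow_one]

theorem MeasureTheory.Lp.norm_eq_integral (f : Lp ℝ (ENNReal.ofReal p) μ) :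
    ‖f‖ = (∫ x, |f x| ^ p ∂μ) ^ (1 / p) := by
  have hp0 : 0 < p := by linarith [hp.out]
  rw [← Lp.norm_rpow_eq_integral, ← Real.rpow_mul (norm_nonneg _), mul_one_div_cancel hp0.ne',
    Real.rpow_one]

/-- Both parts are scalar inequalities integrated. A scalar estimate valid for every `p > 1` makes
separate Clarkson inequalities for `p < 2` and `p ≥ 2` unnecessary. -/
theorem MeasureTheory.Lp.norm_half_add_rpow_le (f g : Lp ℝ (ENNReal.ofReal p) μ) :
    2 * ‖(1 / 2 : ℝ) • (f + g)‖ ^ p ≤ ‖f‖ ^ p + ‖g‖ ^ p ∧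
    ∀ η C : ℝ, (∀ a b : ℝ, |a - b| ^ p ≤ η * (|a| ^ p + |b| ^ p) +
      C * (|a| ^ p + |b| ^ p - 2 * |(a + b) / 2| ^ p)) →
      ‖f - g‖ ^ p ≤ η * (‖f‖ ^ p + ‖g‖ ^ p) +
        C * (‖f‖ ^ p + ‖g‖ ^ p - 2 * ‖(1 / 2 : ℝ) • (f + g)‖ ^ p) := by
  have hf := (Lp.memLp f).integrable_abs_rpow hp.out
  have hg := (Lp.memLp g).integrable_abs_rpow hp.out
  have hm := (Lp.memLp ((1 / 2 : ℝ) • (f + g))).integrable_abs_rpow hp.out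
  have hs := (Lp.memLp (f - g)).integrable_abs_rpow hp.out
  have em : ∀ᵐ x ∂μ, ((1 / 2 : ℝ) • (f + g)) x = (f x + g x) / 2 := by
    filter_upwards [Lp.coeFn_smul (1 / 2 : ℝ) (f + g), Lp.coeFn_add f g] with x h1 h2
    rw [h1, Pi.smul_apply, h2, Pi.add_apply, smul_eq_mul]
    ring
  simp only [Lp.norm_rpow_eq_integral]
  refine ⟨?_, fun η C h => ?_⟩
  · rw [← integral_const_mul, ← integral_add hf hg]
    refine integral_mono_ae (hm.const_mul 2) (hf.add hg) ?_
    filter_upwards [em] with x hx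
    simp only [hx]
    exact abs_half_add_rpow_le hp.out.le _ _
  · have hfg : Integrable (fun x => |f x| ^ p + |g x| ^ p) μ := hf.add hg
    have hd : Integrable (fun x => |f x| ^ p + |g x| ^ p
        - 2 * |((1 / 2 : ℝ) • (f + g) : Lp ℝ (ENNReal.ofReal p) μ) x| ^ p) μ :=
      hfg.sub (hm.const_mul 2)
    rw [← integral_const_mul 2, ← integral_add hf hg, ← integral_sub hfg (hm.const_mul 2),
      ← integral_const_mul, ← integral_const_mul,
      ← integral_add (hfg.const_mul η) (hd.const_mul C)]
    refine integral_mono_ae hs ((hfg.const_mul η).add (hd.const_mul C)) ?_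
    filter_upwards [em, Lp.coeFn_sub f g] with x h1 h2
    simp only [h1, h2, Pi.sub_apply]
    exact h _ _

/-- Differentiation under the integral sign, with `p (|f| + |g|) ^ p` dominating the derivative for
all `|t| < 1`. -/
theorem hasDerivAt_integral_abs_rpow {f g : α → ℝ} (hf : MemLp f (ENNReal.ofReal p) μ)
    (hg : MemLp g (ENNReal.ofReal p) μ) :
    HasDerivAt (fun t : ℝ => ∫ x, |f x + t * g x| ^ p ∂μ)
      (p * ∫ x, |f x| ^ (p - 2) * f x * g x ∂μ) 0 := by
  have hp1 := hp.out
  have hm := hf.norm.add hg.norm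
  have hfm := hf.1.aemeasurable
  have hgm := hg.1.aemeasurable
  have key := hasDerivAt_integral_of_dominated_loc_of_deriv_le (μ := μ)
    (F := fun (t : ℝ) x => |f x + t * g x| ^ p) (x₀ := 0) (s := Metric.ball 0 1)
    (F' := fun t x => p * |f x + t * g x| ^ (p - 2) * (f x + t * g x) * g x)
    (bound := fun x => p * (|f x| + |g x|) ^ p)
    (Metric.ball_mem_nhds _ one_pos)
    (.of_forall fun t => ((hfm.add (hgm.const_mul t)).abs.pow_const _).aestronglyMeasurable)
    (by simpa using hf.integrable_abs_rpow hp1)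
    (by
      simp only [zero_mul, add_zero]
      exact ((((hfm.abs.pow_const _).const_mul p).mul hfm).mul hgm).aestronglyMeasurable)
    (by
      refine .of_forall fun x t ht => ?_
      have ht1 : |t| ≤ 1 := by
        rw [mem_ball_zero_iff, Real.norm_eq_abs] at ht; exact ht.le
      have h1 : |f x + t * g x| ≤ |f x| + |g x| := by
        refine (abs_add_le _ _).trans ?_
        rw [abs_mul]
        gcongr
        exact mul_le_of_le_one_left (abs_nonneg _) ht1
      rw [Real.norm_eq_abs, mul_assoc, mul_assoc, abs_mul, ← mul_assoc, abs_mul,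
        abs_mul_abs_rpow_sub_two hp1, abs_of_pos (by linarith : 0 < p)]
      gcongr
      exact rpow_sub_one_mul_le hp1 (abs_nonneg _) (abs_nonneg _) h1
        (le_add_of_nonneg_left (abs_nonneg _)))
    (by
      have := (hm.integrable_abs_rpow hp1).const_mul p
      refine this.congr (.of_forall fun x => ?_)
      simp only [Pi.add_apply, Real.norm_eq_abs]
      rw [abs_of_nonneg (by positivity : 0 ≤ |f x| + |g x|)])
    (by
      refine .of_forall fun x t _ => ?_
      have h1 : HasDerivAt (fun t : ℝ => f x + t * g x) (g x) t := by
        simpa using ((hasDerivAt_id t).mul_const (g x)).const_add (f x)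
      exact (hasDerivAt_abs_rpow _ hp1).comp t h1)
  have := key.2
  simp only [zero_mul, add_zero] at this
  rw [← integral_const_mul]
  exact this.congr_deriv (integral_congr_ae (.of_forall fun x => by ring))

end

end LpReal

theorem convexOn_norm_rpow {E : Type*} [NormedAddCommGroup E] [NormedSpace ℝ E] {p : ℝ}
    (hp : 1 ≤ p) : ConvexOn ℝ univ fun x : E => ‖x‖ ^ p := by
  refine ⟨convex_univ, fun x _ y _ a b ha hb hab => ?_⟩
  have h1 : ‖a • x + b • y‖ ≤ a * ‖x‖ + b * ‖y‖ := by
    refine (norm_add_le _ _).trans_eq ?_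
    rw [norm_smul, norm_smul, Real.norm_of_nonneg ha, Real.norm_of_nonneg hb]
  exact (Real.rpow_le_rpow (norm_nonneg _) h1 (by linarith)).trans
    ((convexOn_rpow hp).2 (norm_nonneg x) (norm_nonneg y) ha hb hab)

/-! ### The weighted space of radial profiles. -/

/-- Lebesgue measure on `(0, ∞)`. -/
noncomputable abbrev halfLine : Measure ℝ := volume.restrict (Ioi 0)

theorem halfLine_restrict_Ioi_le {r : ℝ} (hr : 0 ≤ r) : volume.restrict (Ioi r) ≤ halfLine :=
  Measure.restrict_mono (Ioi_subset_Ioi hr) le_rfl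

/-- The primitive `r ↦ -∫_r^∞ σ G` vanishing at infinity. -/
noncomputable def tailPrim (σ G : ℝ → ℝ) (r : ℝ) : ℝ := -∫ s in Ioi r, σ s * G s

theorem tailPrim_congr {σ G H : ℝ → ℝ} (h : G =ᵐ[halfLine] H) {r : ℝ} (hr : 0 ≤ r) :
    tailPrim σ G r = tailPrim σ H r := by
  have : ∀ᵐ s ∂volume.restrict (Ioi r), G s = H s := ae_mono (halfLine_restrict_Ioi_le hr) h
  unfold tailPrim
  congr 1
  refine integral_congr_ae ?_
  filter_upwards [this] with s hs
  rw [hs]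

/-- A pair of weights on `(0, ∞)`, the `p`-th powers of `1 / σ` and `κ` being the weights of the
energy of a radial function and of its derivative. -/
structure RadialWeight (p : ℝ) where
  /-- the inverse weight of the derivative -/
  σ : ℝ → ℝ
  /-- the weight of the function -/
  κ : ℝ → ℝ
  σ_pos : ∀ r, 0 < r → 0 < σ r
  continuousOn_σ : ContinuousOn σ (Ioi 0)
  memLp_σ : ∀ r, 0 < r → MemLp σ (ENNReal.ofReal (p / (p - 1))) (volume.restrict (Ioi r))
  κ_nonneg : ∀ r, 0 < r → 0 ≤ κ r
  aemeasurable_κ : AEMeasurable κ halfLine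
  locallyIntegrableOn_κ : LocallyIntegrableOn (fun r => κ r ^ p) (Ioi 0)

namespace RadialWeight

variable {p : ℝ} [hp : Fact (1 < p)] (w : RadialWeight p)

/-- The norm of `σ` on `S`. -/
noncomputable def normOn (S : Set ℝ) : ℝ :=
  (∫ s in S, |w.σ s| ^ (p / (p - 1))) ^ ((p - 1) / p)

omit hp in
theorem normOn_nonneg (S : Set ℝ) : 0 ≤ w.normOn S :=
  Real.rpow_nonneg (integral_nonneg fun _ => by positivity) _

theorem integrableOn_rpow {r : ℝ} (hr : 0 < r) :
    IntegrableOn (fun s => |w.σ s| ^ (p / (p - 1))) (Ioi r) := by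
  have h1 := hp.out
  have : 1 < p / (p - 1) := by rw [lt_div_iff₀ (by linarith)]; linarith
  exact (w.memLp_σ r hr).integrable_abs_rpow this

theorem normOn_mono {S T : Set ℝ} {r : ℝ} (hr : 0 < r) (hST : S ⊆ T) (hT : T ⊆ Ioi r) :
    w.normOn S ≤ w.normOn T := by
  have h1 := hp.out
  refine Real.rpow_le_rpow (integral_nonneg fun _ => by positivity) ?_
    (div_nonneg (by linarith) (by linarith))
  exact setIntegral_mono_set ((w.integrableOn_rpow hr).mono_set hT)
    (.of_forall fun _ => by positivity) (.of_forall hST)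

section Primitive

variable {w} {G H : ℝ → ℝ} (hG : MemLp G (ENNReal.ofReal p) halfLine)
include hG

theorem integral_abs_mul_le {S : Set ℝ} {r : ℝ} (hr : 0 < r) (hS : S ⊆ Ioi r) :
    IntegrableOn (fun s => w.σ s * G s) S ∧
    ∫ s in S, |w.σ s * G s| ≤ w.normOn S * (∫ s in Ioi 0, |G s| ^ p) ^ (1 / p) := by
  have h1 := hp.out
  have hle : volume.restrict S ≤ volume.restrict (Ioi r) := Measure.restrict_mono hS le_rfl
  have hS0 : S ⊆ Ioi 0 := hS.trans (Ioi_subset_Ioi hr.le)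
  have hGS : MemLp G (ENNReal.ofReal p) (volume.restrict S) :=
    hG.mono_measure (Measure.restrict_mono hS0 le_rfl)
  have := integrable_mul_and_integral_abs_mul_le h1 ((w.memLp_σ r hr).mono_measure hle) hGS
  refine ⟨this.1, this.2.trans ?_⟩
  unfold normOn
  gcongr ?_ * ?_
  refine Real.rpow_le_rpow (integral_nonneg fun _ => by positivity) ?_ (by positivity)
  exact setIntegral_mono_set (hG.integrable_abs_rpow h1)
    (.of_forall fun _ => by positivity) (.of_forall hS0)

theorem integrableOn_Ioi {r : ℝ} (hr : 0 < r) : IntegrableOn (fun s => w.σ s * G s) (Ioi r) :=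
  (integral_abs_mul_le hG hr subset_rfl).1

theorem abs_tailPrim_le {r : ℝ} (hr : 0 < r) :
    |tailPrim w.σ G r| ≤ w.normOn (Ioi r) * (∫ s in Ioi 0, |G s| ^ p) ^ (1 / p) := by
  rw [tailPrim, abs_neg]
  exact abs_integral_le_integral_abs.trans (integral_abs_mul_le hG hr subset_rfl).2

theorem intervalIntegrable {r s : ℝ} (hr : 0 < r) (hs : 0 < s) :
    IntervalIntegrable (fun s => w.σ s * G s) volume r s := by
  rw [intervalIntegrable_iff]
  have : 0 < min r s := lt_min hr hs
  refine (integrableOn_Ioi (w := w) hG (r := min r s / 2) (by positivity)).mono_set ?_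
  intro x hx
  have h := hx.1
  change min r s / 2 < x
  linarith

theorem tailPrim_eq_add {r s : ℝ} (hr : 0 < r) (hs : 0 < s) :
    tailPrim w.σ G s = tailPrim w.σ G r + ∫ x in r..s, w.σ x * G x := by
  have key : ∀ {r s : ℝ}, 0 < r → r ≤ s →
      tailPrim w.σ G s = tailPrim w.σ G r + ∫ x in r..s, w.σ x * G x := by
    intro r s hr hrs
    have h := integrableOn_Ioi (w := w) hG hr
    rw [tailPrim, tailPrim, ← Ioc_union_Ioi_eq_Ioi hrs, setIntegral_union
      (Ioc_disjoint_Ioi le_rfl) measurableSet_Ioi (h.mono_set Ioc_subset_Ioi_self)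
      (h.mono_set (Ioi_subset_Ioi hrs)), intervalIntegral.integral_of_le hrs]
    ring
  rcases le_total r s with h | h
  · exact key hr h
  · rw [key hs h, intervalIntegral.integral_symm]
    ring

theorem abs_tailPrim_sub_le {r s : ℝ} (hr : 0 < r) (hrs : r ≤ s) :
    |tailPrim w.σ G s - tailPrim w.σ G r| ≤ ∫ x in Ioc r s, |w.σ x * G x| := by
  rw [tailPrim_eq_add hG hr (hr.trans_le hrs), add_sub_cancel_left,
    intervalIntegral.integral_of_le hrs]
  exact abs_integral_le_integral_abs

theorem continuousOn_tailPrim : ContinuousOn (tailPrim w.σ G) (Ioi 0) := by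
  intro s (hs : 0 < s)
  have hr : 0 < s / 2 := by positivity
  have h := (integrableOn_Ioi (w := w) hG hr)
  have hc : ContinuousOn (fun x => ∫ t in (s / 2)..x, w.σ t * G t) (Icc (s / 2) (2 * s)) := by
    have := intervalIntegral.continuousOn_primitive_interval (a := s / 2) (b := 2 * s)
      (f := fun t => w.σ t * G t) (μ := volume) ?_
    · rwa [uIcc_of_le (by linarith)] at this
    · rw [uIcc_of_le (by linarith), integrableOn_Icc_iff_integrableOn_Ioc]
      exact h.mono_set Ioc_subset_Ioi_self
  have hmem : Icc (s / 2) (2 * s) ∈ 𝓝 s := Icc_mem_nhds (by linarith) (by linarith)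
  refine ContinuousAt.continuousWithinAt ?_
  refine ((hc.continuousAt hmem).const_add (tailPrim w.σ G (s / 2))).congr ?_
  filter_upwards [hmem] with x hx
  exact (tailPrim_eq_add hG hr (hr.trans_le hx.1)).symm

theorem tendsto_tailPrim_atTop : Tendsto (tailPrim w.σ G) atTop (𝓝 0) := by
  have h := (integrableOn_Ioi (w := w) hG one_pos)
  have ht := (intervalIntegral_tendsto_integral_Ioi 1 h tendsto_id).const_add (tailPrim w.σ G 1)
  have h0 : tailPrim w.σ G 1 + ∫ x in Ioi 1, w.σ x * G x = 0 := by simp [tailPrim]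
  rw [h0] at ht
  refine ht.congr' ?_
  filter_upwards [eventually_gt_atTop 0] with x hx
  exact (tailPrim_eq_add hG one_pos hx).symm

/-- The positive part of a primitive is the primitive of the truncated derivative. -/
theorem tailPrim_indicator_pos {r : ℝ} (hr : 0 < r) :
    tailPrim w.σ ({s | 0 < tailPrim w.σ G s}.indicator G) r = max (tailPrim w.σ G r) 0 := by
  set U := tailPrim w.σ G with hU
  set S := {s | 0 < U s} with hS
  have hopen : IsOpen (Ioi 0 ∩ S) :=
    (continuousOn_tailPrim hG).isOpen_inter_preimage isOpen_Ioi isOpen_Ioi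
  have hGS : MemLp (S.indicator G) (ENNReal.ofReal p) halfLine := by
    have hind : MemLp ((Ioi 0 ∩ S).indicator G) (ENNReal.ofReal p) halfLine :=
      hG.indicator hopen.measurableSet
    refine hind.ae_eq ?_
    filter_upwards [ae_restrict_mem measurableSet_Ioi] with x hx
    by_cases h : x ∈ S
    · rw [indicator_of_mem h, indicator_of_mem (mem_inter hx h)]
    · rw [indicator_of_notMem h, indicator_of_notMem fun h' => h h'.2]
  have hUc := continuousOn_tailPrim (w := w) hG
  -- The identity is proved on a bounded interval; `s → ∞` then removes the boundary term, since `U`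
  -- vanishes at infinity.
  have hmain : ∀ s, r ≤ s → max (U s) 0 = max (U r) 0 +
      ∫ x in r..s, w.σ x * S.indicator G x := by
    intro s hrs
    have hs : 0 < s := hr.trans_le hrs
    have hi := intervalIntegrable (w := w) hG hr hs
    have hiS := intervalIntegrable (w := w) hGS hr hs
    have hac := hi.absolutelyContinuousOnInterval_intervalIntegral (c := r) left_mem_uIcc
    have hacS := hiS.absolutelyContinuousOnInterval_intervalIntegral (c := r) left_mem_uIcc
    -- The positive part is 1-Lipschitz, so it inherits absolute continuity, and equality of
    -- derivatives almost everywhere is enough.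
    have hacV : AbsolutelyContinuousOnInterval (fun x => max (U x) 0) r s := by
      rw [absolutelyContinuousOnInterval_iff] at hac ⊢
      intro ε hε
      obtain ⟨δ, hδ, h⟩ := hac ε hε
      refine ⟨δ, hδ, fun E hE hEδ => lt_of_le_of_lt ?_ (h E hE hEδ)⟩
      refine Finset.sum_le_sum fun i hmem => ?_
      have hmem' := hE.1 i hmem
      rw [uIcc_of_le hrs] at hmem'
      rw [Real.dist_eq, Real.dist_eq]
      refine (abs_max_sub_max_le_abs _ _ _).trans_eq ?_
      rw [hU, tailPrim_eq_add hG hr (hr.trans_le hmem'.1.1),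
        tailPrim_eq_add hG hr (hr.trans_le hmem'.2.1)]
      congr 1
      ring
    have hder : ∀ᵐ x, x ∈ uIcc r s → HasDerivAt
        (fun x => max (U x) 0 - ∫ t in r..x, w.σ t * S.indicator G t) 0 x := by
      filter_upwards [hacV.ae_differentiableAt, hi.ae_hasDerivAt_integral,
        hiS.ae_hasDerivAt_integral] with x h1 h2 h3 hx
      have hx0 : 0 < x := by
        rw [uIcc_of_le hrs] at hx; exact hr.trans_le hx.1
      have hd1 : HasDerivAt U (w.σ x * G x) x := by
        refine ((h2 hx r left_mem_uIcc).const_add (U r)).congr_of_eventuallyEq ?_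
        filter_upwards [Ioi_mem_nhds hx0] with y hy
        exact tailPrim_eq_add hG hr hy
      have hd3 := h3 hx r left_mem_uIcc
      have hUx : ContinuousAt U x := hUc.continuousAt (Ioi_mem_nhds hx0)
      have hV : HasDerivAt (fun x => max (U x) 0) (w.σ x * S.indicator G x) x := by
        rcases lt_trichotomy (U x) 0 with h | h | h
        · rw [indicator_of_notMem (by simp only [hS, mem_ofPred_eq]; linarith), mul_zero]
          refine (hasDerivAt_const x (0 : ℝ)).congr_of_eventuallyEq ?_
          filter_upwards [hUx.eventually_lt continuousAt_const h] with y hy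
          exact max_eq_right hy.le
        · rw [indicator_of_notMem (by simp only [hS, mem_ofPred_eq]; linarith), mul_zero]
          -- At a zero of `U` the positive part has a minimum, so its derivative, where it exists,
          -- is zero. This settles the zero set without any knowledge of its measure.
          have hmin : IsLocalMin (fun x => max (U x) 0) x :=
            .of_forall fun y => by simp only [h, max_self]; exact le_max_right _ _
          have := (h1 hx).hasDerivAt
          rwa [hmin.deriv_eq_zero] at this
        · rw [indicator_of_mem (by exact h)]
          refine hd1.congr_of_eventuallyEq ?_
          filter_upwards [continuousAt_const.eventually_lt hUx h] with y hy
          exact max_eq_left hy.le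
      have h4 := hV.sub hd3
      rw [sub_self] at h4
      exact h4
    obtain ⟨C, hC⟩ := (hacV.sub hacS).const_of_ae_hasDerivAt_zero hder
    have c1 := hC r left_mem_uIcc
    have c2 := hC s right_mem_uIcc
    simp only [Pi.sub_apply, intervalIntegral.integral_same] at c1 c2
    linarith
  have hlim1 : Tendsto (fun s => max (U s) 0) atTop (𝓝 0) := by
    simpa using (tendsto_tailPrim_atTop (w := w) hG).max (tendsto_const_nhds (x := (0 : ℝ)))
  have hlim2 := (intervalIntegral_tendsto_integral_Ioi r (integrableOn_Ioi (w := w) hGS hr)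
    tendsto_id).const_add (max (U r) 0)
  have := tendsto_nhds_unique hlim1 (hlim2.congr' (by
    filter_upwards [eventually_ge_atTop r] with s hs
    exact (hmain s hs).symm))
  rw [tailPrim]
  linarith

end Primitive

section Space

/-- The space of the pairs `(G, κ U)`, where `U` is the primitive of `σ G` vanishing at
infinity. -/
noncomputable def space : Submodule ℝ
    (Lp ℝ (ENNReal.ofReal p) halfLine × Lp ℝ (ENNReal.ofReal p) halfLine) where
  carrier := {x | x.2 =ᵐ[halfLine] fun r => w.κ r * tailPrim w.σ x.1 r}
  zero_mem' := by
    filter_upwards [Lp.coeFn_zero ℝ (ENNReal.ofReal p) halfLine,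
      ae_restrict_mem measurableSet_Ioi] with r hr (hr0 : 0 < r)
    have : tailPrim w.σ ((0 : Lp ℝ (ENNReal.ofReal p) halfLine)) r = 0 := by
      rw [tailPrim_congr (Lp.coeFn_zero _ _ _) hr0.le]
      simp [tailPrim]
    simp only [Prod.snd_zero, Prod.fst_zero, this, hr, mul_zero, Pi.zero_apply]
  add_mem' := by
    intro x y hx hy
    filter_upwards [hx, hy, Lp.coeFn_add x.2 y.2,
      ae_restrict_mem measurableSet_Ioi] with r h1 h2 h3 (hr0 : 0 < r)
    rw [Prod.snd_add, h3, Pi.add_apply, h1, h2, Prod.fst_add,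
      tailPrim_congr (Lp.coeFn_add x.1 y.1) hr0.le, ← mul_add]
    congr 1
    simp only [tailPrim, Pi.add_apply, mul_add]
    rw [integral_add (integrableOn_Ioi (Lp.memLp x.1) hr0) (integrableOn_Ioi (Lp.memLp y.1) hr0)]
    ring
  smul_mem' := by
    intro c x hx
    filter_upwards [hx, Lp.coeFn_smul c x.2,
      ae_restrict_mem measurableSet_Ioi] with r h1 h3 (hr0 : 0 < r)
    rw [Prod.smul_snd, h3, Pi.smul_apply, h1, Prod.smul_fst,
      tailPrim_congr (Lp.coeFn_smul c x.1) hr0.le]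
    simp only [tailPrim, Pi.smul_apply, smul_eq_mul]
    have : ∀ s, w.σ s * (c * x.1 s) = c * (w.σ s * x.1 s) := fun s => by ring
    simp only [this, integral_const_mul]
    ring

/-- The radial profile of an element of the space. -/
noncomputable def eval (u : w.space) (r : ℝ) : ℝ := tailPrim w.σ u.1.1 r

variable {w}

theorem eval_add (u v : w.space) {r : ℝ} (hr : 0 < r) :
    w.eval (u + v) r = w.eval u r + w.eval v r := by
  simp only [eval, Submodule.coe_add, Prod.fst_add]
  rw [tailPrim_congr (Lp.coeFn_add u.1.1 v.1.1) hr.le]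
  simp only [tailPrim, Pi.add_apply, mul_add]
  rw [integral_add (integrableOn_Ioi (Lp.memLp u.1.1) hr) (integrableOn_Ioi (Lp.memLp v.1.1) hr)]
  ring

theorem eval_smul (c : ℝ) (u : w.space) {r : ℝ} (hr : 0 < r) :
    w.eval (c • u) r = c * w.eval u r := by
  simp only [eval, Submodule.coe_smul, Prod.smul_fst]
  rw [tailPrim_congr (Lp.coeFn_smul c u.1.1) hr.le]
  simp only [tailPrim, Pi.smul_apply, smul_eq_mul]
  have : ∀ s, w.σ s * (c * u.1.1 s) = c * (w.σ s * u.1.1 s) := fun s => by ring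
  simp only [this, integral_const_mul]
  ring

theorem eval_sub (u v : w.space) {r : ℝ} (hr : 0 < r) :
    w.eval (u - v) r = w.eval u r - w.eval v r := by
  rw [sub_eq_add_neg, ← neg_one_smul ℝ v, eval_add _ _ hr, eval_smul _ _ hr]
  ring

theorem continuousOn_eval (u : w.space) : ContinuousOn (w.eval u) (Ioi 0) :=
  continuousOn_tailPrim (Lp.memLp u.1.1)

theorem aemeasurable_eval (u : w.space) : AEMeasurable (w.eval u) halfLine :=
  (continuousOn_eval u).aemeasurable measurableSet_Ioi

theorem snd_ae_eq (u : w.space) : u.1.2 =ᵐ[halfLine] fun r => w.κ r * w.eval u r := u.2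

theorem norm_fst_le (u : w.space) : ‖u.1.1‖ ≤ ‖u‖ := _root_.norm_fst_le u.1

theorem norm_snd_le (u : w.space) : ‖u.1.2‖ ≤ ‖u‖ := _root_.norm_snd_le u.1

theorem abs_eval_sub_le (u : w.space) {r s : ℝ} (hr : 0 < r) (hrs : r ≤ s) :
    |w.eval u s - w.eval u r| ≤ w.normOn (Ioc r s) * ‖u‖ := by
  refine (abs_tailPrim_sub_le (Lp.memLp u.1.1) hr hrs).trans ?_
  refine (integral_abs_mul_le (Lp.memLp u.1.1) hr Ioc_subset_Ioi_self).2.trans ?_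
  rw [← Lp.norm_eq_integral]
  exact mul_le_mul_of_nonneg_left (norm_fst_le u) (w.normOn_nonneg _)

theorem abs_eval_le_normOn_mul (u : w.space) {r : ℝ} (hr : 0 < r) :
    |w.eval u r| ≤ w.normOn (Ioi r) * ‖u‖ := by
  refine (abs_tailPrim_le (Lp.memLp u.1.1) hr).trans ?_
  rw [← Lp.norm_eq_integral]
  exact mul_le_mul_of_nonneg_left (norm_fst_le u) (w.normOn_nonneg _)

theorem integrable_eval (u : w.space) :
    IntegrableOn (fun r => w.κ r ^ p * |w.eval u r| ^ p) (Ioi 0) ∧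
      ∫ r in Ioi 0, w.κ r ^ p * |w.eval u r| ^ p = ‖u.1.2‖ ^ p := by
  have h := (Lp.memLp u.1.2).integrable_abs_rpow hp.out
  have he : (fun r => |u.1.2 r| ^ p) =ᵐ[halfLine] fun r => w.κ r ^ p * |w.eval u r| ^ p := by
    filter_upwards [snd_ae_eq u, ae_restrict_mem measurableSet_Ioi] with r h1 (hr0 : 0 < r)
    rw [h1, abs_mul, abs_of_nonneg (w.κ_nonneg r hr0),
      Real.mul_rpow (w.κ_nonneg r hr0) (abs_nonneg _)]
  exact ⟨h.congr he, by rw [Lp.norm_rpow_eq_integral, integral_congr_ae he]⟩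

theorem exists_eval_eq {G : ℝ → ℝ} (hG : MemLp G (ENNReal.ofReal p) halfLine)
    (hW : MemLp (fun r => w.κ r * tailPrim w.σ G r) (ENNReal.ofReal p) halfLine) :
    ∃ u : w.space, u.1.1 =ᵐ[halfLine] G ∧ (∀ r, 0 < r → w.eval u r = tailPrim w.σ G r) ∧
      u.1.2 =ᵐ[halfLine] fun r => w.κ r * tailPrim w.σ G r := by
  refine ⟨⟨(hG.toLp, hW.toLp), ?_⟩, hG.coeFn_toLp, fun r hr => ?_, hW.coeFn_toLp⟩
  · change hW.toLp =ᵐ[halfLine] _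
    filter_upwards [hW.coeFn_toLp, ae_restrict_mem measurableSet_Ioi] with r h1 (hr0 : 0 < r)
    rw [h1, tailPrim_congr hG.coeFn_toLp hr0.le]
  · exact tailPrim_congr hG.coeFn_toLp hr.le

/-- `L^p` convergence of the first components gives pointwise convergence of the primitives by
Hölder, and the second components converge almost everywhere along a subsequence, so the defining
relation passes to the limit. -/
theorem isClosed_space : IsClosed (w.space : Set
    (Lp ℝ (ENNReal.ofReal p) halfLine × Lp ℝ (ENNReal.ofReal p) halfLine)) := by
  refine IsSeqClosed.isClosed fun x y hx hxy => ?_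
  have h1 : Tendsto (fun n => (x n).1) atTop (𝓝 y.1) := (continuous_fst.tendsto y).comp hxy
  have h2 : Tendsto (fun n => (x n).2) atTop (𝓝 y.2) := (continuous_snd.tendsto y).comp hxy
  obtain ⟨φ, hφ, hae⟩ := (tendstoInMeasure_of_tendsto_Lp h2).exists_seq_tendsto_ae
  have hx' : ∀ᵐ r ∂halfLine, ∀ n, (x n).2 r = w.κ r * tailPrim w.σ (x n).1 r :=
    ae_all_iff.2 hx
  change y.2 =ᵐ[halfLine] _
  filter_upwards [hae, hx', ae_restrict_mem measurableSet_Ioi] with r hr1 hr2 (hr0 : 0 < r)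
  refine tendsto_nhds_unique hr1 ?_
  simp only [hr2]
  refine Tendsto.const_mul _ (Tendsto.comp (g := fun n => tailPrim w.σ (x n).1 r) ?_
    hφ.tendsto_atTop)
  rw [tendsto_iff_dist_tendsto_zero]
  have hlim := (tendsto_iff_norm_sub_tendsto_zero.1 h1).const_mul (w.normOn (Ioi r))
  rw [mul_zero] at hlim
  refine squeeze_zero (fun _ => dist_nonneg) (fun n => ?_) hlim
  have := abs_tailPrim_le (w := w) (Lp.memLp ((x n).1 - y.1)) hr0
  rw [← Lp.norm_eq_integral, tailPrim_congr (Lp.coeFn_sub _ _) hr0.le] at this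
  refine le_trans (le_of_eq ?_) this
  simp only [tailPrim, Pi.sub_apply, mul_sub, Real.dist_eq]
  rw [integral_sub (integrableOn_Ioi (Lp.memLp (x n).1) hr0)
    (integrableOn_Ioi (Lp.memLp y.1) hr0)]
  congr 1
  ring

instance : CompleteSpace w.space := isClosed_space.completeSpace_coe

end Space

end RadialWeight

/-! ### Subcritical weights and convergence of weighted integrals. -/

namespace RadialWeight

variable {p : ℝ} [hp : Fact (1 < p)] {w : RadialWeight p}

/-- The growth `min (|t| ^ q₁) (|t| ^ q₂)`. -/
noncomputable def growth (q₁ q₂ t : ℝ) : ℝ := min (|t| ^ q₁) (|t| ^ q₂)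

theorem growth_nonneg (q₁ q₂ t : ℝ) : 0 ≤ growth q₁ q₂ t := le_min (by positivity) (by positivity)

/-- The weight `k` is subcritical for the double power `growth q₁ q₂`: elements of the unit ball of
`w.space` are bounded by `b`, and `k · b ^ (q - p)` is negligible with respect to `κ ^ p` at `0` and
at infinity. -/
structure IsSubcritical (w : RadialWeight p) (k b : ℝ → ℝ) (q₁ q₂ : ℝ) : Prop where
  lt₁ : p < q₁
  lt₂ : p < q₂
  k_pos : ∀ r, 0 < r → 0 < k r
  locallyIntegrableOn_k : LocallyIntegrableOn k (Ioi 0)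
  b_nonneg : ∀ r, 0 < r → 0 ≤ b r
  abs_eval_le : ∀ (u : w.space) (r : ℝ), 0 < r → |w.eval u r| ≤ b r * ‖u‖
  b_le : ∀ ρ P : ℝ, 0 < ρ → ∃ C, ∀ r ∈ Icc ρ P, b r ≤ C
  tail : ∀ ε > 0, ∃ ρ P : ℝ, 0 < ρ ∧ ∀ᵐ r ∂halfLine, r ∉ Icc ρ P →
    k r * min (b r ^ (q₁ - p)) (b r ^ (q₂ - p)) ≤ ε * w.κ r ^ p

/-- Functions satisfying the bounds of the sums of few elements of a ball of `w.space`. -/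
def Controlled (w : RadialWeight p) (b : ℝ → ℝ) (B : ℝ) (v : ℝ → ℝ) : Prop :=
  (∀ r, 0 < r → |v r| ≤ B * b r) ∧ IntegrableOn (fun r => w.κ r ^ p * |v r| ^ p) (Ioi 0) ∧
    ∫ r in Ioi 0, w.κ r ^ p * |v r| ^ p ≤ B

namespace IsSubcritical

variable {k b : ℝ → ℝ} {q₁ q₂ : ℝ} (hs : w.IsSubcritical k b q₁ q₂)
include hs

theorem aemeasurable_k : AEMeasurable k halfLine :=
  hs.locallyIntegrableOn_k.aestronglyMeasurable.aemeasurable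

theorem integrableOn_k {ρ P : ℝ} (hρ : 0 < ρ) : IntegrableOn k (Icc ρ P) :=
  hs.locallyIntegrableOn_k.integrableOn_compact_subset
    (fun _ hx => hρ.trans_le hx.1) isCompact_Icc

/-- Integrands such as `f(u) z` are dominated by the growth function at `|u| + |z|`, so sums of
profiles must be controlled, not only single profiles. Convexity of the power costs the factor `2 ^
p`. -/
theorem controlled (u z : w.space) {H B : ℝ} (hH : 0 ≤ H) (hu : ‖u‖ + H * ‖z‖ ≤ B)
    (hB : 2 ^ p * (‖u‖ ^ p + H ^ p * ‖z‖ ^ p) ≤ B) :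
    w.Controlled b B fun r => |w.eval u r| + H * |w.eval z r| := by
  have hp1 := hp.out
  obtain ⟨iu, eu⟩ := integrable_eval u
  obtain ⟨iz, ez⟩ := integrable_eval z
  have hint : IntegrableOn (fun r => 2 ^ p * (w.κ r ^ p * |w.eval u r| ^ p +
      H ^ p * (w.κ r ^ p * |w.eval z r| ^ p))) (Ioi 0) := (iu.add (iz.const_mul _)).const_mul _
  have hle : ∀ r, 0 < r → w.κ r ^ p * |(|w.eval u r| + H * |w.eval z r|)| ^ p ≤
      2 ^ p * (w.κ r ^ p * |w.eval u r| ^ p + H ^ p * (w.κ r ^ p * |w.eval z r| ^ p)) := by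
    intro r hr
    have h0 : 0 ≤ w.κ r ^ p := Real.rpow_nonneg (w.κ_nonneg r hr) _
    set x := |w.eval u r|
    set y := |w.eval z r|
    have hx : 0 ≤ x := abs_nonneg _
    have hy : 0 ≤ y := abs_nonneg _
    have h1 := abs_half_add_rpow_le hp1.le x (H * y)
    rw [abs_div, abs_two, Real.div_rpow (abs_nonneg _) (by norm_num),
      abs_of_nonneg hx, abs_of_nonneg (mul_nonneg hH hy), Real.mul_rpow hH hy] at h1
    have h2 : |x + H * y| ^ p ≤ 2 ^ p * (x ^ p + H ^ p * y ^ p) := by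
      have h3 : (0 : ℝ) < 2 ^ p := by positivity
      rw [← mul_div_assoc, div_le_iff₀ h3] at h1
      have : 0 ≤ |x + H * y| ^ p := by positivity
      linarith
    calc w.κ r ^ p * |x + H * y| ^ p ≤ w.κ r ^ p * (2 ^ p * (x ^ p + H ^ p * y ^ p)) := by gcongr
      _ = _ := by ring
  have hint' : IntegrableOn (fun r => w.κ r ^ p * |(|w.eval u r| + H * |w.eval z r|)| ^ p)
      (Ioi 0) := by
    refine hint.mono' ?_ ?_
    · exact ((w.aemeasurable_κ.pow_const _).mul (((aemeasurable_eval u).abs.add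
        ((aemeasurable_eval z).abs.const_mul _)).abs.pow_const _)).aestronglyMeasurable
    · filter_upwards [ae_restrict_mem measurableSet_Ioi] with r (hr : 0 < r)
      rw [Real.norm_of_nonneg (mul_nonneg (Real.rpow_nonneg (w.κ_nonneg r hr) _) (by positivity))]
      exact hle r hr
  refine ⟨fun r hr => ?_, hint', ?_⟩
  · rw [abs_of_nonneg (by positivity)]
    have h1 := hs.abs_eval_le u r hr
    have h2 := mul_le_mul_of_nonneg_left (hs.abs_eval_le z r hr) hH
    have h3 := mul_le_mul_of_nonneg_right hu (hs.b_nonneg r hr)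
    linarith
  · refine (setIntegral_mono_on hint' hint measurableSet_Ioi fun r hr => hle r hr).trans ?_
    rw [integral_const_mul, integral_add iu (iz.const_mul _), integral_const_mul, eu, ez]
    refine le_trans ?_ hB
    have h1 := Real.rpow_le_rpow (norm_nonneg _) (norm_snd_le u) (by linarith : 0 ≤ p)
    have h2 := Real.rpow_le_rpow (norm_nonneg _) (norm_snd_le z) (by linarith : 0 ≤ p)
    gcongr

/-- Uniform integrability. Outside `[ρ, P]` each power splits as `|v| ^ p |v| ^ (q - p)`; the second
factor is bounded through `b`, and `tail` turns the product with `k` into a small multiple of `κ ^ p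
|v| ^ p`. Inside, `v` is bounded and `k` is integrable. The constants do not depend on `v`. -/
theorem integrableOn_of_controlled {B M ε : ℝ} (hB : 0 ≤ B) (hM : 0 ≤ M) (hε : 0 < ε) :
    ∃ ρ P C : ℝ, 0 < ρ ∧ ∀ v Ψ : ℝ → ℝ, w.Controlled b B v → AEMeasurable Ψ halfLine →
      (∀ r, 0 < r → |Ψ r| ≤ M * growth q₁ q₂ (v r)) →
      IntegrableOn (fun r => k r * Ψ r) (Ioi 0) ∧
      ∫ r in Ioi 0 \ Icc ρ P, |k r * Ψ r| ≤ ε ∧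
      ∀ r ∈ Icc ρ P, |k r * Ψ r| ≤ C * k r := by
  have hp1 := hp.out
  set c := max (B ^ (q₁ - p)) (B ^ (q₂ - p)) with hc
  have hc0 : 0 ≤ c := le_max_of_le_left (by positivity)
  -- Chosen so that the final bound `M c B δ` is at most `ε`; the added `1` covers a vanishing
  -- product.
  set δ := ε / (M * c * B + 1) with hδ
  have hδ0 : 0 < δ := by positivity
  obtain ⟨ρ, P, hρ, htail⟩ := hs.tail δ hδ0
  obtain ⟨C, hC⟩ := hs.b_le ρ P hρ
  refine ⟨ρ, P, M * (B * C) ^ q₁, hρ, fun v Ψ hv hΨ hle => ?_⟩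
  have hsub : Icc ρ P ⊆ Ioi 0 := fun _ hx => hρ.trans_le hx.1
  have hmeas : AEStronglyMeasurable (fun r => k r * Ψ r) halfLine :=
    (hs.aemeasurable_k.mul hΨ).aestronglyMeasurable
  have hmid : ∀ r ∈ Icc ρ P, |k r * Ψ r| ≤ M * (B * C) ^ q₁ * k r := by
    intro r hr
    have hr0 := hsub hr
    rw [abs_mul, abs_of_pos (hs.k_pos r hr0), mul_comm]
    refine mul_le_mul_of_nonneg_right ((hle r hr0).trans ?_) (hs.k_pos r hr0).le
    refine mul_le_mul_of_nonneg_left ((min_le_left _ _).trans ?_) hM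
    refine Real.rpow_le_rpow (abs_nonneg _) ((hv.1 r hr0).trans ?_) (by linarith [hs.lt₁])
    exact mul_le_mul_of_nonneg_left (hC r hr) hB
  have hout : ∀ᵐ r ∂volume.restrict (Ioi 0 \ Icc ρ P),
      ‖k r * Ψ r‖ ≤ M * c * δ * (w.κ r ^ p * |v r| ^ p) := by
    have h1 : ∀ᵐ r ∂volume.restrict (Ioi 0 \ Icc ρ P), r ∉ Icc ρ P →
        k r * min (b r ^ (q₁ - p)) (b r ^ (q₂ - p)) ≤ δ * w.κ r ^ p :=
      ae_mono (Measure.restrict_mono sdiff_subset le_rfl) htail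
    filter_upwards [h1, ae_restrict_mem (measurableSet_Ioi.diff measurableSet_Icc)] with r h2 hr
    have hr0 : 0 < r := hr.1
    have h3 := h2 hr.2
    have hk := hs.k_pos r hr0
    have hb := hs.b_nonneg r hr0
    have hq : ∀ q, p < q → |v r| ^ q ≤ |v r| ^ p * (B ^ (q - p) * b r ^ (q - p)) := by
      intro q hq
      have : |v r| ^ q = |v r| ^ p * |v r| ^ (q - p) := by
        rw [← Real.rpow_add_of_nonneg (abs_nonneg _) (by linarith) (by linarith)]
        ring_nf
      rw [this, ← Real.mul_rpow hB hb]
      exact mul_le_mul_of_nonneg_left (Real.rpow_le_rpow (abs_nonneg _) (hv.1 r hr0) (by linarith))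
        (by positivity)
    have hg : growth q₁ q₂ (v r) ≤
        |v r| ^ p * (c * min (b r ^ (q₁ - p)) (b r ^ (q₂ - p))) := by
      rcases min_choice (b r ^ (q₁ - p)) (b r ^ (q₂ - p)) with h | h <;> rw [h]
      · refine (min_le_left _ _).trans ((hq q₁ hs.lt₁).trans ?_)
        gcongr
        exact le_max_left _ _
      · refine (min_le_right _ _).trans ((hq q₂ hs.lt₂).trans ?_)
        gcongr
        exact le_max_right _ _
    rw [Real.norm_eq_abs, abs_mul, abs_of_pos hk]
    calc k r * |Ψ r| ≤ k r * (M * (|v r| ^ p * (c * min (b r ^ (q₁ - p)) (b r ^ (q₂ - p))))) := by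
          gcongr
          exact (hle r hr0).trans (mul_le_mul_of_nonneg_left hg hM)
      _ = M * c * |v r| ^ p * (k r * min (b r ^ (q₁ - p)) (b r ^ (q₂ - p))) := by ring
      _ ≤ M * c * |v r| ^ p * (δ * w.κ r ^ p) := by gcongr
      _ = _ := by ring
  have hvint := hv.2.1.mono_set (sdiff_subset (s := Ioi 0) (t := Icc ρ P))
  have hiout : IntegrableOn (fun r => k r * Ψ r) (Ioi 0 \ Icc ρ P) :=
    (hvint.const_mul _).mono' (hmeas.mono_measure (Measure.restrict_mono sdiff_subset le_rfl)) hout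
  have himid : IntegrableOn (fun r => k r * Ψ r) (Icc ρ P) := by
    refine ((hs.integrableOn_k hρ).const_mul (M * (B * C) ^ q₁)).mono'
      (hmeas.mono_measure (Measure.restrict_mono hsub le_rfl)) ?_
    filter_upwards [ae_restrict_mem measurableSet_Icc] with r hr using hmid r hr
  refine ⟨?_, ?_, hmid⟩
  · have := hiout.union himid
    rwa [sdiff_union_of_subset hsub] at this
  · calc ∫ r in Ioi 0 \ Icc ρ P, |k r * Ψ r|
        ≤ ∫ r in Ioi 0 \ Icc ρ P, M * c * δ * (w.κ r ^ p * |v r| ^ p) :=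
          integral_mono_ae hiout.norm (hvint.const_mul _) hout
      _ = M * c * δ * ∫ r in Ioi 0 \ Icc ρ P, w.κ r ^ p * |v r| ^ p := integral_const_mul _ _
      _ ≤ M * c * δ * B := by
          refine mul_le_mul_of_nonneg_left (le_trans ?_ hv.2.2) (by positivity)
          refine setIntegral_mono_set hv.2.1 ?_ (.of_forall sdiff_subset)
          filter_upwards [ae_restrict_mem measurableSet_Ioi] with r hr
          exact mul_nonneg (Real.rpow_nonneg (w.κ_nonneg r hr) _) (by positivity)
      _ = M * c * B * δ := by ring
      _ ≤ ε := by
          rw [hδ, ← mul_div_assoc, div_le_iff₀ (by positivity)]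
          nlinarith [mul_nonneg (mul_nonneg hM hc0) hB]

theorem exists_integral_abs_le {B M : ℝ} (hB : 0 ≤ B) (hM : 0 ≤ M) :
    ∃ C : ℝ, ∀ v Ψ : ℝ → ℝ, w.Controlled b B v → AEMeasurable Ψ halfLine →
      (∀ r, 0 < r → |Ψ r| ≤ M * growth q₁ q₂ (v r)) →
      |∫ r in Ioi 0, k r * Ψ r| ≤ C := by
  obtain ⟨ρ, P, C, hρ, h⟩ := hs.integrableOn_of_controlled hB hM one_pos
  refine ⟨1 + ∫ r in Icc ρ P, C * k r, fun v Ψ hv hΨ hle => ?_⟩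
  obtain ⟨h1, h2, h3⟩ := h v Ψ hv hΨ hle
  have hsub : Icc ρ P ⊆ Ioi 0 := fun _ hx => hρ.trans_le hx.1
  have h1' : IntegrableOn (fun r => |k r * Ψ r|) (Ioi 0) := h1.abs
  refine abs_integral_le_integral_abs.trans ?_
  rw [← sdiff_union_of_subset hsub, setIntegral_union disjoint_sdiff_left measurableSet_Icc
    (h1'.mono_set sdiff_subset) (h1'.mono_set hsub)]
  refine add_le_add h2 ?_
  exact setIntegral_mono_on (h1'.mono_set hsub) ((hs.integrableOn_k hρ).const_mul C)
    measurableSet_Icc h3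

/-- Convergence of the integrals of controlled functions against the weight `k`. -/
theorem tendsto_integral {ι : Type*} {l : Filter ι} [l.IsCountablyGenerated] {B M : ℝ}
    (hB : 0 ≤ B) (hM : 0 ≤ M) {v Ψ : ι → ℝ → ℝ} {v₀ Ψ₀ : ℝ → ℝ}
    (hv : ∀ᶠ i in l, w.Controlled b B (v i)) (hΨ : ∀ i, AEMeasurable (Ψ i) halfLine)
    (hle : ∀ᶠ i in l, ∀ r, 0 < r → |Ψ i r| ≤ M * growth q₁ q₂ (v i r))
    (hv₀ : w.Controlled b B v₀) (hΨ₀ : AEMeasurable Ψ₀ halfLine)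
    (hle₀ : ∀ r, 0 < r → |Ψ₀ r| ≤ M * growth q₁ q₂ (v₀ r))
    (hlim : ∀ r, 0 < r → Tendsto (fun i => Ψ i r) l (𝓝 (Ψ₀ r))) :
    Tendsto (fun i => ∫ r in Ioi 0, k r * Ψ i r) l (𝓝 (∫ r in Ioi 0, k r * Ψ₀ r)) := by
  rw [Metric.tendsto_nhds]
  intro ε hε
  -- The interval is common to all indices: both tails cost at most `ε / 4`, and dominated
  -- convergence is needed only on `[ρ, P]`.
  obtain ⟨ρ, P, C, hρ, h⟩ := hs.integrableOn_of_controlled hB hM (ε := ε / 4) (by positivity)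
  have hsub : Icc ρ P ⊆ Ioi 0 := fun _ hx => hρ.trans_le hx.1
  have hsplit : ∀ {g : ℝ → ℝ}, IntegrableOn g (Ioi 0) →
      ∫ r in Ioi 0, g r = (∫ r in Ioi 0 \ Icc ρ P, g r) + ∫ r in Icc ρ P, g r := by
    intro g hg
    conv_lhs => rw [← sdiff_union_of_subset hsub]
    exact setIntegral_union disjoint_sdiff_left measurableSet_Icc (hg.mono_set sdiff_subset)
      (hg.mono_set hsub)
  have hmid : Tendsto (fun i => ∫ r in Icc ρ P, k r * Ψ i r) l
      (𝓝 (∫ r in Icc ρ P, k r * Ψ₀ r)) := by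
    refine tendsto_integral_filter_of_dominated_convergence (fun r => C * k r) ?_ ?_
      ((hs.integrableOn_k hρ).const_mul C) ?_
    · exact .of_forall fun i => ((hs.aemeasurable_k.mul (hΨ i)).mono_measure
        (Measure.restrict_mono hsub le_rfl)).aestronglyMeasurable
    · filter_upwards [hv, hle] with i h1 h2
      filter_upwards [ae_restrict_mem measurableSet_Icc] with r hr
      exact (h _ _ h1 (hΨ i) h2).2.2 r hr
    · filter_upwards [ae_restrict_mem measurableSet_Icc] with r hr
      exact (hlim r (hsub hr)).const_mul _
  obtain ⟨i₀, t₀, -⟩ := h _ _ hv₀ hΨ₀ hle₀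
  filter_upwards [hv, hle, Metric.tendsto_nhds.1 hmid (ε / 4) (by positivity)] with i h1 h2 h3
  obtain ⟨i₁, t₁, -⟩ := h _ _ h1 (hΨ i) h2
  rw [Real.dist_eq] at h3 ⊢
  rw [hsplit i₀, hsplit i₁]
  have a₀ := abs_integral_le_integral_abs (f := fun r => k r * Ψ₀ r)
    (μ := volume.restrict (Ioi 0 \ Icc ρ P))
  have a₁ := abs_integral_le_integral_abs (f := fun r => k r * Ψ i r)
    (μ := volume.restrict (Ioi 0 \ Icc ρ P))
  have b₀ := abs_le.1 (a₀.trans t₀)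
  have b₁ := abs_le.1 (a₁.trans t₁)
  have b₂ := abs_lt.1 h3
  rw [abs_lt]
  constructor <;> linarith [b₀.1, b₀.2, b₁.1, b₁.2, b₂.1, b₂.2]

end IsSubcritical

end RadialWeight

/-! ### The nonlinearity and its primitive. -/

open RadialQuasilinear (primitive)

/-- A nonnegative continuous nonlinearity vanishing on `(-∞, 0]`, with double power growth. -/
structure IsDoublePower (f : ℝ → ℝ) (M q₁ q₂ : ℝ) : Prop where
  continuous : Continuous f
  eq_zero : ∀ t ≤ 0, f t = 0
  nonneg : ∀ t, 0 ≤ f t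
  le : ∀ t, f t ≤ M * min (|t| ^ (q₁ - 1)) (|t| ^ (q₂ - 1))
  M_nonneg : 0 ≤ M
  lt₁ : 1 < q₁
  lt₂ : 1 < q₂

namespace IsDoublePower

variable {f : ℝ → ℝ} {M q₁ q₂ : ℝ} (hf : IsDoublePower f M q₁ q₂)
include hf

theorem hasDerivAt_primitive (t : ℝ) : HasDerivAt (primitive f) (f t) t :=
  intervalIntegral.integral_hasDerivAt_right (hf.continuous.intervalIntegrable _ _)
    hf.continuous.stronglyMeasurable.stronglyMeasurableAtFilter hf.continuous.continuousAt

theorem continuous_primitive : Continuous (primitive f) :=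
  continuous_iff_continuousAt.2 fun t => (hf.hasDerivAt_primitive t).continuousAt

theorem primitive_mono : Monotone (primitive f) :=
  monotone_of_deriv_nonneg (fun t => (hf.hasDerivAt_primitive t).differentiableAt)
    fun t => by rw [(hf.hasDerivAt_primitive t).deriv]; exact hf.nonneg t

omit hf in
theorem primitive_zero : primitive f 0 = 0 := by simp [primitive]

theorem primitive_of_nonpos {t : ℝ} (ht : t ≤ 0) : primitive f t = 0 := by
  rw [primitive, intervalIntegral.integral_congr (g := fun _ => 0)]
  · simp
  · intro s hs
    rw [uIcc_of_ge ht] at hs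
    exact hf.eq_zero s hs.2

theorem primitive_nonneg (t : ℝ) : 0 ≤ primitive f t := by
  rcases le_total t 0 with h | h
  · rw [hf.primitive_of_nonpos h]
  · simpa [primitive_zero] using hf.primitive_mono h

/-- The mean value theorem along a segment. It rewrites difference quotients of the primitive as
values of `f` at intermediate points, which the growth bound dominates. -/
theorem exists_sub_eq (a d : ℝ) :
    ∃ s ∈ Icc (0 : ℝ) 1, primitive f (a + d) - primitive f a = f (a + s * d) * d := by
  have hd : ∀ s : ℝ, HasDerivAt (fun s => primitive f (a + s * d)) (f (a + s * d) * d) s := by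
    intro s
    have h1 : HasDerivAt (fun s : ℝ => a + s * d) d s := by
      simpa using ((hasDerivAt_id s).mul_const d).const_add a
    exact (hf.hasDerivAt_primitive _).comp s h1
  obtain ⟨s, hs, h⟩ := exists_hasDerivAt_eq_slope (fun s => primitive f (a + s * d))
    (fun s => f (a + s * d) * d) one_pos
    (continuousOn_of_forall_continuousAt fun s _ => (hd s).continuousAt) fun s _ => hd s
  refine ⟨s, Ioo_subset_Icc_self hs, ?_⟩
  simpa using h.symm

theorem abs_mul_le {t z x : ℝ} (ht : |t| ≤ x) (hz : |z| ≤ x) :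
    |f t * z| ≤ M * RadialWeight.growth q₁ q₂ x := by
  have hx : 0 ≤ x := (abs_nonneg t).trans ht
  rw [abs_mul, abs_of_nonneg (hf.nonneg t)]
  calc f t * |z| ≤ M * min (|t| ^ (q₁ - 1)) (|t| ^ (q₂ - 1)) * |z| :=
        mul_le_mul_of_nonneg_right (hf.le t) (abs_nonneg z)
    _ = M * (min (|t| ^ (q₁ - 1)) (|t| ^ (q₂ - 1)) * |z|) := by ring
    _ ≤ M * RadialWeight.growth q₁ q₂ x := by
        refine mul_le_mul_of_nonneg_left (le_min ?_ ?_) hf.M_nonneg <;> rw [abs_of_nonneg hx]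
        · exact (mul_le_mul_of_nonneg_right (min_le_left _ _) (abs_nonneg z)).trans
            (rpow_sub_one_mul_le hf.lt₁ (abs_nonneg _) (abs_nonneg _) ht hz)
        · exact (mul_le_mul_of_nonneg_right (min_le_right _ _) (abs_nonneg z)).trans
            (rpow_sub_one_mul_le hf.lt₂ (abs_nonneg _) (abs_nonneg _) ht hz)

theorem abs_primitive_le (t : ℝ) : |primitive f t| ≤ M * RadialWeight.growth q₁ q₂ t := by
  obtain ⟨s, hs, h⟩ := hf.exists_sub_eq 0 t
  rw [zero_add, zero_add, primitive_zero, sub_zero] at h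
  rw [h]
  have h1 : |s * t| ≤ |t| := by
    rw [abs_mul, abs_of_nonneg hs.1]
    exact mul_le_of_le_one_left (abs_nonneg _) hs.2
  have := hf.abs_mul_le (x := |t|) h1 le_rfl
  simpa [RadialWeight.growth] using this

/-- The Ambrosetti–Rabinowitz inequality says that `F(t) t ^ (-θ)` is nondecreasing on `(0, ∞)`. -/
theorem exists_mul_rpow_le_primitive {θ : ℝ}
    (hAR : ∀ t, θ * primitive f t ≤ f t * t) {t₀ : ℝ} (ht₀ : 0 < t₀) (hpos : 0 < primitive f t₀) :
    ∃ c > 0, ∀ t ≥ t₀, c * t ^ θ ≤ primitive f t := by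
  have hd : ∀ t, 0 < t → HasDerivAt (fun t => primitive f t * t ^ (-θ))
      (f t * t ^ (-θ) + primitive f t * (-θ * t ^ (-θ - 1))) t := fun t ht =>
    (hf.hasDerivAt_primitive t).mul (Real.hasDerivAt_rpow_const (Or.inl ht.ne'))
  have hmono : MonotoneOn (fun t => primitive f t * t ^ (-θ)) (Ioi 0) := by
    refine monotoneOn_of_deriv_nonneg (convex_Ioi 0)
      (continuousOn_of_forall_continuousAt fun t ht => (hd t ht).continuousAt) ?_ ?_
    · rw [interior_Ioi]
      exact fun t ht => (hd t ht).differentiableAt.differentiableWithinAt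
    · rw [interior_Ioi]
      intro t (ht : 0 < t)
      rw [(hd t ht).deriv]
      have e : t ^ (-θ) = t ^ (-θ - 1) * t := by
        rw [← Real.rpow_add_one ht.ne', sub_add_cancel]
      rw [e]
      have := hAR t
      have h1 : 0 ≤ t ^ (-θ - 1) := by positivity
      nlinarith
  refine ⟨primitive f t₀ * t₀ ^ (-θ), by positivity, fun t ht => ?_⟩
  have ht0 : 0 < t := ht₀.trans_le ht
  have := hmono (show t₀ ∈ Ioi 0 from ht₀) (show t ∈ Ioi 0 from ht0) ht
  simp only at this
  calc primitive f t₀ * t₀ ^ (-θ) * t ^ θ ≤ primitive f t * t ^ (-θ) * t ^ θ := by gcongr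
    _ = primitive f t := by
        rw [mul_assoc, ← Real.rpow_add ht0, neg_add_cancel, Real.rpow_zero, mul_one]

end IsDoublePower

/-! ### Pointwise compactness of profiles and properties of the energy. -/

namespace RadialWeight

variable {p : ℝ} [hp : Fact (1 < p)] {w : RadialWeight p}

theorem tendsto_eval {ι : Type*} {l : Filter ι} {us : ι → w.space} {u : w.space}
    (h : Tendsto us l (𝓝 u)) {r : ℝ} (hr : 0 < r) :
    Tendsto (fun i => w.eval (us i) r) l (𝓝 (w.eval u r)) := by
  rw [tendsto_iff_norm_sub_tendsto_zero] at h ⊢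
  have hlim := h.const_mul (w.normOn (Ioi r))
  rw [mul_zero] at hlim
  refine squeeze_zero (fun _ => norm_nonneg _) (fun i => ?_) hlim
  rw [← eval_sub _ _ hr]
  exact abs_eval_le_normOn_mul _ hr

/-- A bounded sequence has a subsequence whose profiles converge pointwise. -/
theorem exists_subseq_eval_tendsto (us : ℕ → w.space) {B : ℝ} (hB : ∀ n, ‖us n‖ ≤ B) :
    ∃ φ : ℕ → ℕ, StrictMono φ ∧ ∀ r, 0 < r → CauchySeq fun n => w.eval (us (φ n)) r := by
  have hp1 := hp.out
  have hB0 : 0 ≤ B := (norm_nonneg _).trans (hB 0)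
  -- Convergence at all positive rationals along one subsequence, by compactness of a countable
  -- product of intervals.
  have hcpt : IsCompact (Set.pi univ fun q : {q : ℚ // 0 < q} =>
      Icc (-(w.normOn (Ioi (q.1 : ℝ)) * B)) (w.normOn (Ioi (q.1 : ℝ)) * B)) :=
    isCompact_univ_pi fun _ => isCompact_Icc
  obtain ⟨x, -, φ, hφ, hx⟩ := hcpt.tendsto_subseq
    (x := fun n (q : {q : ℚ // 0 < q}) => w.eval (us n) q.1) (by
      intro n q _
      have hq : (0 : ℝ) < q.1 := by exact_mod_cast q.2
      refine abs_le.1 ((abs_eval_le_normOn_mul (us n) hq).trans ?_)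
      exact mul_le_mul_of_nonneg_left (hB n) (w.normOn_nonneg _))
  rw [tendsto_pi_nhds] at hx
  refine ⟨φ, hφ, fun r hr => ?_⟩
  have hr1 : Icc r (r + 1) ⊆ Ioi 0 := fun _ h => hr.trans_le h.1
  obtain ⟨C, hC⟩ := isCompact_Icc.exists_bound_of_continuousOn (w.continuousOn_σ.mono hr1)
  have hC0 : 0 ≤ C := (norm_nonneg _).trans (hC r ⟨le_rfl, by linarith⟩)
  have hpp : 0 ≤ p / (p - 1) := div_nonneg (by linarith) (by linarith)
  have hpe : 0 < (p - 1) / p := div_pos (by linarith) (by linarith)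
  set C' := C ^ (p / (p - 1)) with hC'
  have hnorm : ∀ q, r ≤ q → q ≤ r + 1 → w.normOn (Ioc r q) ≤ (C' * (q - r)) ^ ((p - 1) / p) := by
    intro q h1 h2
    refine Real.rpow_le_rpow (integral_nonneg fun _ => by positivity) ?_ hpe.le
    have hb : ∀ s ∈ Ioc r q, |w.σ s| ^ (p / (p - 1)) ≤ C' := fun s hs =>
      Real.rpow_le_rpow (abs_nonneg _) (hC s ⟨hs.1.le, hs.2.trans h2⟩) hpp
    refine (setIntegral_mono_on ((w.integrableOn_rpow hr).mono_set Ioc_subset_Ioi_self)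
      (integrableOn_const (by simp)) measurableSet_Ioc hb).trans_eq ?_
    simp [h1, mul_comm]
  have hlim : Tendsto (fun q : ℝ => (C' * (q - r)) ^ ((p - 1) / p) * B) (𝓝[>] r) (𝓝 0) := by
    have hc : Continuous fun q : ℝ => (C' * (q - r)) ^ ((p - 1) / p) * B :=
      (((continuous_id.sub continuous_const).const_mul C').rpow_const
        fun _ => Or.inr hpe.le).mul_const B
    have := hc.tendsto r
    simp only [sub_self, mul_zero, Real.zero_rpow hpe.ne', zero_mul] at this
    exact this.mono_left nhdsWithin_le_nhds
  rw [Metric.cauchySeq_iff']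
  intro ε hε
  have hev := (hlim.eventually (gt_mem_nhds (show 0 < ε / 4 by positivity))).and
    (Ioo_mem_nhdsGT (show r < r + 1 by linarith))
  obtain ⟨δ, hδ, hsub⟩ := mem_nhdsGT_iff_exists_Ioo_subset.1 hev
  obtain ⟨q, hq1, hq2⟩ := exists_rat_btwn (show r < δ from hδ)
  obtain ⟨hqε, hq3, hq4⟩ := hsub ⟨hq1, hq2⟩
  have hq0 : 0 < q := by exact_mod_cast hr.trans hq1
  -- Hölder's inequality on `(r, q]` bounds the variation of the profiles uniformly in `n`, which
  -- transfers the Cauchy property from a rational `q` slightly above `r` to `r`.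
  have hclose : ∀ n, |w.eval (us n) q - w.eval (us n) r| < ε / 4 := by
    intro n
    refine (abs_eval_sub_le (us n) hr hq1.le).trans_lt (lt_of_le_of_lt ?_ hqε)
    exact mul_le_mul (hnorm q hq1.le hq4.le) (hB n) (norm_nonneg _)
      (Real.rpow_nonneg (mul_nonneg (by positivity) (by linarith)) _)
  obtain ⟨N, hN⟩ := Metric.cauchySeq_iff'.1 (hx ⟨q, hq0⟩).cauchySeq (ε / 4) (by positivity)
  refine ⟨N, fun n hn => ?_⟩
  have h1 := abs_lt.1 (hclose (φ n))
  have h2 := abs_lt.1 (hclose (φ N))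
  have h3 := hN n hn
  rw [Real.dist_eq] at h3 ⊢
  simp only [Function.comp] at h3
  have h3 := abs_lt.1 h3
  rw [abs_lt]
  constructor <;> linarith [h1.1, h1.2, h2.1, h2.2, h3.1, h3.2]

/-- The energy of an element of the space. -/
noncomputable def energy (u : w.space) : ℝ := (‖u.1.1‖ ^ p + ‖u.1.2‖ ^ p) / p

theorem continuous_energy : Continuous (energy (w := w)) := by
  have hp0 : 0 ≤ p := by linarith [hp.out]
  refine Continuous.div_const (Continuous.add ?_ ?_) p
  · exact (continuous_fst.comp continuous_subtype_val).norm.rpow_const fun _ => Or.inr hp0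
  · exact (continuous_snd.comp continuous_subtype_val).norm.rpow_const fun _ => Or.inr hp0

theorem convexOn_energy : ConvexOn ℝ univ (energy (w := w)) := by
  refine ⟨convex_univ, fun u _ v _ a b ha hb hab => ?_⟩
  have hp1 := hp.out
  have h1 := (convexOn_norm_rpow hp1.le).2 (mem_univ u.1.1) (mem_univ v.1.1) ha hb hab
  have h2 := (convexOn_norm_rpow hp1.le).2 (mem_univ u.1.2) (mem_univ v.1.2) ha hb hab
  simp only [smul_eq_mul] at h1 h2
  simp only [energy, Submodule.coe_add, Submodule.coe_smul, Prod.fst_add, Prod.snd_add,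
    Prod.smul_fst, Prod.smul_snd, smul_eq_mul]
  rw [← mul_div_assoc, ← mul_div_assoc, ← add_div]
  rw [div_le_div_iff_of_pos_right (by linarith)]
  linarith

theorem energy_smul {s : ℝ} (hs : 0 < s) (u : w.space) : energy (s • u) = s ^ p * energy u := by
  simp only [energy, Submodule.coe_smul, Prod.smul_fst, Prod.smul_snd, norm_smul,
    Real.norm_of_nonneg hs.le]
  rw [Real.mul_rpow hs.le (norm_nonneg _), Real.mul_rpow hs.le (norm_nonneg _)]
  ring

theorem mul_norm_rpow_le_energy (u : w.space) : 1 / p * ‖u‖ ^ p ≤ energy u := by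
  have hp1 := hp.out
  have h : ‖u‖ = max ‖u.1.1‖ ‖u.1.2‖ := rfl
  rw [energy, one_div_mul_eq_div]
  gcongr
  rcases max_choice ‖u.1.1‖ ‖u.1.2‖ with h' | h' <;> rw [h, h']
  · linarith [Real.rpow_nonneg (norm_nonneg u.1.2) p]
  · linarith [Real.rpow_nonneg (norm_nonneg u.1.1) p]

/-- The scalar inequality is integrated in each component. The constant `η` makes its first term at
most `ε ^ p / 2` on the ball, and `δ` does the same for the defect term; each component's defect is
bounded by the total because both are nonnegative. -/
theorem energy_uniformConvex (B ε : ℝ) (hε : 0 < ε) : ∃ δ > 0, ∀ u v : w.space, ‖u‖ ≤ B →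
    ‖v‖ ≤ B → energy u + energy v - 2 * energy ((1 / 2 : ℝ) • (u + v)) ≤ δ → ‖u - v‖ ≤ ε := by
  have hp1 := hp.out
  have hp0 : 0 < p := by linarith
  rcases lt_or_ge B 0 with hB | hB
  · exact ⟨1, one_pos, fun u v hu _ _ => absurd hu (by linarith [norm_nonneg u])⟩
  set η := ε ^ p / (4 * B ^ p + 1) with hη
  have hη0 : 0 < η := by positivity
  obtain ⟨C, hC0, hC⟩ := exists_abs_sub_rpow_le hp1 hη0
  refine ⟨ε ^ p / (2 * p * (C + 1)), by positivity, fun u v hu hv h => ?_⟩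
  have key1 := Lp.norm_half_add_rpow_le u.1.1 v.1.1
  have key2 := Lp.norm_half_add_rpow_le u.1.2 v.1.2
  simp only [energy, Submodule.coe_add, Submodule.coe_smul, Prod.fst_add, Prod.snd_add,
    Prod.smul_fst, Prod.smul_snd] at h
  set d1 := ‖u.1.1‖ ^ p + ‖v.1.1‖ ^ p - 2 * ‖(1 / 2 : ℝ) • (u.1.1 + v.1.1)‖ ^ p with hd1
  set d2 := ‖u.1.2‖ ^ p + ‖v.1.2‖ ^ p - 2 * ‖(1 / 2 : ℝ) • (u.1.2 + v.1.2)‖ ^ p with hd2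
  have hsum : d1 + d2 ≤ ε ^ p / (2 * (C + 1)) := by
    have e : (d1 + d2) / p ≤ ε ^ p / (2 * p * (C + 1)) := by
      refine le_trans (le_of_eq ?_) h
      rw [hd1, hd2]
      ring
    rw [div_le_iff₀ hp0] at e
    refine e.trans_eq ?_
    field_simp
  have hbound : ∀ {x y : ℝ}, 0 ≤ x → 0 ≤ y → x ≤ B → y ≤ B → η * (x ^ p + y ^ p) ≤ ε ^ p / 2 := by
    intro x y hx hy hxB hyB
    have h1 := Real.rpow_le_rpow hx hxB hp0.le
    have h2 := Real.rpow_le_rpow hy hyB hp0.le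
    calc η * (x ^ p + y ^ p) ≤ η * (2 * B ^ p) := by gcongr; linarith
      _ ≤ ε ^ p / 2 := by
          rw [hη, div_mul_eq_mul_div, div_le_div_iff₀ (by positivity) (by norm_num)]
          nlinarith [Real.rpow_nonneg hε.le p]
  have hdef : ∀ {d : ℝ}, d ≤ ε ^ p / (2 * (C + 1)) → C * d ≤ ε ^ p / 2 := by
    intro d hd
    calc C * d ≤ C * (ε ^ p / (2 * (C + 1))) := by gcongr
      _ ≤ ε ^ p / 2 := by
          rw [← mul_div_assoc, div_le_div_iff₀ (by positivity) (by norm_num)]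
          nlinarith [Real.rpow_nonneg hε.le p]
  have f1 : ‖u.1.1 - v.1.1‖ ^ p ≤ ε ^ p := by
    have := key1.2 η C hC
    have a1 := hbound (norm_nonneg u.1.1) (norm_nonneg v.1.1) ((norm_fst_le u).trans hu)
      ((norm_fst_le v).trans hv)
    have a2 := hdef (d := d1) (by linarith [key2.1])
    linarith
  have f2 : ‖u.1.2 - v.1.2‖ ^ p ≤ ε ^ p := by
    have := key2.2 η C hC
    have a1 := hbound (norm_nonneg u.1.2) (norm_nonneg v.1.2) ((norm_snd_le u).trans hu)
      ((norm_snd_le v).trans hv)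
    have a2 := hdef (d := d2) (by linarith [key1.1])
    linarith
  have h1 := (Real.rpow_le_rpow_iff (norm_nonneg _) hε.le hp0).1 f1
  have h2 := (Real.rpow_le_rpow_iff (norm_nonneg _) hε.le hp0).1 f2
  exact max_le h1 h2

theorem hasDerivAt_energy (u h : w.space) :
    HasDerivAt (fun t : ℝ => energy (u + t • h))
      ((∫ r in Ioi 0, |u.1.1 r| ^ (p - 2) * u.1.1 r * h.1.1 r) +
        ∫ r in Ioi 0, |u.1.2 r| ^ (p - 2) * u.1.2 r * h.1.2 r) 0 := by
  have hp0 : p ≠ 0 := by linarith [hp.out]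
  have key : ∀ f g : Lp ℝ (ENNReal.ofReal p) halfLine,
      HasDerivAt (fun t : ℝ => ‖f + t • g‖ ^ p)
        (p * ∫ r in Ioi 0, |f r| ^ (p - 2) * f r * g r) 0 := by
    intro f g
    have := hasDerivAt_integral_abs_rpow (Lp.memLp f) (Lp.memLp g)
    convert this using 2 with t
    rw [Lp.norm_rpow_eq_integral]
    refine integral_congr_ae ?_
    filter_upwards [Lp.coeFn_add f (t • g), Lp.coeFn_smul t g] with r h1 h2
    rw [h1, Pi.add_apply, h2, Pi.smul_apply, smul_eq_mul]
  have := ((key u.1.1 h.1.1).add (key u.1.2 h.1.2)).div_const p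
  rw [← mul_add, mul_div_cancel_left₀ _ hp0] at this
  exact this

end RadialWeight

/-! ### The potential energy: differentiability, compactness, behaviour near the origin. -/

namespace RadialWeight

variable {p : ℝ} [hp : Fact (1 < p)] {w : RadialWeight p} {k b f : ℝ → ℝ} {q₁ q₂ M : ℝ}

/-- The potential energy `∫ k F(u)`. -/
noncomputable def potential (k f : ℝ → ℝ) (u : w.space) : ℝ :=
  ∫ r in Ioi 0, k r * primitive f (w.eval u r)

variable (hs : w.IsSubcritical k b q₁ q₂) (hf : IsDoublePower f M q₁ q₂)
include hs

theorem IsSubcritical.exists_controlled (R : ℝ) :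
    ∃ B, 0 ≤ B ∧ w.Controlled b B (fun _ => 0) ∧ ∀ u z : w.space, ‖u‖ ≤ R → ‖z‖ ≤ R →
      w.Controlled b B fun r => |w.eval u r| + |w.eval z r| := by
  have hp0 : 0 ≤ p := by linarith [hp.out]
  refine ⟨2 * |R| + 2 ^ p * (2 * |R| ^ p), by positivity, ⟨fun r hr => ?_, ?_, ?_⟩,
    fun u z hu hz => ?_⟩
  · rw [abs_zero]
    exact mul_nonneg (by positivity) (hs.b_nonneg r hr)
  · simp [Real.zero_rpow (by linarith [hp.out] : p ≠ 0)]
  · simp only [abs_zero, Real.zero_rpow (by linarith [hp.out] : p ≠ 0), mul_zero, integral_zero]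
    positivity
  · have hu' := hu.trans (le_abs_self R)
    have hz' := hz.trans (le_abs_self R)
    have h1 := Real.rpow_le_rpow (norm_nonneg _) hu' hp0
    have h2 := Real.rpow_le_rpow (norm_nonneg _) hz' hp0
    have h3 : 0 ≤ |R| := abs_nonneg R
    have h4 : (0 : ℝ) < 2 ^ p := by positivity
    have h5 : 0 ≤ |R| ^ p := by positivity
    have := hs.controlled u z (H := 1) (B := 2 * |R| + 2 ^ p * (2 * |R| ^ p)) zero_le_one
      (by nlinarith) (by
        rw [Real.one_rpow, one_mul]
        nlinarith)
    simpa using this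

include hf

theorem integrableOn_mul_nonlinearity (u z : w.space) :
    IntegrableOn (fun r => k r * (f (w.eval u r) * w.eval z r)) (Ioi 0) := by
  obtain ⟨B, hB, -, h⟩ := hs.exists_controlled (max ‖u‖ ‖z‖)
  obtain ⟨ρ, P, C, -, h'⟩ := hs.integrableOn_of_controlled hB hf.M_nonneg one_pos
  refine (h' _ _ (h u z (le_max_left _ _) (le_max_right _ _)) ?_ fun r hr => ?_).1
  · exact (hf.continuous.measurable.comp_aemeasurable (aemeasurable_eval u)).mul
      (aemeasurable_eval z)
  · exact hf.abs_mul_le (le_add_of_nonneg_right (abs_nonneg _))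
      (le_add_of_nonneg_left (abs_nonneg _))

theorem integrableOn_mul_primitive (u : w.space) :
    IntegrableOn (fun r => k r * primitive f (w.eval u r)) (Ioi 0) := by
  obtain ⟨B, hB, -, h⟩ := hs.exists_controlled ‖u‖
  obtain ⟨ρ, P, C, -, h'⟩ := hs.integrableOn_of_controlled hB hf.M_nonneg one_pos
  refine (h' _ _ (h u 0 le_rfl (by simp)) ?_ fun r hr => ?_).1
  · exact hf.continuous_primitive.measurable.comp_aemeasurable (aemeasurable_eval u)
  · have : w.eval 0 r = 0 := by
      have := eval_smul (0 : ℝ) u hr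
      simpa using this
    have := hf.abs_primitive_le (w.eval u r)
    simpa [growth, *] using this

/-- The derivative of the potential energy. -/
noncomputable def potentialDeriv (u : w.space) : w.space →ₗ[ℝ] ℝ where
  toFun z := ∫ r in Ioi 0, k r * (f (w.eval u r) * w.eval z r)
  map_add' x y := by
    rw [← integral_add (integrableOn_mul_nonlinearity hs hf u x)
      (integrableOn_mul_nonlinearity hs hf u y)]
    refine setIntegral_congr_fun measurableSet_Ioi fun r (hr : 0 < r) => ?_
    simp only [eval_add _ _ hr]
    ring
  map_smul' c x := by
    rw [RingHom.id_apply, smul_eq_mul, ← integral_const_mul]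
    refine setIntegral_congr_fun measurableSet_Ioi fun r (hr : 0 < r) => ?_
    simp only [eval_smul _ _ hr]
    ring

theorem potentialDeriv_apply (u z : w.space) : potentialDeriv hs hf u z =
    ∫ r in Ioi 0, k r * (f (w.eval u r) * w.eval z r) := rfl

theorem tendsto_potentialDeriv {ι : Type*} {l : Filter ι} [l.IsCountablyGenerated]
    {us zs : ι → w.space} {u z : w.space} (hus : Tendsto us l (𝓝 u)) (hzs : Tendsto zs l (𝓝 z)) :
    Tendsto (fun i => potentialDeriv hs hf (us i) (zs i)) l (𝓝 (potentialDeriv hs hf u z)) := by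
  obtain ⟨B, hB, -, h⟩ := hs.exists_controlled (max ‖u‖ ‖z‖ + 1)
  have hu : ∀ᶠ i in l, ‖us i‖ < max ‖u‖ ‖z‖ + 1 :=
    hus.norm.eventually (gt_mem_nhds ((le_max_left ‖u‖ ‖z‖).trans_lt (lt_add_one _)))
  have hz : ∀ᶠ i in l, ‖zs i‖ < max ‖u‖ ‖z‖ + 1 :=
    hzs.norm.eventually (gt_mem_nhds ((le_max_right ‖u‖ ‖z‖).trans_lt (lt_add_one _)))
  have hmeas : ∀ u z : w.space, AEMeasurable (fun r => f (w.eval u r) * w.eval z r) halfLine :=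
    fun u z => (hf.continuous.measurable.comp_aemeasurable (aemeasurable_eval u)).mul
      (aemeasurable_eval z)
  have hle : ∀ u z : w.space, ∀ r, |f (w.eval u r) * w.eval z r| ≤
      M * growth q₁ q₂ (|w.eval u r| + |w.eval z r|) := fun u z r =>
    hf.abs_mul_le (le_add_of_nonneg_right (abs_nonneg _)) (le_add_of_nonneg_left (abs_nonneg _))
  simp only [potentialDeriv_apply]
  refine hs.tendsto_integral hB hf.M_nonneg (v := fun i r => |w.eval (us i) r| + |w.eval (zs i) r|)
    (v₀ := fun r => |w.eval u r| + |w.eval z r|)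
    (Ψ := fun i r => f (w.eval (us i) r) * w.eval (zs i) r)
    ?_ (fun i => hmeas _ _) (.of_forall fun i r _ => hle _ _ r) ?_ (hmeas u z)
    (fun r _ => hle u z r) ?_
  · filter_upwards [hu, hz] with x h1 h2 using h _ _ h1.le h2.le
  · exact h u z ((le_max_left _ _).trans (by linarith)) ((le_max_right _ _).trans (by linarith))
  · intro r hr
    exact ((hf.continuous.tendsto _).comp (tendsto_eval hus hr)).mul (tendsto_eval hzs hr)

theorem continuous_potentialDeriv :
    Continuous fun x : w.space × w.space => potentialDeriv hs hf x.1 x.2 :=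
  continuous_iff_continuousAt.2 fun _ =>
    tendsto_potentialDeriv hs hf continuousAt_fst continuousAt_snd

/-- By the mean value theorem the quotients are integrals of `f` at an intermediate point times `z`.
Once `h < 1` they are dominated by the growth at `|u| + |z|`, and they converge pointwise, so
`tendsto_integral` applies. -/
theorem hasSeqStrictDeriv_potential :
    HasSeqStrictDeriv (potential (w := w) k f) (potentialDeriv hs hf) := by
  intro u z us zs h hus hzs hpos hlim
  obtain ⟨B, hB, -, hctrl⟩ := hs.exists_controlled (max ‖u‖ ‖z‖ + 1)
  have hu : ∀ᶠ n in atTop, ‖us n‖ < max ‖u‖ ‖z‖ + 1 :=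
    hus.norm.eventually (gt_mem_nhds ((le_max_left ‖u‖ ‖z‖).trans_lt (lt_add_one _)))
  have hz : ∀ᶠ n in atTop, ‖zs n‖ < max ‖u‖ ‖z‖ + 1 :=
    hzs.norm.eventually (gt_mem_nhds ((le_max_right ‖u‖ ‖z‖).trans_lt (lt_add_one _)))
  have hh : ∀ᶠ n in atTop, h n < 1 := hlim.eventually (gt_mem_nhds one_pos)
  choose s hs01 hseq using fun n r =>
    hf.exists_sub_eq (w.eval (us n) r) (h n * w.eval (zs n) r)
  have hΨ : ∀ n r, (primitive f (w.eval (us n) r + h n * w.eval (zs n) r)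
      - primitive f (w.eval (us n) r)) / h n
      = f (w.eval (us n) r + s n r * (h n * w.eval (zs n) r)) * w.eval (zs n) r := by
    intro n r
    rw [hseq, div_eq_iff (hpos n).ne']
    ring
  have hquot : ∀ n, (potential k f (us n + h n • zs n) - potential k f (us n)) / h n =
      ∫ r in Ioi 0, k r * ((primitive f (w.eval (us n) r + h n * w.eval (zs n) r)
        - primitive f (w.eval (us n) r)) / h n) := by
    intro n
    rw [potential, potential, ← integral_sub (integrableOn_mul_primitive hs hf _)
      (integrableOn_mul_primitive hs hf _), ← integral_div]
    refine setIntegral_congr_fun measurableSet_Ioi fun r (hr : 0 < r) => ?_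
    simp only [eval_add _ _ hr, eval_smul _ _ hr]
    ring
  simp only [hquot]
  refine hs.tendsto_integral hB hf.M_nonneg
    (v := fun n r => |w.eval (us n) r| + |w.eval (zs n) r|)
    (v₀ := fun r => |w.eval u r| + |w.eval z r|) (Ψ₀ := fun r => f (w.eval u r) * w.eval z r)
    ?_ (fun n => ?_) ?_ ?_ ?_ (fun r _ => ?_) (fun r hr => ?_)
  · filter_upwards [hu, hz] with n h1 h2 using hctrl _ _ h1.le h2.le
  · have m1 := aemeasurable_eval (us n)
    have m2 := aemeasurable_eval (zs n)
    have mF := hf.continuous_primitive.measurable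
    exact ((mF.comp_aemeasurable (m1.add (m2.const_mul _))).sub
      (mF.comp_aemeasurable m1)).div_const _
  · filter_upwards [hh] with n hn r _
    rw [hΨ]
    refine hf.abs_mul_le ?_ (le_add_of_nonneg_left (abs_nonneg _))
    refine (abs_add_le _ _).trans (add_le_add le_rfl ?_)
    rw [abs_mul, abs_mul, abs_of_nonneg (hs01 n r).1, abs_of_pos (hpos n), ← mul_assoc]
    refine mul_le_of_le_one_left (abs_nonneg _) ?_
    exact mul_le_one₀ (hs01 n r).2 (hpos n).le hn.le
  · exact hctrl u z ((le_max_left _ _).trans (by linarith)) ((le_max_right _ _).trans (by linarith))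
  · exact (hf.continuous.measurable.comp_aemeasurable (aemeasurable_eval u)).mul
      (aemeasurable_eval z)
  · exact hf.abs_mul_le (le_add_of_nonneg_right (abs_nonneg _))
      (le_add_of_nonneg_left (abs_nonneg _))
  · simp only [hΨ]
    have e1 := tendsto_eval hus hr
    have e2 := tendsto_eval hzs hr
    refine Tendsto.mul ?_ e2
    refine (hf.continuous.tendsto _).comp ?_
    have e3 : Tendsto (fun n => s n r * (h n * w.eval (zs n) r)) atTop (𝓝 0) := by
      have e4 : Tendsto (fun n => h n * w.eval (zs n) r) atTop (𝓝 0) := by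
        simpa using hlim.mul e2
      have e5 := e4.norm
      rw [norm_zero] at e5
      refine squeeze_zero_norm (fun n => ?_) e5
      rw [norm_mul, Real.norm_of_nonneg (hs01 n r).1]
      exact mul_le_of_le_one_left (norm_nonneg _) (hs01 n r).2
    simpa using e1.add e3

theorem continuous_potential : Continuous (potential (w := w) k f) := by
  rw [continuous_iff_continuousAt]
  intro u
  obtain ⟨B, hB, -, h⟩ := hs.exists_controlled (‖u‖ + 1)
  have h0 : ∀ r, 0 < r → w.eval 0 r = 0 := fun r hr => by
    simpa using eval_smul (0 : ℝ) u hr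
  have hu : ∀ᶠ x : w.space in 𝓝 u, ‖x‖ < ‖u‖ + 1 :=
    (continuous_norm.continuousAt).eventually_lt continuousAt_const (lt_add_one _)
  have hmeas : ∀ x : w.space, AEMeasurable (fun r => primitive f (w.eval x r)) halfLine := fun x =>
    hf.continuous_primitive.measurable.comp_aemeasurable (aemeasurable_eval x)
  have hle : ∀ x : w.space, ∀ r, 0 < r → |primitive f (w.eval x r)| ≤
      M * growth q₁ q₂ (|w.eval x r| + |w.eval 0 r|) := fun x r hr => by
    have := hf.abs_primitive_le (w.eval x r)
    simpa [growth, h0 r hr] using this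
  -- The zero profile is added only to match the two-term shape of `exists_controlled`.
  refine hs.tendsto_integral hB hf.M_nonneg (v := fun x r => |w.eval x r| + |w.eval 0 r|)
    (v₀ := fun r => |w.eval u r| + |w.eval 0 r|)
    (Ψ := fun x r => primitive f (w.eval x r))
    ?_ hmeas (.of_forall hle) ?_ (hmeas u) (hle u) ?_
  · filter_upwards [hu] with x h1 using h _ _ h1.le (by simp; positivity)
  · exact h u 0 (by linarith) (by simp; positivity)
  · intro r hr
    exact (hf.continuous_primitive.tendsto _).comp (tendsto_eval tendsto_id hr)

theorem mul_potential_le {θ : ℝ} (hAR : ∀ t, θ * primitive f t ≤ f t * t) (u : w.space) :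
    θ * potential k f u ≤ potentialDeriv hs hf u u := by
  rw [potential, ← integral_const_mul]
  refine setIntegral_mono_on ((integrableOn_mul_primitive hs hf u).const_mul θ)
    (integrableOn_mul_nonlinearity hs hf u u) measurableSet_Ioi fun r hr => ?_
  rw [mul_left_comm]
  exact mul_le_mul_of_nonneg_left (hAR _) (hs.k_pos r hr).le

/-- Along a pointwise Cauchy subsequence `f(u_n) (u_m - u_n)` tends to zero pointwise as both
indices grow. The convergence theorem is applied with pairs `(n, m)` as index set, so no weak limit
is required. -/
theorem potentialDeriv_compact (us : ℕ → w.space) (B : ℝ) (hB : ∀ n, ‖us n‖ ≤ B) :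
    ∃ φ : ℕ → ℕ, StrictMono φ ∧ ∀ ε > 0, ∃ n₀, ∀ n ≥ n₀, ∀ m ≥ n₀,
      |potentialDeriv hs hf (us (φ n)) (us (φ m) - us (φ n))| ≤ ε := by
  obtain ⟨φ, hφ, hlim⟩ := exists_subseq_eval_tendsto us hB
  refine ⟨φ, hφ, fun ε hε => ?_⟩
  obtain ⟨B', hB', hzero, h⟩ := hs.exists_controlled (2 * B)
  have hB0 : 0 ≤ B := (norm_nonneg _).trans (hB 0)
  let Z : ℕ × ℕ → w.space := fun x => us (φ x.2) - us (φ x.1)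
  have hle : ∀ x : ℕ × ℕ, ∀ r, |f (w.eval (us (φ x.1)) r) * w.eval (Z x) r| ≤
      M * growth q₁ q₂ (|w.eval (us (φ x.1)) r| + |w.eval (Z x) r|) := fun x r =>
    hf.abs_mul_le (le_add_of_nonneg_right (abs_nonneg _)) (le_add_of_nonneg_left (abs_nonneg _))
  have key := hs.tendsto_integral (l := (atTop : Filter (ℕ × ℕ))) hB' hf.M_nonneg
    (v := fun x r => |w.eval (us (φ x.1)) r| + |w.eval (Z x) r|) (v₀ := fun _ => 0)
    (Ψ := fun x r => f (w.eval (us (φ x.1)) r) * w.eval (Z x) r) (Ψ₀ := fun _ => 0)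
    (.of_forall fun x => h _ _ (by linarith [hB (φ x.1)])
      (by linarith [norm_sub_le (us (φ x.2)) (us (φ x.1)), hB (φ x.1), hB (φ x.2)]))
    (fun x => (hf.continuous.measurable.comp_aemeasurable (aemeasurable_eval _)).mul
      (aemeasurable_eval _)) (.of_forall fun x r _ => hle x r) hzero aemeasurable_const
    (fun r _ => by
      rw [abs_zero]
      exact mul_nonneg hf.M_nonneg (growth_nonneg _ _ _)) (by
      intro r hr
      obtain ⟨x, hx⟩ := cauchySeq_tendsto_of_complete (hlim r hr)
      rw [← prod_atTop_atTop_eq]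
      have h1 : Tendsto (fun y : ℕ × ℕ => w.eval (us (φ y.1)) r) (atTop ×ˢ atTop) (𝓝 x) :=
        hx.comp tendsto_fst
      have h2 : Tendsto (fun y : ℕ × ℕ => w.eval (us (φ y.2)) r) (atTop ×ˢ atTop) (𝓝 x) :=
        hx.comp tendsto_snd
      simp only [Z, eval_sub _ _ hr]
      simpa using ((hf.continuous.tendsto x).comp h1).mul (h2.sub h1))
  simp only [mul_zero, integral_zero] at key
  obtain ⟨⟨n₀, m₀⟩, hn⟩ := eventually_atTop.1 (Metric.tendsto_nhds.1 key ε hε)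
  refine ⟨max n₀ m₀, fun n hn1 m hm1 => ?_⟩
  have := hn (n, m) ⟨(le_max_left _ _).trans hn1, (le_max_right _ _).trans hm1⟩
  rw [Real.dist_eq, sub_zero] at this
  exact this.le

/-- The mountain pass geometry near the origin. -/
theorem exists_sphere_le (hq : p < min q₁ q₂) :
    ∃ ρ > 0, ∃ α > 0, ∀ u : w.space, ‖u‖ = ρ → α ≤ energy u - potential k f u := by
  have hp1 := hp.out
  have hp0 : 0 < p := by linarith
  obtain ⟨B, hB, -, hctrl⟩ := hs.exists_controlled 1
  obtain ⟨C, hC⟩ := hs.exists_integral_abs_le hB hf.M_nonneg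
  set q := min q₁ q₂ with hqdef
  have hlim : Tendsto (fun ρ : ℝ => ρ ^ (q - p) * C) (𝓝[>] 0) (𝓝 0) := by
    have hc : ContinuousAt (fun ρ : ℝ => ρ ^ (q - p) * C) 0 :=
      (Real.continuousAt_rpow_const _ _ (Or.inr (by linarith))).mul_const C
    have := hc.tendsto
    simp only [Real.zero_rpow (by linarith : q - p ≠ 0), zero_mul] at this
    exact this.mono_left nhdsWithin_le_nhds
  obtain ⟨ρ, hρ1, hρ2⟩ := ((hlim.eventually
    (gt_mem_nhds (show 0 < 1 / (2 * p) by positivity))).and (Ioo_mem_nhdsGT one_pos)).exists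
  have hρ0 : 0 < ρ := hρ2.1
  refine ⟨ρ, hρ0, ρ ^ p / (2 * p), by positivity, fun u hu => ?_⟩
  -- For `ρ < 1` the growth function at `ρ t` is at most `ρ ^ q` times its value at `t`, with `q =
  -- min q₁ q₂`. A bound on the unit sphere thus yields a potential of order `ρ ^ q`, negligible
  -- against `ρ ^ p`.
  set v := ρ⁻¹ • u with hv
  have hv1 : ‖v‖ = 1 := by
    rw [hv, norm_smul, hu, Real.norm_of_nonneg (by positivity), inv_mul_cancel₀ hρ0.ne']
  have huv : ∀ r, 0 < r → w.eval u r = ρ * w.eval v r := by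
    intro r hr
    rw [hv, eval_smul _ _ hr, mul_inv_cancel_left₀ hρ0.ne']
  have h0 : ∀ r, 0 < r → w.eval 0 r = 0 := fun r hr => by
    simpa using eval_smul (0 : ℝ) u hr
  have hbound := hC _ (fun r => (ρ ^ q)⁻¹ * primitive f (w.eval u r))
    (hctrl v 0 hv1.le (by simp))
    ((hf.continuous_primitive.measurable.comp_aemeasurable (aemeasurable_eval u)).const_mul _) (by
      intro r hr
      rw [h0 r hr, abs_zero, add_zero, abs_mul, abs_of_pos (by positivity),
        inv_mul_le_iff₀ (by positivity)]
      refine (hf.abs_primitive_le _).trans ?_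
      rw [mul_left_comm]
      refine mul_le_mul_of_nonneg_left ?_ hf.M_nonneg
      have hpow : ∀ s, q ≤ s → |w.eval u r| ^ s ≤ ρ ^ q * |(|w.eval v r|)| ^ s := by
        intro s hs'
        rw [huv r hr, abs_mul, abs_of_pos hρ0, abs_abs, Real.mul_rpow hρ0.le (abs_nonneg _)]
        refine mul_le_mul_of_nonneg_right ?_ (by positivity)
        exact Real.rpow_le_rpow_of_exponent_ge hρ0 hρ2.2.le hs'
      unfold growth
      rw [mul_min_of_nonneg _ _ (by positivity)]
      exact min_le_min (hpow _ (min_le_left _ _)) (hpow _ (min_le_right _ _)))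
  have hpot : potential k f u ≤ ρ ^ q * C := by
    have e : ∀ r, k r * ((ρ ^ q)⁻¹ * primitive f (w.eval u r))
        = (ρ ^ q)⁻¹ * (k r * primitive f (w.eval u r)) := fun r => by ring
    simp only [e, integral_const_mul] at hbound
    have := (le_abs_self _).trans hbound
    rwa [inv_mul_le_iff₀ (by positivity)] at this
  have hen := mul_norm_rpow_le_energy u
  rw [hu] at hen
  have hsplit : ρ ^ q * C = ρ ^ p * (ρ ^ (q - p) * C) := by
    rw [← mul_assoc, ← Real.rpow_add hρ0]
    ring_nf
  have h1 : ρ ^ q * C ≤ ρ ^ p * (1 / (2 * p)) := by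
    rw [hsplit]; exact mul_le_mul_of_nonneg_left hρ1.le (by positivity)
  have h2 : 1 / p * ρ ^ p = ρ ^ p / (2 * p) + ρ ^ p * (1 / (2 * p)) := by
    field_simp
    norm_num
  linarith

end RadialWeight

/-! ### Mountain pass geometry, positivity, and the one-dimensional solution. -/

namespace RadialWeight

variable {p : ℝ} [hp : Fact (1 < p)] {w : RadialWeight p}

/-- A continuous function supported in a compact interval of `(0, ∞)`, times a weight that is
locally `p`-integrable, is `p`-integrable. -/
theorem memLp_of_support {g c : ℝ → ℝ} {C ρ P : ℝ} (hρ : 0 < ρ) (hg : AEMeasurable g halfLine)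
    (hc : LocallyIntegrableOn c (Ioi 0)) (hle : ∀ r, 0 < r → |g r| ^ p ≤ C * c r)
    (hsupp : ∀ r, 0 < r → r ∉ Icc ρ P → g r = 0) : MemLp g (ENNReal.ofReal p) halfLine := by
  have hp1 := hp.out
  rw [← integrable_abs_rpow_iff hp1 hg.aestronglyMeasurable]
  have hsub : Icc ρ P ⊆ Ioi 0 := fun _ hx => hρ.trans_le hx.1
  have hint : IntegrableOn ((Icc ρ P).indicator fun r => C * c r) (Ioi 0) :=
    (IntegrableOn.integrable_indicator ((hc.integrableOn_compact_subset hsub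
      isCompact_Icc).const_mul C) measurableSet_Icc).integrableOn
  refine hint.mono' (hg.abs.pow_const _).aestronglyMeasurable ?_
  filter_upwards [ae_restrict_mem measurableSet_Ioi] with r (hr : 0 < r)
  rw [Real.norm_of_nonneg (by positivity)]
  by_cases h : r ∈ Icc ρ P
  · rw [indicator_of_mem h]; exact hle r hr
  · rw [indicator_of_notMem h, hsupp r hr h, abs_zero, Real.zero_rpow (by linarith)]

theorem setIntegral_Ioi_indicator_Ioc {a b r : ℝ} :
    ∫ s in Ioi r, (Ioc a b).indicator (fun _ => (1 : ℝ)) s = max (b - max r a) 0 := by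
  rw [setIntegral_indicator measurableSet_Ioc, inter_comm, Ioc_inter_Ioi]
  simp [sup_comm]

/-- An element of the space whose profile is a trapezoidal bump. -/
theorem exists_bump (w : RadialWeight p) : ∃ u : w.space, ∀ r ∈ Icc (2 : ℝ) 3, w.eval u r = 1 := by
  have hp0 : 0 < p := by linarith [hp.out]
  -- The derivative of the trapezoid that rises on `(1, 2]`, equals `1` on `[2, 3]` and falls on
  -- `(3, 4]`.
  set h : ℝ → ℝ := fun s =>
    (Ioc (1 : ℝ) 2).indicator (fun _ => (1 : ℝ)) s - (Ioc (3 : ℝ) 4).indicator (fun _ => (1 : ℝ)) s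
    with hh
  have hmeas : Measurable h :=
    (measurable_const.indicator measurableSet_Ioc).sub (measurable_const.indicator measurableSet_Ioc)
  have hle : ∀ s, |h s| ≤ 1 := by
    intro s
    simp only [hh, indicator, mem_Ioc]
    split_ifs <;> norm_num
  have hsupp : ∀ s, s ∉ Icc (1 : ℝ) 4 → h s = 0 := by
    intro s hs
    rw [mem_Icc, not_and_or] at hs
    simp only [hh]
    rw [indicator_of_notMem, indicator_of_notMem, sub_zero]
    · rintro ⟨a, b⟩
      rcases hs with hs | hs
      · exact hs (by linarith)
      · exact hs b
    · rintro ⟨a, b⟩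
      rcases hs with hs | hs
      · exact hs a.le
      · exact hs (by linarith)
  have hcont : ContinuousOn (fun s => (w.σ s)⁻¹) (Ioi 0) :=
    w.continuousOn_σ.inv₀ fun s hs => (w.σ_pos s hs).ne'
  have hcontp : ContinuousOn (fun s => (w.σ s)⁻¹ ^ p) (Ioi 0) :=
    hcont.rpow_const fun _ _ => Or.inr hp0.le
  have hG : MemLp (fun s => (w.σ s)⁻¹ * h s) (ENNReal.ofReal p) halfLine := by
    refine memLp_of_support (C := 1) (P := 4) one_pos ((hcont.aemeasurable measurableSet_Ioi).mul
      hmeas.aemeasurable) (hcontp.locallyIntegrableOn measurableSet_Ioi) (fun r hr => ?_)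
      fun r _ hr' => by rw [hsupp r hr', mul_zero]
    have hpos : 0 < (w.σ r)⁻¹ := inv_pos.2 (w.σ_pos r hr)
    rw [one_mul, abs_mul, abs_of_pos hpos]
    exact Real.rpow_le_rpow (by positivity) (mul_le_of_le_one_right hpos.le (hle r)) hp0.le
  have hU : ∀ r, 0 < r → tailPrim w.σ (fun s => (w.σ s)⁻¹ * h s) r =
      max (4 - max r 3) 0 - max (2 - max r 1) 0 := by
    intro r hr
    have h1 : ∫ s in Ioi r, w.σ s * ((w.σ s)⁻¹ * h s) = ∫ s in Ioi r, h s := by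
      refine setIntegral_congr_fun measurableSet_Ioi fun s (hs : r < s) => ?_
      rw [mul_inv_cancel_left₀ (w.σ_pos s (hr.trans hs)).ne']
    have hi : ∀ a b : ℝ, IntegrableOn ((Ioc a b).indicator fun _ => (1 : ℝ)) (Ioi r) := fun a b =>
      ((integrableOn_const (by simp)).integrable_indicator measurableSet_Ioc).integrableOn
    rw [tailPrim, h1, hh, integral_sub (hi _ _) (hi _ _), setIntegral_Ioi_indicator_Ioc,
      setIntegral_Ioi_indicator_Ioc]
    ring
  have hUle : ∀ r : ℝ, |max (4 - max r 3) 0 - max (2 - max r 1) 0| ≤ 1 := by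
    intro r
    rw [abs_le]
    constructor <;> grind
  have hUsupp : ∀ r : ℝ, r ∉ Icc (1 : ℝ) 4 → max (4 - max r 3) 0 - max (2 - max r 1) 0 = 0 := by
    intro r hr
    rw [mem_Icc, not_and_or] at hr
    grind
  have hW : MemLp (fun r => w.κ r * tailPrim w.σ (fun s => (w.σ s)⁻¹ * h s) r)
      (ENNReal.ofReal p) halfLine := by
    refine memLp_of_support (C := 1) (P := 4) one_pos (w.aemeasurable_κ.mul
      ((continuousOn_tailPrim hG).aemeasurable measurableSet_Ioi)) w.locallyIntegrableOn_κ
      (fun r hr => ?_) fun r hr hr' => by rw [hU r hr, hUsupp r hr', mul_zero]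
    rw [hU r hr, one_mul, abs_mul, abs_of_nonneg (w.κ_nonneg r hr)]
    exact Real.rpow_le_rpow (mul_nonneg (w.κ_nonneg r hr) (abs_nonneg _))
      (mul_le_of_le_one_right (w.κ_nonneg r hr) (hUle r)) hp0.le
  obtain ⟨u, -, hu, -⟩ := exists_eval_eq hG hW
  refine ⟨u, fun r hr => ?_⟩
  rw [hu r (by linarith [hr.1]), hU r (by linarith [hr.1])]
  have h1 := hr.1
  have h2 := hr.2
  grind

/-- The positive part acts on the space and does not increase the energy; the energy decreases
strictly unless the profile is nonnegative. -/
theorem exists_posPart (u : w.space) : ∃ v : w.space,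
    (∀ r, 0 < r → w.eval v r = max (w.eval u r) 0) ∧
    (energy u ≤ energy v → ∀ r, 0 < r → 0 ≤ w.eval u r) := by
  have hp1 := hp.out
  have hp0 : 0 < p := by linarith
  set S := {s | 0 < tailPrim w.σ u.1.1 s} with hS
  have hle : ∀ r, |S.indicator u.1.1 r| ≤ |u.1.1 r| := fun r => by
    by_cases h : r ∈ S
    · rw [indicator_of_mem h]
    · rw [indicator_of_notMem h, abs_zero]; positivity
  have hopen : IsOpen (Ioi 0 ∩ S) :=
    (continuousOn_tailPrim (Lp.memLp u.1.1)).isOpen_inter_preimage isOpen_Ioi isOpen_Ioi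
  have hGm : AEStronglyMeasurable (S.indicator u.1.1) halfLine := by
    have := (Lp.aestronglyMeasurable u.1.1).indicator hopen.measurableSet
    refine this.congr ?_
    filter_upwards [ae_restrict_mem measurableSet_Ioi] with x hx
    by_cases h : x ∈ S
    · rw [indicator_of_mem h, indicator_of_mem (mem_inter hx h)]
    · rw [indicator_of_notMem h, indicator_of_notMem fun h' => h h'.2]
  have hG : MemLp (S.indicator u.1.1) (ENNReal.ofReal p) halfLine :=
    (Lp.memLp u.1.1).mono hGm (.of_forall hle)
  have hU : ∀ r, 0 < r → tailPrim w.σ (S.indicator u.1.1) r = max (w.eval u r) 0 := fun r hr =>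
    tailPrim_indicator_pos (Lp.memLp u.1.1) hr
  have hWle : ∀ᵐ r ∂halfLine, |w.κ r * tailPrim w.σ (S.indicator u.1.1) r| ≤ |u.1.2 r| := by
    filter_upwards [snd_ae_eq u, ae_restrict_mem measurableSet_Ioi] with r h1 (hr : 0 < r)
    rw [h1, hU r hr, abs_mul, abs_mul]
    refine mul_le_mul_of_nonneg_left ?_ (abs_nonneg _)
    rw [abs_of_nonneg (le_max_right _ _)]
    exact max_le (le_abs_self _) (abs_nonneg _)
  have hW : MemLp (fun r => w.κ r * tailPrim w.σ (S.indicator u.1.1) r) (ENNReal.ofReal p)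
      halfLine := (Lp.memLp u.1.2).mono (w.aemeasurable_κ.mul
      ((continuousOn_tailPrim hG).aemeasurable measurableSet_Ioi)).aestronglyMeasurable hWle
  obtain ⟨v, hv1, hv2, hv3⟩ := exists_eval_eq hG hW
  refine ⟨v, fun r hr => (hv2 r hr).trans (hU r hr), fun hen r hr => ?_⟩
  have n1 : ‖v.1.1‖ ^ p = ∫ r in Ioi 0, |S.indicator u.1.1 r| ^ p := by
    rw [Lp.norm_rpow_eq_integral]
    refine integral_congr_ae ?_
    filter_upwards [hv1] with r h using by rw [h]
  have n2 : ‖v.1.2‖ ^ p ≤ ‖u.1.2‖ ^ p := by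
    refine Real.rpow_le_rpow (norm_nonneg _) (Lp.norm_le_norm_of_ae_le ?_) hp0.le
    filter_upwards [hv3, hWle] with r h1 h2
    rw [h1]
    exact h2
  -- The second component has not increased, so the hypothesis on the energies leaves no loss in the
  -- first one. The part of `u.1.1` removed by truncation is therefore null, and `U` coincides with
  -- its positive part.
  have n3 : ‖u.1.1‖ ^ p ≤ ‖v.1.1‖ ^ p := by
    rw [energy, energy, div_le_div_iff_of_pos_right hp0] at hen
    linarith
  rw [n1, Lp.norm_rpow_eq_integral] at n3
  have i1 := (Lp.memLp u.1.1).integrable_abs_rpow hp1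
  have i2 := hG.integrable_abs_rpow hp1
  have hnn : ∀ r, 0 ≤ |u.1.1 r| ^ p - |S.indicator u.1.1 r| ^ p := fun r =>
    sub_nonneg.2 (Real.rpow_le_rpow (abs_nonneg _) (hle r) hp0.le)
  have hzero : ∫ r in Ioi 0, (|u.1.1 r| ^ p - |S.indicator u.1.1 r| ^ p) = 0 := by
    refine le_antisymm ?_ (integral_nonneg hnn)
    rw [integral_sub i1 i2]
    linarith
  have hae := (integral_eq_zero_iff_of_nonneg hnn (i1.sub i2)).1 hzero
  have hGeq : S.indicator u.1.1 =ᵐ[halfLine] u.1.1 := by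
    filter_upwards [hae] with s hs
    by_cases h : s ∈ S
    · rw [indicator_of_mem h]
    · simp only [indicator_of_notMem h, abs_zero, Real.zero_rpow hp0.ne', sub_zero,
        Pi.zero_apply] at hs
      rw [indicator_of_notMem h]
      rw [Real.rpow_eq_zero (abs_nonneg _) hp0.ne', abs_eq_zero] at hs
      exact hs.symm
  have := hU r hr
  rw [tailPrim_congr hGeq hr.le] at this
  change w.eval u r = _ at this
  rw [this]
  exact le_max_right _ _

variable {k b f : ℝ → ℝ} {q₁ q₂ M : ℝ}

/-- Along multiples `t • e₀` of the bump the energy grows like `t ^ p`, while the potential, bounded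
below on the plateau, grows at least like `t ^ θ`. -/
theorem exists_far_le (hs : w.IsSubcritical k b q₁ q₂) (hf : IsDoublePower f M q₁ q₂)
    {θ : ℝ} (hθ : p < θ) (hAR : ∀ t, θ * primitive f t ≤ f t * t)
    {t₀ : ℝ} (ht₀ : 0 < t₀) (hpos : 0 < primitive f t₀) (ρ : ℝ) :
    ∃ e : w.space, ρ ≤ ‖e‖ ∧ energy e - potential k f e ≤ 0 := by
  obtain ⟨e₀, he₀⟩ := w.exists_bump
  obtain ⟨c, hc, hgrow⟩ := hf.exists_mul_rpow_le_primitive hAR ht₀ hpos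
  have hsub : Icc (2 : ℝ) 3 ⊆ Ioi 0 := fun r hr => show 0 < r by linarith [hr.1]
  have hkint : IntegrableOn k (Icc 2 3) := hs.integrableOn_k two_pos
  set m := ∫ r in Icc 2 3, k r with hm
  have hm0 : 0 < m := by
    rw [hm, setIntegral_pos_iff_support_of_nonneg_ae]
    · have : Icc (2 : ℝ) 3 ⊆ Function.support k ∩ Icc 2 3 := fun r hr =>
        ⟨(hs.k_pos r (hsub hr)).ne', hr⟩
      refine lt_of_lt_of_le ?_ (measure_mono this)
      simp
      norm_num
    · filter_upwards [ae_restrict_mem measurableSet_Icc] with r hr using (hs.k_pos r (hsub hr)).le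
    · exact hkint
  have he₀0 : 0 < ‖e₀‖ := by
    rw [norm_pos_iff]
    rintro rfl
    have h1 := he₀ 2 ⟨le_rfl, by norm_num⟩
    have h2 := eval_smul (0 : ℝ) (0 : w.space) two_pos
    rw [zero_smul, zero_mul] at h2
    rw [h2] at h1
    exact zero_ne_one h1
  have hpotlow : ∀ t ≥ t₀, c * t ^ θ * m ≤ potential k f (t • e₀) := by
    intro t ht
    have hi := integrableOn_mul_primitive hs hf (t • e₀)
    calc c * t ^ θ * m = ∫ r in Icc 2 3, c * t ^ θ * k r := (integral_const_mul _ _).symm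
      _ ≤ ∫ r in Icc 2 3, k r * primitive f (w.eval (t • e₀) r) := by
          refine setIntegral_mono_on (hkint.const_mul _) (hi.mono_set hsub) measurableSet_Icc
            fun r hr => ?_
          rw [eval_smul _ _ (hsub hr), he₀ r hr, mul_one, mul_comm]
          exact mul_le_mul_of_nonneg_left (hgrow t ht) (hs.k_pos r (hsub hr)).le
      _ ≤ potential k f (t • e₀) := by
          refine setIntegral_mono_set hi ?_ (.of_forall hsub)
          filter_upwards [ae_restrict_mem measurableSet_Ioi] with r hr
          exact mul_nonneg (hs.k_pos r hr).le (hf.primitive_nonneg _)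
  obtain ⟨t, ht1, ht2, ht3⟩ : ∃ t, max t₀ 1 ≤ t ∧ ρ / ‖e₀‖ ≤ t ∧
      energy e₀ / (c * m) ≤ t ^ (θ - p) :=
    ((eventually_ge_atTop _).and ((eventually_ge_atTop _).and
      ((tendsto_rpow_atTop (sub_pos.2 hθ)).eventually_ge_atTop _))).exists
  have ht0 : 0 < t := by linarith [le_max_right t₀ 1]
  have hIe : energy (t • e₀) - potential k f (t • e₀) ≤ 0 := by
    have h1 := hpotlow t ((le_max_left _ _).trans ht1)
    rw [energy_smul ht0]
    rw [div_le_iff₀ (by positivity)] at ht3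
    have e : t ^ θ = t ^ p * t ^ (θ - p) := by
      rw [← Real.rpow_add ht0]; ring_nf
    have h2 := mul_le_mul_of_nonneg_left ht3 (by positivity : 0 ≤ t ^ p)
    rw [e] at h1
    linarith
  refine ⟨t • e₀, ?_, hIe⟩
  rw [norm_smul, Real.norm_of_nonneg ht0.le]
  rwa [div_le_iff₀ he₀0] at ht2

theorem eval_zero {r : ℝ} (hr : 0 < r) : w.eval 0 r = 0 := by
  simpa using eval_smul (0 : ℝ) (0 : w.space) hr

theorem potential_eq_zero {u : w.space} (hu : ∀ r, 0 < r → w.eval u r = 0) :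
    potential k f u = 0 := by
  rw [potential, setIntegral_congr_fun (g := fun _ => (0 : ℝ)) measurableSet_Ioi fun r hr => ?_]
  · simp
  · simp only [hu r hr, IsDoublePower.primitive_zero, mul_zero]

theorem exists_critical (hs : w.IsSubcritical k b q₁ q₂) (hf : IsDoublePower f M q₁ q₂)
    {θ : ℝ} (hθ : p < θ) (hAR : ∀ t, θ * primitive f t ≤ f t * t)
    {t₀ : ℝ} (ht₀ : 0 < t₀) (hpos : 0 < primitive f t₀) :
    ∃ u : w.space, 0 < energy u - potential k f u ∧
      ∀ v, potentialDeriv hs hf u (v - u) ≤ energy v - energy u := by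
  have hp0 : 0 < p := by linarith [hp.out]
  obtain ⟨ρ, hρ, α, hα, hsphere⟩ := exists_sphere_le hs hf (lt_min hs.lt₁ hs.lt₂)
  obtain ⟨e, he1, he2⟩ := exists_far_le hs hf hθ hAR ht₀ hpos ρ
  have hI0 : energy (0 : w.space) - potential k f (0 : w.space) ≤ 0 := by
    have h1 : energy (0 : w.space) = 0 := by
      simp [energy, Real.zero_rpow hp0.ne']
    rw [h1, potential_eq_zero fun r hr => eval_zero hr, sub_zero]
  exact exists_critical_of_mountainPass hp.out hθ (one_div_pos.2 hp0)
    continuous_energy convexOn_energy (fun s u h => energy_smul h u) mul_norm_rpow_le_energy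
    energy_uniformConvex (continuous_potential hs hf) (continuous_potentialDeriv hs hf)
    (hasSeqStrictDeriv_potential hs hf) (mul_potential_le hs hf hAR)
    (potentialDeriv_compact hs hf) hα hsphere hρ.le he1 hI0 he2

/-- Existence of a nonnegative nontrivial solution of the weighted one-dimensional problem. -/
theorem exists_solution (hs : w.IsSubcritical k b q₁ q₂) (hf : IsDoublePower f M q₁ q₂)
    {θ : ℝ} (hθ : p < θ) (hAR : ∀ t, θ * primitive f t ≤ f t * t)
    {t₀ : ℝ} (ht₀ : 0 < t₀) (hpos : 0 < primitive f t₀) :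
    ∃ u : w.space, (∀ r, 0 < r → 0 ≤ w.eval u r) ∧ (∃ r, 0 < r ∧ w.eval u r ≠ 0) ∧
      ∀ h : w.space, (∫ r in Ioi 0, |u.1.1 r| ^ (p - 2) * u.1.1 r * h.1.1 r) +
        (∫ r in Ioi 0, |u.1.2 r| ^ (p - 2) * u.1.2 r * h.1.2 r) =
        ∫ r in Ioi 0, k r * (f (w.eval u r) * w.eval h r) := by
  have hp1 := hp.out
  have hp0 : 0 < p := by linarith
  obtain ⟨u, hu0, hu⟩ := exists_critical hs hf hθ hAR ht₀ hpos
  -- Tested at the positive part, the derivative term vanishes: `f(u)` is zero where `u ≤ 0`, and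
  -- the increment is zero elsewhere.
  have hnonneg : ∀ r, 0 < r → 0 ≤ w.eval u r := by
    obtain ⟨v, hv1, hv2⟩ := exists_posPart u
    refine hv2 ?_
    have h1 := hu v
    rw [potentialDeriv_apply, setIntegral_congr_fun (g := fun _ => (0 : ℝ)) measurableSet_Ioi
      fun r hr => ?_] at h1
    · simp only [integral_zero] at h1
      linarith
    · simp only
      rw [eval_sub _ _ hr, hv1 r hr]
      rcases le_total (w.eval u r) 0 with h | h
      · rw [hf.eq_zero _ h]; simp
      · rw [max_eq_left h]; simp
  refine ⟨u, hnonneg, ?_, fun h => ?_⟩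
  · by_contra hcon
    push Not at hcon
    have hpot : potential k f u = 0 := potential_eq_zero hcon
    -- A vanishing profile makes the right-hand side trivial, so comparison with `u / 2` forces
    -- energy at most zero, against the positive mountain pass level.
    have h1 := hu ((1 / 2 : ℝ) • u)
    rw [energy_smul (by norm_num), potentialDeriv_apply,
      setIntegral_congr_fun (g := fun _ => (0 : ℝ)) measurableSet_Ioi fun r hr => ?_] at h1
    · simp only [integral_zero] at h1
      have h2 : (1 / 2 : ℝ) ^ p < 1 := Real.rpow_lt_one (by norm_num) (by norm_num) hp0
      nlinarith
    · simp only
      rw [hcon r hr, hf.eq_zero 0 le_rfl]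
      simp
  · have hd := (hasDerivAt_energy u h).sub
      ((hasDerivAt_id (0 : ℝ)).mul_const (potentialDeriv hs hf u h))
    -- The variational inequality says that `t ↦ energy (u + t h) - t D u h` is minimal at `0`; its
    -- vanishing derivative is the Euler equation.
    have hmin : IsLocalMin ((fun t : ℝ => energy (u + t • h)) -
        fun t : ℝ => id t * potentialDeriv hs hf u h) 0 := by
      refine .of_forall fun s => ?_
      have h1 := hu (u + s • h)
      rw [add_sub_cancel_left, map_smul, smul_eq_mul] at h1
      simp only [Pi.sub_apply, zero_smul, add_zero, id, zero_mul, sub_zero]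
      linarith
    have := hmin.hasDerivAt_eq_zero hd
    rw [one_mul, potentialDeriv_apply] at this
    linarith

end RadialWeight

/-! ### Pointwise decay from bounds on the potentials. -/

namespace RadialWeight

section LocalEstimate

variable {p : ℝ} [hp : Fact (1 < p)] {w : RadialWeight p}

theorem normOn_Ioc_le {r l S : ℝ} (hr : 0 < r) (hl : 0 ≤ l)
    (hS : ∀ s ∈ Icc r (r + l), w.σ s ≤ S) : w.normOn (Ioc r (r + l)) ≤ S * l ^ ((p - 1) / p) := by
  have hp1 := hp.out
  have hpe : 0 ≤ (p - 1) / p := div_nonneg (by linarith) (by linarith)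
  have hpp : 0 ≤ p / (p - 1) := div_nonneg (by linarith) (by linarith)
  have hS0 : 0 ≤ S := (w.σ_pos r hr).le.trans (hS r ⟨le_rfl, by linarith⟩)
  have h1 : ∫ s in Ioc r (r + l), |w.σ s| ^ (p / (p - 1)) ≤ S ^ (p / (p - 1)) * l := by
    have hb : ∀ s ∈ Ioc r (r + l), |w.σ s| ^ (p / (p - 1)) ≤ S ^ (p / (p - 1)) := fun s hs => by
      refine Real.rpow_le_rpow (abs_nonneg _) ?_ hpp
      rw [abs_of_pos (w.σ_pos s (hr.trans hs.1))]
      exact hS s (Ioc_subset_Icc_self hs)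
    refine (setIntegral_mono_on ((w.integrableOn_rpow hr).mono_set Ioc_subset_Ioi_self)
      (integrableOn_const (by simp)) measurableSet_Ioc hb).trans_eq ?_
    simp [hl, mul_comm]
  refine (Real.rpow_le_rpow (integral_nonneg fun _ => by positivity) h1 hpe).trans_eq ?_
  rw [Real.mul_rpow (by positivity) hl, ← Real.rpow_mul hS0]
  have : p / (p - 1) * ((p - 1) / p) = 1 := by
    have h1 : p - 1 ≠ 0 := by linarith
    have h2 : p ≠ 0 := by linarith
    field_simp
  rw [this, Real.rpow_one]

/-- A pointwise estimate from bounds of the weights on a short interval. -/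
theorem abs_eval_le_of_bounds (u : w.space) {r l S T : ℝ} (hr : 0 < r) (hl : 0 < l) (hT : 0 < T)
    (hS : ∀ s ∈ Icc r (r + l), w.σ s ≤ S)
    (hκ : ∀ᵐ s ∂volume.restrict (Ioc r (r + l)), T ≤ w.κ s ^ p) :
    |w.eval u r| ≤ (S * l ^ ((p - 1) / p) + (l * T) ^ (-(1 / p))) * ‖u‖ := by
  have hp1 := hp.out
  have hp0 : 0 < p := by linarith
  -- `Q` bounds the oscillation of the profile on the window, so `x` is a lower bound for its
  -- modulus there. The weighted norm over the window then bounds `x`.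
  set Q := S * l ^ ((p - 1) / p) * ‖u‖ with hQ
  set x := max (|w.eval u r| - Q) 0 with hx
  have hx0 : 0 ≤ x := le_max_right _ _
  have hxs : ∀ s ∈ Ioc r (r + l), x ≤ |w.eval u s| := by
    intro s hs
    refine max_le ?_ (abs_nonneg _)
    have h1 := abs_eval_sub_le u hr hs.1.le
    have h2 : w.normOn (Ioc r s) ≤ S * l ^ ((p - 1) / p) :=
      (w.normOn_mono hr (Ioc_subset_Ioc_right hs.2) Ioc_subset_Ioi_self).trans
        (normOn_Ioc_le hr hl.le hS)
    have h3 := mul_le_mul_of_nonneg_right h2 (norm_nonneg u)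
    have h4 := abs_sub_abs_le_abs_sub (w.eval u r) (w.eval u s)
    rw [abs_sub_comm] at h4
    linarith
  obtain ⟨hi, he⟩ := integrable_eval u
  have hsub : Ioc r (r + l) ⊆ Ioi 0 := fun s hs => hr.trans hs.1
  have hint : l * T * x ^ p ≤ ‖u‖ ^ p := by
    calc l * T * x ^ p = ∫ _ in Ioc r (r + l), T * x ^ p := by
          simp [hl.le]; ring
      _ ≤ ∫ s in Ioc r (r + l), w.κ s ^ p * |w.eval u s| ^ p := by
          refine integral_mono_ae (integrableOn_const (by simp)) (hi.mono_set hsub) ?_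
          filter_upwards [hκ, ae_restrict_mem measurableSet_Ioc] with s h1 hs
          have h2 := Real.rpow_le_rpow hx0 (hxs s hs) hp0.le
          exact mul_le_mul h1 h2 (by positivity) (hT.le.trans h1)
      _ ≤ ∫ s in Ioi 0, w.κ s ^ p * |w.eval u s| ^ p := by
          refine setIntegral_mono_set hi ?_ (.of_forall hsub)
          filter_upwards [ae_restrict_mem measurableSet_Ioi] with s hs
          exact mul_nonneg (Real.rpow_nonneg (w.κ_nonneg s hs) _) (by positivity)
      _ = ‖u.1.2‖ ^ p := he
      _ ≤ ‖u‖ ^ p := Real.rpow_le_rpow (norm_nonneg _) (norm_snd_le u) hp0.le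
  have hxle : x ≤ (l * T) ^ (-(1 / p)) * ‖u‖ := by
    have hlT : 0 < l * T := by positivity
    have h1 : x ^ p ≤ ((l * T) ^ (-(1 / p)) * ‖u‖) ^ p := by
      rw [Real.mul_rpow (by positivity) (norm_nonneg _), ← Real.rpow_mul hlT.le, neg_mul,
        one_div_mul_cancel hp0.ne', Real.rpow_neg_one, le_inv_mul_iff₀ hlT]
      exact hint
    exact (Real.rpow_le_rpow_iff hx0 (by positivity) hp0).1 h1
  have := le_max_left (|w.eval u r| - Q) 0
  rw [add_mul, ← hQ]
  linarith

end LocalEstimate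

/-- The weights of the radial problem in dimension `N`. -/
structure IsRadialFor (N : ℕ) {p : ℝ} (A V : ℝ → ℝ) (w : RadialWeight p) : Prop where
  σ_eq : ∀ r, 0 < r → w.σ r = (A r * r ^ ((N : ℝ) - 1)) ^ (-(1 / p))
  κ_eq : ∀ r, 0 < r → w.κ r = (V r * r ^ ((N : ℝ) - 1)) ^ (1 / p)

theorem min_mul_rpow_le {r s x : ℝ} (hr : 0 < r) (h1 : r ≤ s) (h2 : s ≤ 2 * r) :
    min 1 (2 ^ x) * r ^ x ≤ s ^ x := by
  have hs : 0 < s := hr.trans_le h1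
  rcases le_total 0 x with hx | hx
  · calc min 1 (2 ^ x) * r ^ x ≤ 1 * r ^ x := by gcongr; exact min_le_left _ _
      _ ≤ s ^ x := by rw [one_mul]; gcongr
  · calc min 1 (2 ^ x) * r ^ x ≤ 2 ^ x * r ^ x := by gcongr; exact min_le_right _ _
      _ = (2 * r) ^ x := (Real.mul_rpow (by norm_num) hr.le).symm
      _ ≤ s ^ x := Real.rpow_le_rpow_of_nonpos hs h2 hx

/-- Decay of the elements of the space, from power bounds of the potentials on `[r, 2 r]`. -/
theorem exists_abs_eval_le_rpow {N : ℕ} {p : ℝ} [hp : Fact (1 < p)] {A V : ℝ → ℝ}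
    {w : RadialWeight p} (hw : w.IsRadialFor N A V) {a γ cA cV : ℝ} (hcA : 0 < cA) (hcV : 0 < cV) :
    ∃ C, 0 ≤ C ∧ ∀ (u : w.space) (r : ℝ), 0 < r → r ^ ((γ + a) / p) ≤ r →
      (∀ s ∈ Icc r (2 * r), cA * s ^ a ≤ A s) →
      (∀ᵐ s ∂volume.restrict (Ioc r (2 * r)), cV * s ^ (-γ) ≤ V s) →
      |w.eval u r| ≤ C * r ^ (-((p * ((N : ℝ) - 1) + a - γ * (p - 1)) / p ^ 2)) * ‖u‖ := by
  have hp1 := hp.out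
  have hp0 : 0 < p := by linarith
  set n : ℝ := (N : ℝ) - 1 with hn
  set c₁ := cA * min 1 (2 ^ (a + n)) with hc₁
  set c₂ := cV * min 1 (2 ^ (n - γ)) with hc₂
  have h₁ : 0 < c₁ := by positivity
  have h₂ : 0 < c₂ := by positivity
  refine ⟨c₁ ^ (-(1 / p)) + c₂ ^ (-(1 / p)), by positivity, fun u r hr hl hA hV => ?_⟩
  -- This length gives the oscillation term and the size term the same power of `r`. The condition
  -- `l ≤ r` keeps the window in `[r, 2 r]`, where powers of `s` and of `r` are comparable.
  set l := r ^ ((γ + a) / p) with hldef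
  have hl0 : 0 < l := by positivity
  have hsub : r + l ≤ 2 * r := by linarith
  have hS : ∀ s ∈ Icc r (r + l), w.σ s ≤ (c₁ * r ^ (a + n)) ^ (-(1 / p)) := by
    intro s hs
    have hs0 : 0 < s := hr.trans_le hs.1
    have hs2 : s ≤ 2 * r := hs.2.trans hsub
    rw [hw.σ_eq s hs0]
    refine Real.rpow_le_rpow_of_nonpos (by positivity) ?_ (by
      rw [neg_nonpos]; positivity)
    calc c₁ * r ^ (a + n) = cA * (min 1 (2 ^ (a + n)) * r ^ (a + n)) := by rw [hc₁]; ring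
      _ ≤ cA * s ^ (a + n) := by gcongr; exact min_mul_rpow_le hr hs.1 hs2
      _ = cA * s ^ a * s ^ n := by rw [Real.rpow_add hs0]; ring
      _ ≤ A s * s ^ n := by gcongr; exact hA s ⟨hs.1, hs2⟩
  have hκ : ∀ᵐ s ∂volume.restrict (Ioc r (r + l)), c₂ * r ^ (n - γ) ≤ w.κ s ^ p := by
    have hV' := ae_mono (Measure.restrict_mono (Ioc_subset_Ioc le_rfl hsub) le_rfl) hV
    filter_upwards [hV', ae_restrict_mem measurableSet_Ioc] with s hVs hs
    have hs0 : 0 < s := hr.trans hs.1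
    have hVpos : 0 ≤ V s := le_trans (by positivity) hVs
    rw [hw.κ_eq s hs0, ← Real.rpow_mul (by positivity), one_div_mul_cancel hp0.ne', Real.rpow_one]
    calc c₂ * r ^ (n - γ) = cV * (min 1 (2 ^ (n - γ)) * r ^ (n - γ)) := by rw [hc₂]; ring
      _ ≤ cV * s ^ (n - γ) := by
          gcongr; exact min_mul_rpow_le hr hs.1.le (hs.2.trans hsub)
      _ = cV * s ^ (-γ) * s ^ n := by
          rw [show n - γ = -γ + n by ring, Real.rpow_add hs0]; ring
      _ ≤ V s * s ^ n := by gcongr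
  refine (abs_eval_le_of_bounds u hr hl0 (by positivity) hS hκ).trans_eq ?_
  congr 1
  rw [add_mul]
  congr 1
  · rw [Real.mul_rpow h₁.le (by positivity), mul_assoc, hldef, ← Real.rpow_mul hr.le,
      ← Real.rpow_mul hr.le, ← Real.rpow_add hr]
    congr 2
    field_simp
    ring
  · rw [hldef, mul_left_comm, Real.mul_rpow h₂.le (by positivity), ← Real.rpow_add hr,
      ← Real.rpow_mul hr.le]
    congr 2
    field_simp
    ring

/-- The weight `k` against the decay of the functions of the space. -/
theorem exists_tail_le {N : ℕ} {p : ℝ} [hp : Fact (1 < p)] {A V K : ℝ → ℝ}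
    {w : RadialWeight p} (hw : w.IsRadialFor N A V) {α β γ ν q cV cK C : ℝ} (hcV : 0 < cV)
    (hcK : 0 ≤ cK) (hC : 0 ≤ C) (hβ : β ≤ 1) :
    ∃ C', 0 ≤ C' ∧ ∀ r, 0 < r → cV * r ^ (-γ) ≤ V r → K r ≤ cK * (r ^ α * V r ^ β) →
      K r * r ^ ((N : ℝ) - 1) * (C * r ^ (-ν)) ^ (q - p) ≤
        C' * r ^ (α + γ * (1 - β) - ν * (q - p)) * w.κ r ^ p := by
  have hp0 : 0 < p := by linarith [hp.out]
  refine ⟨cK * C ^ (q - p) * cV ^ (β - 1), by positivity, fun r hr hV hK => ?_⟩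
  have hV0 : 0 < V r := lt_of_lt_of_le (by positivity) hV
  set n : ℝ := (N : ℝ) - 1 with hn
  have hκ : w.κ r ^ p = V r * r ^ n := by
    rw [hw.κ_eq r hr, ← Real.rpow_mul (by positivity), one_div_mul_cancel hp0.ne', Real.rpow_one]
  -- One factor `V` is kept for `κ ^ p`; as `β - 1 ≤ 0`, the lower bound on `V` bounds the remaining
  -- `V ^ (β - 1)` from above.
  have hVβ : V r ^ β ≤ V r * (cV ^ (β - 1) * r ^ (γ * (1 - β))) := by
    have e : V r ^ β = V r * V r ^ (β - 1) := by
      rw [mul_comm, ← Real.rpow_add_one hV0.ne', sub_add_cancel]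
    rw [e]
    refine mul_le_mul_of_nonneg_left ?_ hV0.le
    refine (Real.rpow_le_rpow_of_nonpos (by positivity) hV (by linarith)).trans_eq ?_
    rw [Real.mul_rpow hcV.le (by positivity), ← Real.rpow_mul hr.le]
    ring_nf
  rw [hκ, Real.mul_rpow hC (by positivity), ← Real.rpow_mul hr.le]
  calc K r * r ^ n * (C ^ (q - p) * r ^ (-ν * (q - p)))
      ≤ cK * (r ^ α * (V r * (cV ^ (β - 1) * r ^ (γ * (1 - β))))) * r ^ n *
        (C ^ (q - p) * r ^ (-ν * (q - p))) := by
        gcongr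
        refine hK.trans ?_
        gcongr
    _ = cK * C ^ (q - p) * cV ^ (β - 1) *
        (r ^ α * r ^ (γ * (1 - β)) * r ^ (-ν * (q - p))) * (V r * r ^ n) := by ring
    _ = _ := by
        rw [← Real.rpow_add hr, ← Real.rpow_add hr]
        ring_nf

end RadialWeight

/-! ### From the hypotheses on the potentials and exponents to subcriticality. -/

namespace RadialQuasilinear

theorem LowerBound.exists_le {V : ℝ → ℝ} {γ : ℝ} {J : Set ℝ} (hJ : MeasurableSet J)
    (hJ0 : J ⊆ Ioi 0) (h : LowerBound V γ J) :
    ∃ c > 0, ∀ᵐ r ∂volume.restrict J, c * r ^ (-γ) ≤ V r := by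
  obtain ⟨c, hc0, hc⟩ := exists_between h
  have hctop : c ≠ ⊤ := (hc.trans_le le_top).ne
  refine ⟨c.toReal, ENNReal.toReal_pos hc0.ne' hctop, ?_⟩
  filter_upwards [ae_essInf_le (f := fun r : ℝ => ENNReal.ofReal (r ^ γ * V r))
    (μ := volume.restrict J), ae_restrict_mem hJ] with r hr hrJ
  have hr0 : 0 < r := hJ0 hrJ
  have h1 := hc.trans_le hr
  rw [← ENNReal.ofReal_toReal hctop] at h1
  have h2 := (ENNReal.ofReal_lt_ofReal_iff_of_nonneg ENNReal.toReal_nonneg).1 h1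
  rw [Real.rpow_neg hr0.le, ← div_eq_mul_inv, div_le_iff₀ (by positivity)]
  linarith

theorem RatioBound.exists_le {K V : ℝ → ℝ} {α β : ℝ} {J : Set ℝ} (hJ : MeasurableSet J)
    (hJ0 : J ⊆ Ioi 0) (h : RatioBound K V α β J) :
    ∃ c ≥ 0, ∀ᵐ r ∂volume.restrict J, 0 < V r → K r ≤ c * (r ^ α * V r ^ β) := by
  set C := essSup (fun r : ℝ => ENNReal.ofReal (K r) / ENNReal.ofReal (r ^ α * V r ^ β))
    (volume.restrict J)
  refine ⟨C.toReal, ENNReal.toReal_nonneg, ?_⟩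
  filter_upwards [ENNReal.ae_le_essSup (μ := volume.restrict J)
    (fun r : ℝ => ENNReal.ofReal (K r) / ENNReal.ofReal (r ^ α * V r ^ β)),
    ae_restrict_mem hJ] with r hr hrJ hV
  have hr0 : 0 < r := hJ0 hrJ
  have hpos : 0 < r ^ α * V r ^ β := by positivity
  rw [ENNReal.div_le_iff (by simpa using hpos) ENNReal.ofReal_ne_top,
    ← ENNReal.ofReal_toReal (h.ne), ← ENNReal.ofReal_mul ENNReal.toReal_nonneg] at hr
  exact (ENNReal.ofReal_le_ofReal_iff (by positivity)).1 hr

theorem eventually_mul_le_of_lt_liminf {A : ℝ → ℝ} {a c : ℝ} {l : Filter ℝ} (hc : 0 < c)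
    (hl : ∀ᶠ r in l, 0 < r)
    (h : ENNReal.ofReal c ≤ liminf (fun r : ℝ => ENNReal.ofReal (A r / r ^ a)) l) :
    ∀ᶠ r in l, c / 2 * r ^ a ≤ A r := by
  have h1 : ENNReal.ofReal (c / 2) < liminf (fun r : ℝ => ENNReal.ofReal (A r / r ^ a)) l :=
    lt_of_lt_of_le ((ENNReal.ofReal_lt_ofReal_iff hc).2 (by linarith)) h
  filter_upwards [eventually_lt_of_lt_liminf h1, hl] with r hr hr0
  have h2 := (ENNReal.ofReal_lt_ofReal_iff_of_nonneg (by positivity)).1 hr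
  rw [lt_div_iff₀ (by positivity)] at h2
  exact h2.le

/-- In this form the comparison of `q` with `q_**` is linear: the denominator is `p ^ 2` times the
decay exponent `ν`, and the numerator is `p ^ 2` times the exponent left over by `K` and `V`. -/
theorem qStarStar_eq {N : ℕ} {p a α β γ : ℝ}
    (hD : p * ((N : ℝ) - 1) - γ * (p - 1) + a ≠ 0) :
    qStarStar N p a α β γ =
      p + p ^ 2 * (α + γ * (1 - β)) / (p * ((N : ℝ) - 1) - γ * (p - 1) + a) := by
  unfold qStarStar
  field_simp
  ring

/-- The cases of the region collapse to one inequality, `ν (q - p) < α + γ (1 - β)`. The denominator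
`D` changes sign at the critical `γ`, which is why the bound on `q` by `q_**` is reversed there; at
`D = 0` only the condition on `α` remains. -/
theorem mul_lt_of_mem_regionA {N : ℕ} {p a α β γ q : ℝ} (hp : 1 < p) (ha : p - N < a)
    (h : (α, q) ∈ regionA N p a β γ) :
    (q - p) * (p * ((N : ℝ) - 1) - γ * (p - 1) + a) < p ^ 2 * (α + γ * (1 - β)) := by
  set D := p * ((N : ℝ) - 1) - γ * (p - 1) + a with hD
  have hp1 : 0 < p - 1 := by linarith
  have hpos : 0 < D → q < qStarStar N p a α β γ → (q - p) * D < p ^ 2 * (α + γ * (1 - β)) := by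
    intro hD0 hlt
    rw [qStarStar_eq hD0.ne', ← sub_lt_iff_lt_add', lt_div_iff₀ hD0] at hlt
    exact hlt
  have hcrit : D = (gammaCrit N p a - γ) * (p - 1) := by
    rw [gammaCrit, sub_mul, div_mul_cancel₀ _ hp1.ne', hD]
    ring
  rcases h with h | h | h | h | h
  · refine hpos ?_ (h.2.2.2.trans_le (min_le_right _ _))
    have := mul_lt_mul_of_pos_right h.2.1 hp1
    simp only [hD]
    linarith
  · refine hpos ?_ h.2.2.1
    simp only [hD, h.1]
    linarith
  · refine hpos ?_ h.2.2.2
    rw [hcrit]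
    exact mul_pos (by linarith [h.2.1]) hp1
  · have hD0 : D = 0 := by rw [hcrit, ← h.1, sub_self, zero_mul]
    rw [hD0, mul_zero]
    have := h.2.2
    simp only at this
    have : 0 < α + γ * (1 - β) := by linarith
    positivity
  · have hD0 : D < 0 := by
      rw [hcrit]
      exact mul_neg_of_neg_of_pos (by linarith [h.1]) hp1
    have hlt := (le_max_right _ _).trans_lt h.2
    simp only at hlt
    rw [qStarStar_eq hD0.ne, ← lt_sub_iff_add_lt', div_lt_iff_of_neg hD0] at hlt
    exact hlt

end RadialQuasilinear

namespace RadialQuasilinear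

variable {N : ℕ} {p : ℝ} {A V K : ℝ → ℝ} {a₀ aInf : ℝ}

theorem HypA.exists_le_atTop (hA : HypA N p A a₀ aInf) :
    ∃ c > 0, ∃ R > 0, ∀ r, R ≤ r → c * r ^ aInf ≤ A r := by
  obtain ⟨-, -, -, -, -, c, hc, h, -⟩ := hA
  obtain ⟨R, hR⟩ := eventually_atTop.1
    (eventually_mul_le_of_lt_liminf hc (eventually_gt_atTop 0) h)
  exact ⟨c / 2, by positivity, max R 1, by positivity, fun r hr => hR r ((le_max_left _ _).trans hr)⟩

theorem HypA.exists_le_zero (hA : HypA N p A a₀ aInf) :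
    ∃ c > 0, ∃ R > 0, ∀ r, 0 < r → r < R → c * r ^ a₀ ≤ A r := by
  obtain ⟨-, -, -, -, ⟨c, hc, h, -⟩, -⟩ := hA
  obtain ⟨R, hR0, hR⟩ := mem_nhdsGT_iff_exists_Ioo_subset.1
    (eventually_mul_le_of_lt_liminf hc self_mem_nhdsWithin h)
  exact ⟨c / 2, by positivity, R, hR0, fun r h1 h2 => hR ⟨h1, h2⟩⟩

/-- The point is the integrability of `σ ^ (p / (p - 1))` at infinity. It is at most a constant
times `s ^ (-(aInf + N - 1) / (p - 1))`, and this power is integrable exactly because `aInf > p -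
N`. -/
theorem exists_isRadialFor [hp : Fact (1 < p)] (hA : HypA N p A a₀ aInf) (hV : HypV V) :
    ∃ w : RadialWeight p, w.IsRadialFor N A V := by
  have hp1 := hp.out
  have hp0 : 0 < p := by linarith
  have hpm : 0 < p - 1 := by linarith
  have hpow : ContinuousOn (fun r : ℝ => r ^ ((N : ℝ) - 1)) (Ioi 0) :=
    continuousOn_id.rpow_const fun r hr => Or.inl (ne_of_gt hr)
  have hpos : ∀ r, 0 < r → 0 < A r * r ^ ((N : ℝ) - 1) := fun r hr =>
    mul_pos (hA.2.1 r hr) (by positivity)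
  have hcont : ContinuousOn (fun r => (A r * r ^ ((N : ℝ) - 1)) ^ (-(1 / p))) (Ioi 0) :=
    (hA.1.mul hpow).rpow_const fun r hr => Or.inl (hpos r hr).ne'
  obtain ⟨c, hc, R, hR, hle⟩ := hA.exists_le_atTop
  have hexp : ∀ r, 0 < r → |(A r * r ^ ((N : ℝ) - 1)) ^ (-(1 / p))| ^ (p / (p - 1)) =
      (A r * r ^ ((N : ℝ) - 1)) ^ (-(1 / (p - 1))) := fun r hr => by
    rw [abs_of_pos (Real.rpow_pos_of_pos (hpos r hr) _), ← Real.rpow_mul (hpos r hr).le]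
    congr 1
    field_simp
  refine ⟨⟨fun r => (A r * r ^ ((N : ℝ) - 1)) ^ (-(1 / p)),
    fun r => (V r * r ^ ((N : ℝ) - 1)) ^ (1 / p), fun r hr => Real.rpow_pos_of_pos (hpos r hr) _,
    hcont, fun r hr => ?_, fun r hr => Real.rpow_nonneg (mul_nonneg (hV.1 r hr) (by positivity)) _,
    ?_, ?_⟩, fun _ _ => rfl, fun _ _ => rfl⟩
  · have hq : 1 < p / (p - 1) := by rw [lt_div_iff₀ hpm]; linarith
    have hsub : Ioi r ⊆ Ioi 0 := Ioi_subset_Ioi hr.le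
    rw [← integrable_abs_rpow_iff hq
      ((hcont.mono hsub).aestronglyMeasurable measurableSet_Ioi)]
    have hcont' : ContinuousOn (fun r => (A r * r ^ ((N : ℝ) - 1)) ^ (-(1 / (p - 1)))) (Ioi 0) :=
      (hA.1.mul hpow).rpow_const fun r hr => Or.inl (hpos r hr).ne'
    have hint : IntegrableOn (fun r => (A r * r ^ ((N : ℝ) - 1)) ^ (-(1 / (p - 1)))) (Ioi r) := by
      have hR' : 0 < max r R := lt_max_of_lt_right hR
      rw [← Ioc_union_Ioi_eq_Ioi (le_max_left r R)]
      refine IntegrableOn.union ?_ ?_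
      · refine IntegrableOn.mono_set (ContinuousOn.integrableOn_Icc
          (hcont'.mono fun s hs => hr.trans_le hs.1)) Ioc_subset_Icc_self
      · have ht : -((aInf + ((N : ℝ) - 1)) / (p - 1)) < -1 := by
          rw [neg_lt_neg_iff, lt_div_iff₀ hpm]
          have := hA.2.2.2.1.1
          linarith
        refine Integrable.mono' ((integrableOn_Ioi_rpow_of_lt ht hR').const_mul
          (c ^ (-(1 / (p - 1))))) ((hcont'.mono
          (Ioi_subset_Ioi hR'.le)).aestronglyMeasurable measurableSet_Ioi) ?_
        filter_upwards [ae_restrict_mem measurableSet_Ioi] with s hs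
        have hs0 : 0 < s := hR'.trans hs
        have h1 := hle s ((le_max_right _ _).trans (le_of_lt hs))
        rw [Real.norm_of_nonneg (Real.rpow_nonneg (hpos s hs0).le _)]
        have h2 : c * s ^ (aInf + ((N : ℝ) - 1)) ≤ A s * s ^ ((N : ℝ) - 1) := by
          rw [Real.rpow_add hs0, ← mul_assoc]
          gcongr
        refine (Real.rpow_le_rpow_of_nonpos (by positivity) h2 ?_).trans_eq ?_
        · rw [neg_nonpos]; positivity
        · rw [Real.mul_rpow hc.le (by positivity), ← Real.rpow_mul hs0.le]
          congr 2
          ring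
    refine hint.congr ?_
    filter_upwards [ae_restrict_mem measurableSet_Ioi] with s hs
    exact (hexp s (hr.trans hs)).symm
  · exact (hV.2.1.mul (hpow.aemeasurable measurableSet_Ioi)).pow_const _
  · have h := hV.2.2.mul_continuousOn hpow isOpen_Ioi.isLocallyClosed
    rw [locallyIntegrableOn_iff isOpen_Ioi.isLocallyClosed] at h ⊢
    intro k hk hkc
    refine (h k hk hkc).congr_fun (fun r hr => ?_) hkc.measurableSet
    have hr0 : 0 < r := hk hr
    dsimp only
    rw [← Real.rpow_mul (mul_nonneg (hV.1 r hr0) (by positivity)), one_div_mul_cancel hp0.ne',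
      Real.rpow_one]

theorem HypK.locallyIntegrableOn (hK : HypK K) : LocallyIntegrableOn K (Ioi 0) := by
  obtain ⟨hpos, hm, s, hs, hi⟩ := hK
  rw [locallyIntegrableOn_iff isOpen_Ioi.isLocallyClosed] at hi ⊢
  intro k hk hkc
  have h1 : IntegrableOn (fun r => 1 + K r ^ s) k :=
    (integrableOn_const hkc.measure_ne_top).add (hi k hk hkc)
  refine Integrable.mono' h1
    (hm.mono_measure (Measure.restrict_mono hk le_rfl)).aestronglyMeasurable ?_
  filter_upwards [ae_restrict_mem hkc.measurableSet] with r hr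
  have h0 := hpos r (hk hr)
  rw [Real.norm_of_nonneg h0.le]
  rcases le_total (K r) 1 with h | h
  · have := Real.rpow_nonneg h0.le s
    linarith
  · have := Real.self_le_rpow_of_one_le h hs.le
    linarith

end RadialQuasilinear

namespace RadialWeight

open RadialQuasilinear

variable {N : ℕ} {p : ℝ} [hp : Fact (1 < p)] {A V K : ℝ → ℝ} {a₀ aInf : ℝ}
  {w : RadialWeight p}

/-- At the origin the tail is small because the exponent `δ` is positive, by membership in the
region. The condition `p - a₀ ≤ γ` makes the window length at most `r` when `r ≤ 1`. -/
theorem IsRadialFor.exists_bound_zero (hw : w.IsRadialFor N A V) (hA : HypA N p A a₀ aInf)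
    {R α β γ q : ℝ} (hR : 0 < R) (hβ : β ≤ 1) (hγ : p - a₀ ≤ γ)
    (hK : RatioBound K V α β (Ioo 0 R)) (hV : LowerBound V γ (Ioo 0 R))
    (hq : (α, q) ∈ regionA N p a₀ β γ) :
    ∃ C ν ρ C' δ : ℝ, 0 ≤ C ∧ 0 < ρ ∧ 0 < δ ∧ 0 ≤ C' ∧
      (∀ (u : w.space) (r : ℝ), 0 < r → r ≤ ρ → |w.eval u r| ≤ C * r ^ (-ν) * ‖u‖) ∧
      ∀ᵐ r ∂halfLine, r ≤ ρ →
        K r * r ^ ((N : ℝ) - 1) * (C * r ^ (-ν)) ^ (q - p) ≤ C' * r ^ δ * w.κ r ^ p := by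
  have hp0 : 0 < p := by linarith [hp.out]
  obtain ⟨cA, hcA, RA, hRA, hAle⟩ := hA.exists_le_zero
  have hJ0 : Ioo 0 R ⊆ Ioi 0 := fun r hr => hr.1
  obtain ⟨cV, hcV, hVle⟩ := hV.exists_le measurableSet_Ioo hJ0
  obtain ⟨cK, hcK, hKle⟩ := hK.exists_le measurableSet_Ioo hJ0
  obtain ⟨C, hC, hev⟩ := exists_abs_eval_le_rpow hw (a := a₀) (γ := γ) hcA hcV
  set ν := (p * ((N : ℝ) - 1) + a₀ - γ * (p - 1)) / p ^ 2 with hν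
  obtain ⟨C', hC', ht⟩ := exists_tail_le hw (K := K) (α := α) (β := β) (γ := γ) (ν := ν) (q := q)
    hcV hcK hC hβ
  have hm := lt_min (lt_min hR hRA) one_pos
  set m := min (min R RA) 1 with hmdef
  have hmR : m ≤ R := (min_le_left _ _).trans (min_le_left _ _)
  have hmA : m ≤ RA := (min_le_left _ _).trans (min_le_right _ _)
  have hm1 : m ≤ 1 := min_le_right _ _
  -- With `r ≤ m / 3`, the interval `[r, 2 r]` stays inside the range where both lower bounds hold.
  refine ⟨C, ν, m / 3, C', α + γ * (1 - β) - ν * (q - p), hC, by positivity, ?_, hC',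
    fun u r hr hrm => hev u r hr ?_ (fun s hs => hAle s (hr.trans_le hs.1) ?_) ?_, ?_⟩
  · have := mul_lt_of_mem_regionA hp.out hA.2.2.1.1 hq
    rw [hν, sub_pos, div_mul_eq_mul_div, div_lt_iff₀ (by positivity)]
    linarith
  · refine (Real.rpow_le_rpow_of_exponent_ge hr (by linarith) ?_).trans_eq (Real.rpow_one r)
    rw [le_div_iff₀ hp0]
    linarith
  · linarith [hs.2]
  · have hsub : Ioc r (2 * r) ⊆ Ioo 0 R := fun s hs => ⟨hr.trans hs.1, by linarith [hs.2]⟩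
    exact ae_mono (Measure.restrict_mono hsub le_rfl) hVle
  · rw [ae_restrict_iff' measurableSet_Ioo] at hVle hKle
    filter_upwards [ae_restrict_of_ae hVle, ae_restrict_of_ae hKle,
      ae_restrict_mem measurableSet_Ioi] with r h1 h2 hr hrm
    have hr' : r ∈ Ioo 0 R := ⟨hr, by linarith⟩
    have h3 := h1 hr'
    have hr0 : 0 < r := hr
    exact ht r hr h3 (h2 hr' (lt_of_lt_of_le (by positivity) h3))

/-- At infinity the inequality on `γ` is reversed, since large `r` needs `(γ + a) / p ≤ 1`. With
`aInf > p - N` it makes the denominator of `q_**` positive, so `q > q_**` gives a negative exponent.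
-/
theorem IsRadialFor.exists_bound_atTop (hw : w.IsRadialFor N A V) (hA : HypA N p A a₀ aInf)
    {R α β γ q : ℝ} (hR : 0 < R) (hβ : β ≤ 1) (hγ : γ ≤ p - aInf)
    (hK : RatioBound K V α β (Ioi R)) (hV : LowerBound V γ (Ioi R))
    (hq : qStarStar N p aInf α β γ < q) :
    ∃ C ν ρ C' δ : ℝ, 0 ≤ C ∧ 0 < ρ ∧ δ < 0 ∧ 0 ≤ C' ∧
      (∀ (u : w.space) (r : ℝ), ρ ≤ r → |w.eval u r| ≤ C * r ^ (-ν) * ‖u‖) ∧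
      ∀ᵐ r ∂halfLine, ρ ≤ r →
        K r * r ^ ((N : ℝ) - 1) * (C * r ^ (-ν)) ^ (q - p) ≤ C' * r ^ δ * w.κ r ^ p := by
  have hp1 := hp.out
  have hp0 : 0 < p := by linarith
  obtain ⟨cA, hcA, RA, hRA, hAle⟩ := hA.exists_le_atTop
  have hJ0 : Ioi R ⊆ Ioi 0 := Ioi_subset_Ioi hR.le
  obtain ⟨cV, hcV, hVle⟩ := hV.exists_le measurableSet_Ioi hJ0
  obtain ⟨cK, hcK, hKle⟩ := hK.exists_le measurableSet_Ioi hJ0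
  obtain ⟨C, hC, hev⟩ := exists_abs_eval_le_rpow hw (a := aInf) (γ := γ) hcA hcV
  set ν := (p * ((N : ℝ) - 1) + aInf - γ * (p - 1)) / p ^ 2 with hν
  obtain ⟨C', hC', ht⟩ := exists_tail_le hw (K := K) (α := α) (β := β) (γ := γ) (ν := ν) (q := q)
    hcV hcK hC hβ
  set m := max (max R RA) 1 with hmdef
  have hmR : R ≤ m := (le_max_left _ _).trans (le_max_left _ _)
  have hmA : RA ≤ m := (le_max_right _ _).trans (le_max_left _ _)
  have hm1 : 1 ≤ m := le_max_right _ _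
  have hD : 0 < p * ((N : ℝ) - 1) - γ * (p - 1) + aInf := by
    have h1 := mul_le_mul_of_nonneg_right hγ (by linarith : 0 ≤ p - 1)
    have h2 := mul_pos hp0 (by linarith [hA.2.2.2.1.1] : 0 < aInf - (p - N))
    linarith
  refine ⟨C, ν, 2 * m, C', α + γ * (1 - β) - ν * (q - p), hC, by positivity, ?_, hC',
    fun u r hrm => hev u r (by linarith) ?_ (fun s hs => hAle s (by linarith [hs.1])) ?_, ?_⟩
  · rw [qStarStar_eq hD.ne', ← lt_sub_iff_add_lt', div_lt_iff₀ hD] at hq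
    rw [hν, sub_neg, div_mul_eq_mul_div, lt_div_iff₀ (by positivity)]
    linarith
  · refine (Real.rpow_le_rpow_of_exponent_le (by linarith) ?_).trans_eq (Real.rpow_one r)
    rw [div_le_iff₀ hp0]
    linarith
  · exact ae_mono (Measure.restrict_mono (fun s hs =>
      (by linarith : R < r).trans hs.1) le_rfl) hVle
  · rw [ae_restrict_iff' measurableSet_Ioi] at hVle hKle
    filter_upwards [ae_restrict_of_ae hVle, ae_restrict_of_ae hKle,
      ae_restrict_mem measurableSet_Ioi] with r h1 h2 hr hrm
    have hr' : r ∈ Ioi R := (by linarith : R < r)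
    have h3 := h1 hr'
    have hr0 : 0 < r := hr
    exact ht r hr h3 (h2 hr' (lt_of_lt_of_le (by positivity) h3))

/-- The hypotheses on the potentials make the weight `K r ^ (N - 1)` subcritical. -/
theorem IsRadialFor.exists_isSubcritical (hw : w.IsRadialFor N A V) (hA : HypA N p A a₀ aInf)
    (hK : HypK K) {R₁ R₂ α₀ β₀ γ₀ αInf βInf γInf q₁ q₂ : ℝ} (hR₁ : 0 < R₁) (hR₂ : 0 < R₂)
    (hβ₀ : β₀ ≤ 1) (hγ₀ : p - a₀ ≤ γ₀)
    (hK₀ : RatioBound K V α₀ β₀ (Ioo 0 R₁)) (hV₀ : LowerBound V γ₀ (Ioo 0 R₁))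
    (hβInf : βInf ≤ 1) (hγInf : γInf ≤ p - aInf)
    (hKInf : RatioBound K V αInf βInf (Ioi R₂)) (hVInf : LowerBound V γInf (Ioi R₂))
    (hq₁ : p < q₁) (hq₂ : p < q₂) (hq₁A : (α₀, q₁) ∈ regionA N p a₀ β₀ γ₀)
    (hq₂m : qStarStar N p aInf αInf βInf γInf < q₂) :
    ∃ b, w.IsSubcritical (fun r => K r * r ^ ((N : ℝ) - 1)) b q₁ q₂ := by
  obtain ⟨C, ν, ρ, C', δ, hC, hρ, hδ, hC', hev, ht⟩ :=
    hw.exists_bound_zero hA hR₁ hβ₀ hγ₀ hK₀ hV₀ hq₁A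
  obtain ⟨B, μ, P, B', η, hB, hP, hη, hB', hev', ht'⟩ :=
    hw.exists_bound_atTop hA hR₂ hβInf hγInf hKInf hVInf hq₂m
  -- The decay bounds are used at the two ends, and the plain Hölder bound in between.
  refine ⟨fun r => if r ≤ ρ then C * r ^ (-ν) else if P ≤ r then B * r ^ (-μ) else
    w.normOn (Ioi ρ), hq₁, hq₂, fun r hr => mul_pos (hK.1 r hr) (by positivity), ?_, ?_, ?_, ?_, ?_⟩
  · exact hK.locallyIntegrableOn.mul_continuousOn
      (continuousOn_id.rpow_const fun r hr => Or.inl (ne_of_gt hr)) isOpen_Ioi.isLocallyClosed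
  · intro r hr
    have := w.normOn_nonneg (Ioi ρ)
    split_ifs <;> positivity
  · intro u r hr
    split_ifs with h1 h2
    · exact hev u r hr h1
    · exact hev' u r h2
    · exact (abs_eval_le_normOn_mul u hr).trans (mul_le_mul_of_nonneg_right
        (w.normOn_mono hρ (Ioi_subset_Ioi (le_of_not_ge h1)) subset_rfl) (norm_nonneg _))
  · intro s T hs
    have hpow : ∀ x : ℝ, ∃ D, ∀ r ∈ Icc s T, ‖r ^ x‖ ≤ D := fun x =>
      isCompact_Icc.exists_bound_of_continuousOn
        (continuousOn_id.rpow_const fun r hr => Or.inl (hs.trans_le hr.1).ne')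
    obtain ⟨D, hD⟩ := hpow (-ν)
    obtain ⟨E, hE⟩ := hpow (-μ)
    refine ⟨max (max (C * D) (B * E)) (w.normOn (Ioi ρ)), fun r hr => ?_⟩
    have h1 := mul_le_mul_of_nonneg_left ((Real.le_norm_self _).trans (hD r hr)) hC
    have h2 := mul_le_mul_of_nonneg_left ((Real.le_norm_self _).trans (hE r hr)) hB
    split_ifs
    · exact le_max_of_le_left (le_max_of_le_left h1)
    · exact le_max_of_le_left (le_max_of_le_right h2)
    · exact le_max_right _ _
  · intro ε hε
    have l1 : ∀ᶠ r in 𝓝[>] (0 : ℝ), C' * r ^ δ < ε := by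
      have : Tendsto (fun r : ℝ => C' * r ^ δ) (𝓝 0) (𝓝 (C' * 0 ^ δ)) :=
        ((Real.continuousAt_rpow_const 0 δ (Or.inr hδ.le)).tendsto).const_mul C'
      rw [Real.zero_rpow hδ.ne', mul_zero] at this
      exact (this.mono_left nhdsWithin_le_nhds).eventually_lt_const hε
    have l2 : ∀ᶠ r in atTop, B' * r ^ η < ε := by
      have : Tendsto (fun r : ℝ => B' * r ^ η) atTop (𝓝 (B' * 0)) := by
        have := tendsto_rpow_neg_atTop (y := -η) (by linarith)
        rw [neg_neg] at this
        exact this.const_mul B'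
      rw [mul_zero] at this
      exact this.eventually_lt_const hε
    obtain ⟨s, hs0, hs⟩ := mem_nhdsGT_iff_exists_Ioo_subset.1 l1
    obtain ⟨T, hT⟩ := eventually_atTop.1 l2
    have hs0' : 0 < s := hs0
    refine ⟨min ρ s, max (max P T) ρ, lt_min hρ hs0', ?_⟩
    filter_upwards [ht, ht', ae_restrict_mem measurableSet_Ioi] with r h1 h2 hr hn
    have hr0 : 0 < r := hr
    have hκ := Real.rpow_nonneg (w.κ_nonneg r hr) p
    have hk := mul_pos (hK.1 r hr) (by positivity : 0 < r ^ ((N : ℝ) - 1))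
    rcases lt_or_ge r (min ρ s) with hlt | hge
    · have hrρ := (hlt.trans_le (min_le_left _ _)).le
      have h3 := hs ⟨hr, hlt.trans_le (min_le_right _ _)⟩
      simp only [if_pos hrρ]
      calc _ ≤ _ := mul_le_mul_of_nonneg_left (min_le_left _ _) hk.le
        _ ≤ _ := h1 hrρ
        _ ≤ _ := mul_le_mul_of_nonneg_right (le_of_lt h3) hκ
    · have hgt : max (max P T) ρ < r := by
        by_contra hle
        exact hn ⟨hge, not_lt.1 hle⟩
      have hrρ : ¬ r ≤ ρ := not_le.2 ((le_max_right _ _).trans_lt hgt)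
      have hrP : P ≤ r := ((le_max_left _ _).trans (le_max_left _ _)).trans hgt.le
      have h3 := hT r (((le_max_right _ _).trans (le_max_left _ _)).trans hgt.le)
      simp only [if_neg hrρ, if_pos hrP]
      calc _ ≤ _ := mul_le_mul_of_nonneg_left (min_le_right _ _) hk.le
        _ ≤ _ := h2 hrP
        _ ≤ _ := mul_le_mul_of_nonneg_right (le_of_lt h3) hκ

end RadialWeight

/-! ### Polar coordinates and smooth radial functions. -/

section RadialIntegration

variable {E : Type*} [NormedAddCommGroup E] [NormedSpace ℝ E] [FiniteDimensional ℝ E]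
  [MeasurableSpace E] [BorelSpace E] [Nontrivial E] (μ : Measure E) [μ.IsAddHaarMeasure]

/-- By polar coordinates a null set of radii pulls back to a null set. This is what allows profiles
and densities defined only almost everywhere to be composed with the norm. -/
theorem quasiMeasurePreserving_norm :
    Measure.QuasiMeasurePreserving (fun x : E => ‖x‖) μ halfLine := by
  refine ⟨measurable_norm, Measure.AbsolutelyContinuous.mk fun S hS h0 => ?_⟩
  rw [Measure.map_apply measurable_norm hS]
  set f : ℝ → ℝ := S.indicator fun _ => 1 with hf
  have hz : (fun y : ℝ => y ^ (Module.finrank ℝ E - 1) • f y) =ᵐ[halfLine] 0 := by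
    filter_upwards [measure_eq_zero_iff_ae_notMem.1 h0] with y hy
    simp [hf, hy]
  have hi : Integrable (fun x : E => f ‖x‖) μ :=
    (integrable_fun_norm_addHaar μ).2 ((integrable_zero _ _ _).congr hz.symm)
  have h1 : ∫ x, f ‖x‖ ∂μ = 0 := by
    rw [integral_fun_norm_addHaar μ f, integral_congr_ae hz]
    simp
  rw [integral_eq_zero_iff_of_nonneg (fun x => indicator_nonneg (fun _ _ => zero_le_one) _) hi] at h1
  rw [measure_eq_zero_iff_ae_notMem]
  filter_upwards [h1] with x hx hxS
  have hm : ‖x‖ ∈ S := hxS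
  simp [hm] at hx

end RadialIntegration

section RadialCalculus

variable {E : Type*} [NormedAddCommGroup E] [InnerProductSpace ℝ E] [CompleteSpace E]

theorem hasGradientAt_norm {x : E} (hx : x ≠ 0) :
    HasGradientAt (fun y : E => ‖y‖) (‖x‖⁻¹ • x) x := by
  have hx0 : 0 < ‖x‖ := norm_pos_iff.2 hx
  have h := ((hasStrictFDerivAt_norm_sq x).hasFDerivAt).sqrt (by positivity)
  rw [hasGradientAt_iff_hasFDerivAt]
  refine (h.congr_of_eventuallyEq (.of_forall fun y => ?_)).congr_fderiv ?_
  · exact (Real.sqrt_sq (norm_nonneg y)).symm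
  · ext y
    simp [Real.sqrt_sq hx0.le]
    field_simp

theorem hasGradientAt_comp_norm {ϕ : ℝ → ℝ} {x : E} (hx : x ≠ 0)
    (hϕ : DifferentiableAt ℝ ϕ ‖x‖) :
    HasGradientAt (fun y : E => ϕ ‖y‖) (deriv ϕ ‖x‖ • ‖x‖⁻¹ • x) x := by
  rw [hasGradientAt_iff_hasFDerivAt, map_smul]
  exact hϕ.hasDerivAt.comp_hasFDerivAt x (hasGradientAt_iff_hasFDerivAt.1 (hasGradientAt_norm hx))

omit [CompleteSpace E] in
theorem norm_smul_inv_norm_smul (c : ℝ) {x : E} (hx : x ≠ 0) : ‖c • ‖x‖⁻¹ • x‖ = |c| := by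
  rw [norm_smul, norm_smul, norm_inv, norm_norm, inv_mul_cancel₀ (norm_ne_zero_iff.2 hx), mul_one,
    Real.norm_eq_abs]

omit [CompleteSpace E] in
/-- A smooth profile that is constant near `0` defines a smooth radial function. -/
theorem contDiff_comp_norm {ϕ : ℝ → ℝ} {ρ : ℝ} (hρ : 0 < ρ) (hϕ : ContDiff ℝ ∞ ϕ)
    (hc : ∀ r < ρ, ϕ r = ϕ 0) : ContDiff ℝ ∞ fun x : E => ϕ ‖x‖ := by
  rw [contDiff_iff_contDiffAt]
  intro x
  by_cases hx : x = 0
  · subst hx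
    refine (contDiffAt_const (c := ϕ 0)).congr_of_eventuallyEq ?_
    filter_upwards [Metric.ball_mem_nhds (0 : E) hρ] with y hy
    exact hc _ (by simpa using hy)
  · exact hϕ.contDiffAt.comp x (contDiffAt_norm ℝ hx)

end RadialCalculus

/-! ### Density of smooth profiles. -/

namespace RadialWeight

variable {p : ℝ} [hp : Fact (1 < p)] {w : RadialWeight p}

theorem tailPrim_sub {G H : ℝ → ℝ} (hG : MemLp G (ENNReal.ofReal p) halfLine)
    (hH : MemLp H (ENNReal.ofReal p) halfLine) {r : ℝ} (hr : 0 < r) :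
    tailPrim w.σ (G - H) r = tailPrim w.σ G r - tailPrim w.σ H r := by
  simp only [tailPrim, Pi.sub_apply, mul_sub]
  rw [integral_sub (integrableOn_Ioi hG hr) (integrableOn_Ioi hH hr)]
  ring

omit hp in
theorem tailPrim_deriv_div (w : RadialWeight p) {ϕ : ℝ → ℝ} (hϕ : ContDiff ℝ ∞ ϕ)
    (hc : HasCompactSupport ϕ) {r : ℝ} (hr : 0 < r) :
    tailPrim w.σ (fun s => deriv ϕ s / w.σ s) r = ϕ r := by
  rw [tailPrim, neg_eq_iff_eq_neg, ← hc.integral_Ioi_deriv_eq (hϕ.of_le (by simp)) r]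
  refine setIntegral_congr_fun measurableSet_Ioi fun s hs => ?_
  exact mul_div_cancel₀ _ (w.σ_pos s (hr.trans hs)).ne'

/-- Truncation to a compact interval of `(0, ∞)`. -/
theorem exists_truncation {G : ℝ → ℝ} (hG : MemLp G (ENNReal.ofReal p) halfLine) {ε : ℝ}
    (hε : 0 < ε) : ∃ a b : ℝ, 0 < a ∧ a < b ∧
      eLpNorm (G - (Icc a b).indicator G) (ENNReal.ofReal p) halfLine ≤ ENNReal.ofReal ε := by
  have hp1 := hp.out
  have hp0 : 0 < p := by linarith
  set a : ℕ → ℝ := fun n => 1 / ((n : ℝ) + 1) with ha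
  have hf := hG.integrable_abs_rpow hp1
  have hmem : ∀ n, MemLp (G - (Icc (a n) (n + 2)).indicator G) (ENNReal.ofReal p) halfLine :=
    fun n => hG.sub (hG.indicator measurableSet_Icc)
  have hlim : Tendsto (fun n : ℕ => ∫ r, |(G - (Icc (a n) (n + 2)).indicator G) r| ^ p ∂halfLine)
      atTop (𝓝 (∫ _, (0 : ℝ) ∂halfLine)) := by
    refine tendsto_integral_of_dominated_convergence _
      (fun n => ((hmem n).integrable_abs_rpow hp1).1) hf (fun n => .of_forall fun r => ?_) ?_
    · rw [Real.norm_of_nonneg (by positivity)]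
      refine Real.rpow_le_rpow (abs_nonneg _) ?_ hp0.le
      by_cases hr : r ∈ Icc (a n) (n + 2)
      · simp [indicator_of_mem hr]
      · simp [indicator_of_notMem hr]
    · filter_upwards [ae_restrict_mem measurableSet_Ioi] with r (hr : 0 < r)
      refine tendsto_const_nhds.congr' ?_
      filter_upwards [tendsto_one_div_add_atTop_nhds_zero_nat.eventually_lt_const hr,
        tendsto_natCast_atTop_atTop.eventually_ge_atTop r] with n h1 h2
      have hm : r ∈ Icc (a n) (n + 2) := ⟨h1.le, by linarith⟩
      simp [indicator_of_mem hm, Real.zero_rpow hp0.ne']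
  rw [integral_zero] at hlim
  obtain ⟨n, hn⟩ := (hlim.eventually_lt_const (by positivity : 0 < ε ^ p)).exists
  refine ⟨a n, n + 2, by positivity, ?_, ?_⟩
  · have : a n ≤ 1 := by
      rw [ha, div_le_one (by positivity)]
      linarith [(Nat.cast_nonneg n : (0 : ℝ) ≤ n)]
    linarith [(Nat.cast_nonneg n : (0 : ℝ) ≤ n)]
  · rw [(hmem n).eLpNorm_eq_integral_rpow_norm (ofReal_ne_zero_of_one_lt hp1)
      ENNReal.ofReal_ne_top, ENNReal.toReal_ofReal hp0.le]
    refine ENNReal.ofReal_le_ofReal ?_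
    refine (Real.rpow_le_rpow (integral_nonneg fun _ => by positivity) hn.le
      (by positivity)).trans_eq ?_
    rw [← Real.rpow_mul hε.le, mul_inv_cancel₀ hp0.ne', Real.rpow_one]

/-- Density of the smooth functions with compact support in `(0, ∞)`. -/
theorem exists_smooth_approx (w : RadialWeight p) {G : ℝ → ℝ}
    (hG : MemLp G (ENNReal.ofReal p) halfLine) {ε : ℝ} (hε : 0 < ε) :
    ∃ (g : ℝ → ℝ) (a b : ℝ), 0 < a ∧ a ≤ b ∧ ContDiff ℝ ∞ g ∧ (∀ r, r ∉ Icc a b → g r = 0) ∧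
      MemLp (fun r => g r / w.σ r) (ENNReal.ofReal p) halfLine ∧
      eLpNorm (G - fun r => g r / w.σ r) (ENNReal.ofReal p) halfLine ≤ ENNReal.ofReal ε := by
  have hp1 := hp.out
  have hp0 : 0 < p := by linarith
  have hpe : (1 : ENNReal) ≤ ENNReal.ofReal p := Fact.out
  obtain ⟨a, b, ha, hab, htr⟩ := exists_truncation hG (half_pos hε)
  set χ : ContDiffBump ((a + b) / 2) := ⟨(b - a) / 2, b / 2, by linarith, by linarith⟩ with hχ
  have hχ1 : ∀ r ∈ Icc a b, χ r = 1 := fun r hr => χ.one_of_mem_closedBall (by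
    rw [Real.closedBall_eq_Icc]
    constructor <;> simp only [hχ] <;> linarith [hr.1, hr.2])
  have hχ0 : ∀ r, r ∉ Icc (a / 2) (b + a) → χ r = 0 := fun r hr => by
    refine χ.zero_of_le_dist ?_
    rw [Real.dist_eq, hχ, le_abs]
    rw [mem_Icc, not_and_or, not_le, not_le] at hr
    rcases hr with h | h
    · right; dsimp only; linarith
    · left; dsimp only; linarith
  have hsub : Icc (a / 2) (b + a) ⊆ Ioi 0 := fun r hr => lt_of_lt_of_le (by positivity) hr.1
  have hinv : ContinuousOn (fun r => (w.σ r)⁻¹) (Ioi 0) :=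
    w.continuousOn_σ.inv₀ fun r hr => (w.σ_pos r hr).ne'
  obtain ⟨B, hB⟩ := isCompact_Icc.exists_bound_of_continuousOn (hinv.mono hsub)
  obtain ⟨S, hS⟩ := isCompact_Icc.exists_bound_of_continuousOn (w.continuousOn_σ.mono hsub)
  have hmem : a ∈ Icc (a / 2) (b + a) := ⟨by linarith, by linarith⟩
  have hB0 : 0 < B := lt_of_lt_of_le (norm_pos_iff.2 (inv_ne_zero (w.σ_pos a ha).ne')) (hB a hmem)
  have hIsub : Icc a b ⊆ Icc (a / 2) (b + a) := Icc_subset_Icc (by linarith) (by linarith)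
  -- Since `σ` is merely continuous, the function to be smoothed is the derivative `σ G` of the
  -- profile, not `G`. On the support of the cutoff `1 / σ` is at most `B`, whence the tolerance `ε
  -- / 2 / B` below.
  set h : ℝ → ℝ := (Icc a b).indicator fun r => w.σ r * G r with hh
  have hσm : AEStronglyMeasurable w.σ halfLine :=
    w.continuousOn_σ.aestronglyMeasurable measurableSet_Ioi
  have hhL : MemLp h (ENNReal.ofReal p) halfLine := by
    refine MemLp.of_le_mul (c := S) hG ((hσm.mul hG.1).indicator measurableSet_Icc) ?_
    refine .of_forall fun r => ?_
    by_cases hr : r ∈ Icc a b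
    · rw [hh, indicator_of_mem hr, norm_mul]
      exact mul_le_mul_of_nonneg_right (hS r (hIsub hr)) (norm_nonneg _)
    · rw [hh, indicator_of_notMem hr, norm_zero]
      exact mul_nonneg ((norm_nonneg _).trans (hS a hmem)) (norm_nonneg _)
  obtain ⟨g, -, hgs, hgle⟩ := hhL.exist_eLpNorm_sub_le ENNReal.ofReal_ne_top hpe
    (ε := ε / 2 / B) (by positivity)
  have hsm : ContDiff ℝ ∞ fun r => χ r * g r := χ.contDiff.mul hgs
  have hsupp : ∀ r, r ∉ Icc (a / 2) (b + a) → χ r * g r = 0 := fun r hr => by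
    rw [hχ0 r hr, zero_mul]
  have hqm : AEStronglyMeasurable (fun r => χ r * g r / w.σ r) halfLine :=
    (hsm.continuous.continuousOn.div w.continuousOn_σ fun r hr =>
      (w.σ_pos r hr).ne').aestronglyMeasurable measurableSet_Ioi
  have hind : MemLp ((Icc a b).indicator G) (ENNReal.ofReal p) halfLine :=
    hG.indicator measurableSet_Icc
  have hpt : ∀ r, ‖((Icc a b).indicator G - fun r => χ r * g r / w.σ r) r‖ ≤ B * ‖(h - g) r‖ := by
    intro r
    by_cases hr : r ∈ Icc (a / 2) (b + a)
    · have e : ((Icc a b).indicator G - fun r => χ r * g r / w.σ r) r =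
          (w.σ r)⁻¹ * (χ r * (h - g) r) := by
        have hσ := (w.σ_pos r (hsub hr)).ne'
        by_cases hr' : r ∈ Icc a b
        · simp only [Pi.sub_apply, hh, indicator_of_mem hr', hχ1 r hr']
          field_simp
        · simp only [Pi.sub_apply, hh, indicator_of_notMem hr']
          field_simp
          ring
      rw [e, norm_mul, norm_mul]
      refine mul_le_mul (hB r hr) ?_ (by positivity) hB0.le
      refine mul_le_of_le_one_left (norm_nonneg _) ?_
      rw [Real.norm_of_nonneg χ.nonneg]
      exact χ.le_one
    · have hr' : r ∉ Icc a b := fun h => hr (hIsub h)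
      simp only [Pi.sub_apply, indicator_of_notMem hr', hsupp r hr, zero_div, sub_zero, norm_zero]
      positivity
  have hle2 : eLpNorm ((Icc a b).indicator G - fun r => χ r * g r / w.σ r) (ENNReal.ofReal p)
      halfLine ≤ ENNReal.ofReal (ε / 2) := by
    refine (eLpNorm_le_mul_eLpNorm_of_ae_le_mul (.of_forall hpt) _).trans ?_
    refine (mul_le_mul_right hgle _).trans_eq ?_
    rw [← ENNReal.ofReal_mul hB0.le, mul_div_cancel₀ _ hB0.ne']
  have htot : eLpNorm (G - fun r => χ r * g r / w.σ r) (ENNReal.ofReal p) halfLine ≤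
      ENNReal.ofReal ε := by
    have e : (G - fun r => χ r * g r / w.σ r) = (G - (Icc a b).indicator G) +
      ((Icc a b).indicator G - fun r => χ r * g r / w.σ r) := by abel
    rw [e]
    refine (eLpNorm_add_le (hG.1.sub hind.1) (hind.1.sub hqm) hpe).trans ?_
    refine (add_le_add htr hle2).trans_eq ?_
    rw [← ENNReal.ofReal_add (by positivity) (by positivity), add_halves]
  refine ⟨fun r => χ r * g r, a / 2, b + a, by positivity, by linarith, hsm, hsupp, ?_, htot⟩
  have : (fun r => χ r * g r / w.σ r) = G - (G - fun r => χ r * g r / w.σ r) := by abel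
  rw [this]
  exact hG.sub ⟨hG.1.sub hqm, htot.trans_lt ENNReal.ofReal_lt_top⟩

end RadialWeight

/-! ### Identification of `DA` with a space of profiles. -/

namespace RadialQuasilinear

/-- The area of the unit sphere of `ℝ ^ N`. -/
noncomputable def sphereArea (N : ℕ) : ℝ :=
  N * (volume : Measure (EuclideanSpace ℝ (Fin N))).real (Metric.ball 0 1)

variable {N : ℕ} [NeZero N]

theorem sphereArea_pos : 0 < sphereArea N := by
  refine mul_pos (Nat.cast_pos.2 (NeZero.pos N)) ?_
  rw [measureReal_def, ENNReal.toReal_pos_iff]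
  exact ⟨Metric.measure_ball_pos _ _ one_pos, measure_ball_lt_top⟩

theorem pow_eq_rpow_sub_one {r : ℝ} : r ^ (N - 1) = r ^ ((N : ℝ) - 1) := by
  rw [← Real.rpow_natCast, Nat.cast_pred (NeZero.pos N)]

theorem integral_comp_norm (f : ℝ → ℝ) :
    ∫ x : EuclideanSpace ℝ (Fin N), f ‖x‖ =
      sphereArea N * ∫ r in Ioi 0, r ^ ((N : ℝ) - 1) * f r := by
  rw [integral_fun_norm_addHaar volume f, finrank_euclideanSpace_fin, nsmul_eq_mul, smul_eq_mul,
    ← mul_assoc, sphereArea]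
  simp only [smul_eq_mul, pow_eq_rpow_sub_one]

theorem integrable_comp_norm {f : ℝ → ℝ} :
    Integrable (fun x : EuclideanSpace ℝ (Fin N) => f ‖x‖) ↔
      IntegrableOn (fun r => r ^ ((N : ℝ) - 1) * f r) (Ioi 0) := by
  rw [integrable_fun_norm_addHaar volume (f := f), finrank_euclideanSpace_fin]
  simp only [smul_eq_mul, pow_eq_rpow_sub_one]

theorem ae_ne_zero : ∀ᵐ x : EuclideanSpace ℝ (Fin N), x ≠ 0 := by
  simp [ae_iff]

end RadialQuasilinear

namespace RadialWeight

open RadialQuasilinear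

/-- The radial function with the profile `tailPrim w.σ G`. -/
noncomputable def radialFun {p : ℝ} (N : ℕ) (w : RadialWeight p) (G : ℝ → ℝ)
    (x : EuclideanSpace ℝ (Fin N)) : ℝ := tailPrim w.σ G ‖x‖

/-- The gradient of `w.radialFun N G`. -/
noncomputable def radialField {p : ℝ} (N : ℕ) (w : RadialWeight p) (G : ℝ → ℝ)
    (x : EuclideanSpace ℝ (Fin N)) : EuclideanSpace ℝ (Fin N) :=
  (w.σ ‖x‖ * G ‖x‖) • ‖x‖⁻¹ • x

/-- The derivative, divided by `σ`, of the restriction of `φ` to a ray. -/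
noncomputable def slope {p : ℝ} {N : ℕ} [NeZero N] (w : RadialWeight p)
    (φ : EuclideanSpace ℝ (Fin N) → ℝ) (r : ℝ) : ℝ :=
  deriv (fun t : ℝ => φ (t • EuclideanSpace.single 0 1)) r / w.σ r

variable {p : ℝ} {N : ℕ} [NeZero N] {A V : ℝ → ℝ} {w : RadialWeight p}

section Slope

variable {φ ψ : EuclideanSpace ℝ (Fin N) → ℝ} (hφ : ContDiff ℝ ∞ φ)
  (hc : HasCompactSupport φ) (hr : ∀ x y, ‖x‖ = ‖y‖ → φ x = φ y)
  (hψ : ContDiff ℝ ∞ ψ)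

include hφ in
theorem contDiff_ray : ContDiff ℝ ∞ fun t : ℝ => φ (t • EuclideanSpace.single 0 1) :=
  hφ.comp (contDiff_id.smul contDiff_const)

include hc in
theorem hasCompactSupport_ray :
    HasCompactSupport fun t : ℝ => φ (t • EuclideanSpace.single 0 1) := by
  refine hc.comp_isClosedEmbedding (g := fun t : ℝ => t • EuclideanSpace.single (0 : Fin N) (1 : ℝ))
    (Isometry.isClosedEmbedding ?_)
  refine Isometry.of_dist_eq fun s t => ?_
  rw [dist_eq_norm, ← sub_smul, norm_smul]
  simp [Real.dist_eq]

include hr in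
theorem eq_ray (x : EuclideanSpace ℝ (Fin N)) : φ x = φ (‖x‖ • EuclideanSpace.single 0 1) :=
  hr _ _ (by simp [norm_smul])

include hφ hψ in
theorem slope_sub : w.slope (φ - ψ) = w.slope φ - w.slope ψ := by
  funext r
  have h1 := ((contDiff_ray hφ).differentiable (by simp)).differentiableAt (x := r)
  have h2 := ((contDiff_ray hψ).differentiable (by simp)).differentiableAt (x := r)
  have := deriv_fun_sub h1 h2
  simp only [slope, Pi.sub_apply, ← sub_div, this]

include hφ in
theorem aestronglyMeasurable_slope : AEStronglyMeasurable (w.slope φ) halfLine :=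
  (((contDiff_ray hφ).continuous_deriv (by simp)).continuousOn.div w.continuousOn_σ fun r hr =>
      (w.σ_pos r hr).ne').aestronglyMeasurable measurableSet_Ioi

include hφ hc hr in
theorem radialFun_slope {x : EuclideanSpace ℝ (Fin N)} (hx : x ≠ 0) :
    w.radialFun N (w.slope φ) x = φ x := by
  rw [radialFun, eq_ray hr x]
  exact tailPrim_deriv_div w (contDiff_ray hφ) (hasCompactSupport_ray hc) (norm_pos_iff.2 hx)

include hφ hr in
theorem gradient_eq_radialField {x : EuclideanSpace ℝ (Fin N)} (hx : x ≠ 0) :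
    gradient φ x = w.radialField N (w.slope φ) x := by
  have h1 := ((contDiff_ray hφ).differentiable (by simp)).differentiableAt (x := ‖x‖)
  have h2 := (hasGradientAt_comp_norm hx h1).gradient
  have h3 : φ = fun x => φ (‖x‖ • EuclideanSpace.single 0 1) := funext (eq_ray hr)
  rw [← h3] at h2
  rw [h2, radialField, slope, mul_div_cancel₀ _ (w.σ_pos _ (norm_pos_iff.2 hx)).ne']

omit [NeZero N] in
theorem norm_radialField (w : RadialWeight p) (G : ℝ → ℝ) {x : EuclideanSpace ℝ (Fin N)}
    (hx : x ≠ 0) : ‖w.radialField N G x‖ = w.σ ‖x‖ * |G ‖x‖| := by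
  rw [radialField, norm_smul_inv_norm_smul _ hx, abs_mul, abs_of_pos (w.σ_pos _ (norm_pos_iff.2 hx))]

end Slope

section Energy

variable [hp : Fact (1 < p)] (hw : w.IsRadialFor N A V) (hA : ∀ r, 0 < r → 0 < A r)
include hw

omit [NeZero N] in
theorem IsRadialFor.rpow_κ (hV : ∀ r, 0 < r → 0 ≤ V r) {r : ℝ} (hr : 0 < r) :
    w.κ r ^ p = V r * r ^ ((N : ℝ) - 1) := by
  have hp0 : 0 < p := by linarith [hp.out]
  rw [hw.κ_eq r hr, ← Real.rpow_mul (mul_nonneg (hV r hr) (by positivity)),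
    one_div_mul_cancel hp0.ne', Real.rpow_one]

include hA

omit [NeZero N] in
-- The normalisation behind the choice of `σ`: it absorbs both `A` and the polar Jacobian, so the
-- gradient energy becomes unweighted.
theorem IsRadialFor.mul_rpow_σ {r : ℝ} (hr : 0 < r) :
    r ^ ((N : ℝ) - 1) * A r * w.σ r ^ p = 1 := by
  have hp0 : 0 < p := by linarith [hp.out]
  have h0 := mul_pos (hA r hr) (by positivity : 0 < r ^ ((N : ℝ) - 1))
  rw [hw.σ_eq r hr, ← Real.rpow_mul h0.le, neg_mul, one_div_mul_cancel hp0.ne', Real.rpow_neg_one,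
    mul_comm (r ^ _), mul_inv_cancel₀ h0.ne']

variable {φ ψ : EuclideanSpace ℝ (Fin N) → ℝ} (hφ : ContDiff ℝ ∞ φ)
  (hc : HasCompactSupport φ) (hr : ∀ x y, ‖x‖ = ‖y‖ → φ x = φ y)
include hφ hr

omit hp hw hA in
theorem energy_ae_eq : (fun x => A ‖x‖ * ‖gradient φ x‖ ^ p) =ᵐ[volume]
    fun x => (fun r => A r * (w.σ r * |w.slope φ r|) ^ p) ‖x‖ := by
  filter_upwards [ae_ne_zero] with x hx
  rw [gradient_eq_radialField (w := w) hφ hr hx, norm_radialField _ _ hx]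

omit [NeZero N] hφ hr in
theorem IsRadialFor.energy_eqOn (G : ℝ → ℝ) : EqOn
    (fun r => r ^ ((N : ℝ) - 1) * (A r * (w.σ r * |G r|) ^ p)) (fun r => |G r| ^ p) (Ioi 0) := by
  intro r (hr0 : 0 < r)
  dsimp only
  rw [Real.mul_rpow (w.σ_pos r hr0).le (abs_nonneg _), ← mul_assoc, ← mul_assoc,
    hw.mul_rpow_σ hA hr0, one_mul]

theorem IsRadialFor.integral_energy :
    ∫ x, A ‖x‖ * ‖gradient φ x‖ ^ p = sphereArea N * ∫ r in Ioi 0, |w.slope φ r| ^ p := by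
  rw [integral_congr_ae (energy_ae_eq (w := w) hφ hr),
    integral_comp_norm fun r => A r * (w.σ r * |w.slope φ r|) ^ p,
    setIntegral_congr_fun measurableSet_Ioi (hw.energy_eqOn hA _)]

theorem IsRadialFor.integrable_energy : Integrable (fun x => A ‖x‖ * ‖gradient φ x‖ ^ p) ↔
    MemLp (w.slope φ) (ENNReal.ofReal p) halfLine := by
  rw [integrable_congr (energy_ae_eq (w := w) hφ hr),
    integrable_comp_norm (f := fun r => A r * (w.σ r * |w.slope φ r|) ^ p),
    integrableOn_congr_fun (hw.energy_eqOn hA _) measurableSet_Ioi, IntegrableOn,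
    integrable_abs_rpow_iff hp.out (aestronglyMeasurable_slope hφ)]

theorem IsRadialFor.normA_eq (hL : MemLp (w.slope φ) (ENNReal.ofReal p) halfLine) :
    normA p A φ = sphereArea N ^ (1 / p) * ‖hL.toLp‖ := by
  rw [normA, hw.integral_energy hA hφ hr, Real.mul_rpow sphereArea_pos.le
    (integral_nonneg fun _ => by positivity), Lp.norm_eq_integral]
  congr 2
  refine integral_congr_ae ?_
  filter_upwards [hL.coeFn_toLp] with r hr
  rw [hr]

omit hφ hr in
-- Up to the area factor, `slope` is an isometry into `L^p`, so Cauchy sequences of test functions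
-- correspond to Cauchy sequences in `L^p`.
theorem IsRadialFor.normA_sub_eq (hφ : φ ∈ SA N p A) (hψ : ψ ∈ SA N p A)
    (hL : MemLp (w.slope φ) (ENNReal.ofReal p) halfLine)
    (hM : MemLp (w.slope ψ) (ENNReal.ofReal p) halfLine) :
    normA p A (φ - ψ) = sphereArea N ^ (1 / p) * ‖hL.toLp - hM.toLp‖ := by
  have hs : w.slope (φ - ψ) = w.slope φ - w.slope ψ := slope_sub hφ.1 hψ.1
  have hLs : MemLp (w.slope (φ - ψ)) (ENNReal.ofReal p) halfLine := by
    rw [hs]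
    exact hL.sub hM
  have hd : ContDiff ℝ ∞ (φ - ψ) := hφ.1.sub hψ.1
  rw [hw.normA_eq hA hd (fun x y hxy => by
    simp only [Pi.sub_apply, hφ.2.2.1 x y hxy, hψ.2.2.1 x y hxy]) hLs, ← MemLp.toLp_sub]
  congr 2
  exact MemLp.toLp_congr _ _ (by rw [hs])

end Energy

section Convergence

variable [hp : Fact (1 < p)]

theorem tendsto_tailPrim {G : ℕ → ℝ → ℝ} {H : ℝ → ℝ}
    (hG : ∀ n, MemLp (G n) (ENNReal.ofReal p) halfLine)
    (hH : MemLp H (ENNReal.ofReal p) halfLine)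
    (hlim : Tendsto (fun n => (hG n).toLp) atTop (𝓝 hH.toLp)) {r : ℝ} (hr : 0 < r) :
    Tendsto (fun n => tailPrim w.σ (G n) r) atTop (𝓝 (tailPrim w.σ H r)) := by
  rw [tendsto_iff_norm_sub_tendsto_zero] at hlim ⊢
  have h0 := hlim.const_mul (w.normOn (Ioi r))
  rw [mul_zero] at h0
  refine squeeze_zero (fun _ => norm_nonneg _) (fun n => ?_) h0
  rw [← tailPrim_sub (hG n) hH hr, ← MemLp.toLp_sub, Lp.norm_eq_integral]
  refine (abs_tailPrim_le ((hG n).sub hH) hr).trans_eq ?_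
  congr 2
  refine integral_congr_ae ?_
  filter_upwards [((hG n).sub hH).coeFn_toLp] with s hs
  rw [hs]

/-- Functions of `D_A` are radial, with profile a primitive vanishing at infinity. -/
theorem IsRadialFor.exists_of_mem_DA (hw : w.IsRadialFor N A V) (hA : ∀ r, 0 < r → 0 < A r)
    {u : EuclideanSpace ℝ (Fin N) → ℝ} (hu : u ∈ DA N p A) :
    ∃ G, MemLp G (ENNReal.ofReal p) halfLine ∧ u =ᵐ[volume] w.radialFun N G := by
  obtain ⟨φ, hφ, hcau, hlim⟩ := hu
  have hL : ∀ n, MemLp (w.slope (φ n)) (ENNReal.ofReal p) halfLine := fun n =>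
    (hw.integrable_energy hA (hφ n).1 (hφ n).2.2.1).1 (hφ n).2.2.2
  have hcs : CauchySeq fun n => (hL n).toLp := by
    rw [Metric.cauchySeq_iff]
    intro ε hε
    have hs := Real.rpow_pos_of_pos (sphereArea_pos (N := N)) (1 / p)
    obtain ⟨n₀, hn₀⟩ := hcau (sphereArea N ^ (1 / p) * ε) (by positivity)
    refine ⟨n₀, fun m hm n hn => ?_⟩
    have h1 := hn₀ m n hm hn
    rw [hw.normA_sub_eq hA (hφ m) (hφ n) (hL m) (hL n)] at h1
    rw [dist_eq_norm]
    exact lt_of_mul_lt_mul_left h1 hs.le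
  obtain ⟨F, hF⟩ := cauchySeq_tendsto_of_complete hcs
  refine ⟨F, Lp.memLp F, ?_⟩
  filter_upwards [hlim, ae_ne_zero] with x hx hx0
  have h1 := tendsto_tailPrim (w := w) hL (Lp.memLp F) (by rwa [Lp.toLp_coeFn])
    (norm_pos_iff.2 hx0)
  refine tendsto_nhds_unique (hx.congr fun n => ?_) h1
  exact (radialFun_slope (hφ n).1 (hφ n).2.1 (hφ n).2.2.1 hx0).symm

/-- The antiderivative, normalised to vanish at `b`, of a smooth function supported in `[a, b]` is
zero beyond `b` and constant near the origin. Its radial extension is therefore smooth and compactly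
supported. -/
theorem IsRadialFor.exists_mem_SA_approx (hw : w.IsRadialFor N A V) (hA : ∀ r, 0 < r → 0 < A r)
    {G : ℝ → ℝ} (hG : MemLp G (ENNReal.ofReal p) halfLine) {ε : ℝ} (hε : 0 < ε) :
    ∃ φ ∈ SA N p A, ∃ hφ : MemLp (w.slope φ) (ENNReal.ofReal p) halfLine,
      ‖hφ.toLp - hG.toLp‖ ≤ ε := by
  obtain ⟨g, a, b, ha, hab, hg, hsupp, hgL, hle⟩ := w.exists_smooth_approx hG hε
  set ϕ : ℝ → ℝ := fun r => ∫ s in b..r, g s with hϕ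
  have hder : ∀ r, HasDerivAt ϕ (g r) r := fun r =>
    intervalIntegral.integral_hasDerivAt_right (hg.continuous.intervalIntegrable _ _)
      (hg.continuous.stronglyMeasurableAtFilter _ _) hg.continuous.continuousAt
  have hϕs : ContDiff ℝ ∞ ϕ := by
    rw [contDiff_infty_iff_deriv]
    refine ⟨fun r => (hder r).differentiableAt, ?_⟩
    rwa [show deriv ϕ = g from funext fun r => (hder r).deriv]
  have hconst : ∀ r < a, ϕ r = ϕ 0 := by
    intro r hr
    have : ϕ r - ϕ 0 = ∫ s in (0 : ℝ)..r, g s := by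
      rw [hϕ]
      dsimp only
      rw [← intervalIntegral.integral_add_adjacent_intervals (b := 0)
        (hg.continuous.intervalIntegrable _ _) (hg.continuous.intervalIntegrable _ _)]
      ring
    rw [← sub_eq_zero, this]
    refine intervalIntegral.integral_zero_ae (.of_forall fun s hs => hsupp s fun h => ?_)
    have := hs.2
    have h2 : s ≤ max 0 r := this
    rcases max_le_iff.1 (max_le ha.le hr.le) with ⟨h3, h4⟩
    rcases le_max_iff.1 h2 with h5 | h5
    · linarith [h.1]
    · linarith [h.1]
  have hzero : ∀ r, b ≤ r → ϕ r = 0 := by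
    intro r hr
    refine intervalIntegral.integral_zero_ae (.of_forall fun s hs => hsupp s fun h => ?_)
    rw [uIoc_of_le hr] at hs
    linarith [h.2, hs.1]
  set φ : EuclideanSpace ℝ (Fin N) → ℝ := fun x => ϕ ‖x‖ with hφ
  have hφs : ContDiff ℝ ∞ φ := contDiff_comp_norm ha hϕs hconst
  have hφc : HasCompactSupport φ := by
    refine HasCompactSupport.intro (isCompact_closedBall 0 b) fun x hx => hzero _ ?_
    rw [mem_closedBall_zero_iff, not_le] at hx
    exact hx.le
  have hφr : ∀ x y, ‖x‖ = ‖y‖ → φ x = φ y := fun x y h => by simp only [hφ, h]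
  have hslope : w.slope φ =ᵐ[halfLine] fun r => g r / w.σ r := by
    filter_upwards [ae_restrict_mem measurableSet_Ioi] with r (hr : 0 < r)
    rw [slope]
    congr 1
    refine (HasDerivAt.congr_of_eventuallyEq (hder r) ?_).deriv
    filter_upwards [lt_mem_nhds hr] with t ht
    simp [hφ, norm_smul, abs_of_pos ht]
  have hL : MemLp (w.slope φ) (ENNReal.ofReal p) halfLine := (memLp_congr_ae hslope).2 hgL
  refine ⟨φ, ⟨hφs, hφc, hφr, (hw.integrable_energy hA hφs hφr).2 hL⟩, hL, ?_⟩
  rw [norm_sub_rev, ← MemLp.toLp_sub, Lp.norm_toLp]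
  refine ENNReal.toReal_le_of_le_ofReal hε.le ?_
  rw [eLpNorm_congr_ae (EventuallyEq.rfl.sub hslope)]
  exact hle

theorem IsRadialFor.radialFun_mem_DA (hw : w.IsRadialFor N A V) (hA : ∀ r, 0 < r → 0 < A r)
    {G : ℝ → ℝ} (hG : MemLp G (ENNReal.ofReal p) halfLine) : w.radialFun N G ∈ DA N p A := by
  choose φ hφ hL hle using fun n : ℕ =>
    hw.exists_mem_SA_approx hA hG (Nat.one_div_pos_of_nat (n := n) (α := ℝ))
  have hlim : Tendsto (fun n => (hL n).toLp) atTop (𝓝 hG.toLp) := by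
    rw [tendsto_iff_norm_sub_tendsto_zero]
    exact squeeze_zero (fun _ => norm_nonneg _) hle tendsto_one_div_add_atTop_nhds_zero_nat
  have hs := Real.rpow_pos_of_pos (sphereArea_pos (N := N)) (1 / p)
  refine ⟨φ, hφ, fun ε hε => ?_, ?_⟩
  · obtain ⟨n₀, hn₀⟩ := Metric.cauchySeq_iff.1 hlim.cauchySeq (ε / sphereArea N ^ (1 / p))
      (by positivity)
    refine ⟨n₀, fun m n hm hn => ?_⟩
    have h1 := hn₀ m hm n hn
    rw [dist_eq_norm, lt_div_iff₀' hs] at h1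
    rwa [hw.normA_sub_eq hA (hφ m) (hφ n) (hL m) (hL n)]
  · filter_upwards [ae_ne_zero] with x hx
    refine (tendsto_tailPrim (w := w) hL hG hlim (norm_pos_iff.2 hx)).congr fun n => ?_
    exact radialFun_slope (hφ n).1 (hφ n).2.1 (hφ n).2.2.1 hx

end Convergence

end RadialWeight

/-! ### Weak gradients of radial functions. -/

namespace RadialQuasilinear

variable {N : ℕ}

theorem exists_annulus {E : Type*} [NormedAddCommGroup E] {K : Set E} (hK : IsCompact K)
    (h0 : K ⊆ {0}ᶜ) : ∃ ρ P : ℝ, 0 < ρ ∧ 0 < P ∧ ∀ x ∈ K, ‖x‖ ∈ Icc ρ P := by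
  rcases K.eq_empty_or_nonempty with rfl | hne
  · exact ⟨1, 1, one_pos, one_pos, by simp⟩
  obtain ⟨y, hy, hmin⟩ := hK.exists_isMinOn hne continuous_norm.continuousOn
  obtain ⟨z, hz, hmax⟩ := hK.exists_isMaxOn hne continuous_norm.continuousOn
  exact ⟨‖y‖, ‖z‖, norm_pos_iff.2 (h0 hy), norm_pos_iff.2 (h0 hz),
    fun x hx => ⟨hmin hx, hmax hx⟩⟩

theorem integrable_apply_mul {G : EuclideanSpace ℝ (Fin N) → EuclideanSpace ℝ (Fin N)}
    (hG : LocallyIntegrableOn G {0}ᶜ) {φ : EuclideanSpace ℝ (Fin N) → ℝ} (hφ : Continuous φ)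
    (hc : HasCompactSupport φ) (h0 : tsupport φ ⊆ {0}ᶜ) (i : Fin N) :
    Integrable fun x => G x i * φ x := by
  have h1 : IntegrableOn (fun x => G x i) (tsupport φ) := by
    have := hG.integrableOn_compact_subset h0 hc
    exact (EuclideanSpace.proj (𝕜 := ℝ) i).integrable_comp this
  have h2 : IntegrableOn (fun x => G x i * φ x) (tsupport φ) :=
    h1.mul_continuousOn hφ.continuousOn hc
  rw [integrableOn_iff_integrable_of_support_subset] at h2
  · exact h2
  · intro x hx
    exact subset_tsupport φ (right_ne_zero_of_mul hx)

theorem HasWeakGradient.ae_eq {u : EuclideanSpace ℝ (Fin N) → ℝ}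
    {G H : EuclideanSpace ℝ (Fin N) → EuclideanSpace ℝ (Fin N)} [NeZero N]
    (hG : HasWeakGradient u G) (hH : HasWeakGradient u H) : G =ᵐ[volume] H := by
  have key : ∀ i : Fin N, ∀ᵐ x, x ∈ ({0}ᶜ : Set (EuclideanSpace ℝ (Fin N))) →
      G x i - H x i = 0 := by
    intro i
    have hloc : LocallyIntegrableOn (fun x => G x i - H x i) {0}ᶜ := by
      have h1 := hG.2.1.sub hH.2.1
      rw [locallyIntegrableOn_iff isOpen_compl_singleton.isLocallyClosed] at h1 ⊢
      exact fun k hk hkc => (EuclideanSpace.proj (𝕜 := ℝ) i).integrable_comp (h1 k hk hkc)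
    refine isOpen_compl_singleton.ae_eq_zero_of_integral_contDiff_smul_eq_zero hloc ?_
    intro φ hφ hc h0
    have h1 := hG.2.2 φ hφ hc h0 i
    rw [hH.2.2 φ hφ hc h0 i, neg_inj] at h1
    simp only [smul_eq_mul, mul_comm (φ _), sub_mul]
    rw [integral_sub (integrable_apply_mul hG.2.1 hφ.continuous hc h0 i)
      (integrable_apply_mul hH.2.1 hφ.continuous hc h0 i), h1, sub_self]
  filter_upwards [ae_all_iff.2 key, ae_ne_zero] with x hx hx0
  ext i
  exact sub_eq_zero.1 (hx i hx0)

theorem HasWeakGradient.congr {u v : EuclideanSpace ℝ (Fin N) → ℝ}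
    {G : EuclideanSpace ℝ (Fin N) → EuclideanSpace ℝ (Fin N)}
    (h : HasWeakGradient u G) (huv : v =ᵐ[volume] u) : HasWeakGradient v G := by
  refine ⟨?_, h.2.1, fun φ hφ hc h0 i => ?_⟩
  · have h1 := h.1
    rw [locallyIntegrableOn_iff isOpen_compl_singleton.isLocallyClosed] at h1 ⊢
    exact fun k hk hkc => (h1 k hk hkc).congr (ae_restrict_of_ae huv.symm)
  · rw [← h.2.2 φ hφ hc h0 i]
    refine integral_congr_ae ?_
    filter_upwards [huv] with x hx
    rw [hx]

/-- `weakGrad` is an arbitrary choice; uniqueness almost everywhere lets any explicit weak gradient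
stand in for it. -/
theorem HasWeakGradient.weakGrad_ae_eq [NeZero N] {u : EuclideanSpace ℝ (Fin N) → ℝ}
    {G : EuclideanSpace ℝ (Fin N) → EuclideanSpace ℝ (Fin N)}
    (h : HasWeakGradient u G) : weakGrad u =ᵐ[volume] G := by
  have hex : ∃ G, HasWeakGradient u G := ⟨G, h⟩
  rw [weakGrad, dif_pos hex]
  exact hex.choose_spec.ae_eq h

end RadialQuasilinear

namespace RadialWeight

open RadialQuasilinear

variable {p : ℝ} [hp : Fact (1 < p)] {N : ℕ} {A V : ℝ → ℝ} {w : RadialWeight p}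

omit hp in
theorem abs_radialField_apply_le (w : RadialWeight p) (G : ℝ → ℝ) (x : EuclideanSpace ℝ (Fin N))
    (i : Fin N) : |w.radialField N G x i| ≤ |w.σ ‖x‖ * G ‖x‖| := by
  by_cases hx : x = 0
  · simp only [radialField, hx, smul_zero, PiLp.zero_apply, abs_zero]
    exact abs_nonneg _
  rw [← norm_smul_inv_norm_smul (w.σ ‖x‖ * G ‖x‖) hx]
  exact PiLp.norm_apply_le (w.radialField N G x) i

variable [NeZero N] {G H : ℝ → ℝ} (hG : MemLp G (ENNReal.ofReal p) halfLine)
  (hH : MemLp H (ENNReal.ofReal p) halfLine)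

include hG

theorem aestronglyMeasurable_radialFun : AEStronglyMeasurable (w.radialFun N G) :=
  ((continuousOn_tailPrim hG).aestronglyMeasurable
    measurableSet_Ioi).comp_quasiMeasurePreserving (quasiMeasurePreserving_norm volume)

omit hp in
theorem aestronglyMeasurable_radialField : AEStronglyMeasurable (w.radialField N G) := by
  have h1 : AEStronglyMeasurable (fun r => w.σ r * G r) halfLine :=
    (w.continuousOn_σ.aestronglyMeasurable measurableSet_Ioi).mul hG.1
  have h2 := h1.comp_quasiMeasurePreserving
    (quasiMeasurePreserving_norm (volume : Measure (EuclideanSpace ℝ (Fin N))))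
  refine h2.smul ?_
  exact (measurable_norm.inv.smul measurable_id).aestronglyMeasurable

omit [NeZero N] in
include hH in
theorem radialFun_sub {x : EuclideanSpace ℝ (Fin N)} (hx : x ≠ 0) :
    w.radialFun N (G - H) x = w.radialFun N G x - w.radialFun N H x :=
  tailPrim_sub hG hH (norm_pos_iff.2 hx)

/-- Integrability over an annulus. -/
theorem integrable_annulus {ρ P : ℝ} (hρ : 0 < ρ) (hP : 0 < P) :
    Integrable (fun x : EuclideanSpace ℝ (Fin N) =>
        (Icc ρ P).indicator (fun r => |w.σ r * G r|) ‖x‖) ∧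
      ∫ x : EuclideanSpace ℝ (Fin N), (Icc ρ P).indicator (fun r => |w.σ r * G r|) ‖x‖ ≤
        sphereArea N * P ^ ((N : ℝ) - 1) * w.normOn (Ioi (ρ / 2)) *
          (∫ r in Ioi 0, |G r| ^ p) ^ (1 / p) := by
  have hN : (0 : ℝ) ≤ (N : ℝ) - 1 := sub_nonneg.2 (Nat.one_le_cast.2 (NeZero.pos N))
  have hρ2 : 0 < ρ / 2 := by positivity
  have hsub : Icc ρ P ⊆ Ioi (ρ / 2) := fun r hr => (half_lt_self hρ).trans_le hr.1
  have hint := (integrableOn_Ioi (w := w) hG hρ2).abs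
  have hle : ∀ r ∈ Ioi (0 : ℝ), r ^ ((N : ℝ) - 1) * (Icc ρ P).indicator (fun r => |w.σ r * G r|) r ≤
      P ^ ((N : ℝ) - 1) * (Ioi (ρ / 2)).indicator (fun r => |w.σ r * G r|) r := by
    intro r hr
    have hr0 : 0 < r := hr
    by_cases h : r ∈ Icc ρ P
    · rw [indicator_of_mem h, indicator_of_mem (hsub h)]
      gcongr
      exact h.2
    · rw [indicator_of_notMem h, mul_zero]
      exact mul_nonneg (by positivity) (indicator_nonneg (fun _ _ => abs_nonneg _) _)
  have hdom : IntegrableOn (fun r => P ^ ((N : ℝ) - 1) *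
      (Ioi (ρ / 2)).indicator (fun r => |w.σ r * G r|) r) (Ioi 0) :=
    (((integrable_indicator_iff measurableSet_Ioi).2 hint).integrableOn).const_mul _
  have hmeas : AEStronglyMeasurable (fun r => r ^ ((N : ℝ) - 1) *
      (Icc ρ P).indicator (fun r => |w.σ r * G r|) r) halfLine := by
    refine (measurable_id.pow_const _).aestronglyMeasurable.mul ?_
    refine AEStronglyMeasurable.indicator ?_ measurableSet_Icc
    exact ((w.continuousOn_σ.aestronglyMeasurable measurableSet_Ioi).mul hG.1).norm
  have hi : IntegrableOn (fun r => r ^ ((N : ℝ) - 1) *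
      (Icc ρ P).indicator (fun r => |w.σ r * G r|) r) (Ioi 0) := by
    refine Integrable.mono' hdom hmeas ?_
    filter_upwards [ae_restrict_mem measurableSet_Ioi] with r hr
    have hr0 : 0 < r := hr
    rw [Real.norm_of_nonneg (mul_nonneg (by positivity)
      (indicator_nonneg (fun _ _ => abs_nonneg _) _))]
    exact hle r hr
  refine ⟨integrable_comp_norm.2 hi, ?_⟩
  rw [integral_comp_norm, mul_assoc, mul_assoc]
  refine mul_le_mul_of_nonneg_left ?_ sphereArea_pos.le
  refine (setIntegral_mono_on hi hdom measurableSet_Ioi hle).trans ?_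
  rw [integral_const_mul]
  refine mul_le_mul_of_nonneg_left ?_ (by positivity)
  rw [setIntegral_indicator measurableSet_Ioi, inter_eq_right.2 (Ioi_subset_Ioi hρ2.le)]
  exact (integral_abs_mul_le hG hρ2 subset_rfl).2

variable {φ : EuclideanSpace ℝ (Fin N) → ℝ} {ρ P M : ℝ}

/-- The bound by the `L^p` norm of `G` makes this half of the integration by parts formula
continuous in `G`, so that the formula can be extended by density. -/
theorem integrable_radialFun_mul (hρ : 0 < ρ) (hφ : Integrable φ)
    (h0 : ∀ x, φ x ≠ 0 → ρ ≤ ‖x‖) :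
    Integrable (fun x => w.radialFun N G x * φ x) ∧
      |∫ x, w.radialFun N G x * φ x| ≤
        w.normOn (Ioi ρ) * (∫ x, |φ x|) * (∫ r in Ioi 0, |G r| ^ p) ^ (1 / p) := by
  set Q := (∫ r in Ioi 0, |G r| ^ p) ^ (1 / p) with hQ
  have hQ0 : 0 ≤ Q := Real.rpow_nonneg (integral_nonneg fun _ => by positivity) _
  have hle : ∀ x, ‖w.radialFun N G x * φ x‖ ≤ w.normOn (Ioi ρ) * Q * |φ x| := by
    intro x
    rw [norm_mul, Real.norm_eq_abs, Real.norm_eq_abs]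
    by_cases h : φ x = 0
    · simp [h]
    · refine mul_le_mul_of_nonneg_right ?_ (abs_nonneg _)
      have h1 := h0 x h
      exact (abs_tailPrim_le hG (hρ.trans_le h1)).trans (mul_le_mul_of_nonneg_right
        (w.normOn_mono hρ (Ioi_subset_Ioi h1) subset_rfl) hQ0)
  have hd := hφ.abs.const_mul (w.normOn (Ioi ρ) * Q)
  refine ⟨Integrable.mono' hd ((aestronglyMeasurable_radialFun hG).mul hφ.1) (.of_forall hle), ?_⟩
  refine (norm_integral_le_of_norm_le hd (.of_forall hle)).trans_eq ?_
  rw [integral_const_mul]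
  ring

theorem integrable_radialField_mul (hρ : 0 < ρ) (hP : 0 < P) (hM : 0 ≤ M) (hφ : Continuous φ)
    (h0 : ∀ x, φ x ≠ 0 → ‖x‖ ∈ Icc ρ P) (hle : ∀ x, |φ x| ≤ M) (i : Fin N) :
    Integrable (fun x => w.radialField N G x i * φ x) ∧
      |∫ x, w.radialField N G x i * φ x| ≤
        M * (sphereArea N * P ^ ((N : ℝ) - 1) * w.normOn (Ioi (ρ / 2))) *
          (∫ r in Ioi 0, |G r| ^ p) ^ (1 / p) := by
  obtain ⟨hi, hb⟩ := integrable_annulus (w := w) (N := N) hG hρ hP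
  have hpt : ∀ x, ‖w.radialField N G x i * φ x‖ ≤
      M * (Icc ρ P).indicator (fun r => |w.σ r * G r|) ‖x‖ := by
    intro x
    rw [norm_mul, Real.norm_eq_abs, Real.norm_eq_abs, mul_comm]
    by_cases h : φ x = 0
    · rw [h, abs_zero, zero_mul]
      exact mul_nonneg hM (indicator_nonneg (fun _ _ => abs_nonneg _) _)
    · rw [indicator_of_mem (h0 x h)]
      exact mul_le_mul (hle x) (w.abs_radialField_apply_le G x i) (abs_nonneg _) hM
  have hm : AEStronglyMeasurable (fun x => w.radialField N G x i) :=
    (EuclideanSpace.proj (𝕜 := ℝ) i).continuous.comp_aestronglyMeasurable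
      (aestronglyMeasurable_radialField hG)
  have hd := hi.const_mul M
  refine ⟨Integrable.mono' hd (hm.mul hφ.aestronglyMeasurable) (.of_forall hpt), ?_⟩
  refine (norm_integral_le_of_norm_le hd (.of_forall hpt)).trans ?_
  rw [integral_const_mul, mul_assoc]
  exact mul_le_mul_of_nonneg_left hb hM

omit [NeZero N] in
theorem locallyIntegrableOn_radialFun : LocallyIntegrableOn (w.radialFun N G) {0}ᶜ := by
  refine ContinuousOn.locallyIntegrableOn ?_ (measurableSet_singleton _).compl
  exact (continuousOn_tailPrim hG).comp continuous_norm.continuousOn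
    fun x hx => norm_pos_iff.2 hx

theorem locallyIntegrableOn_radialField : LocallyIntegrableOn (w.radialField N G) {0}ᶜ := by
  rw [locallyIntegrableOn_iff isOpen_compl_singleton.isLocallyClosed]
  intro K hK hKc
  obtain ⟨ρ, P, hρ, hP, hKb⟩ := exists_annulus hKc hK
  refine Integrable.mono' (integrable_annulus (w := w) (N := N) hG hρ hP).1.integrableOn
    (aestronglyMeasurable_radialField hG).restrict ?_
  filter_upwards [ae_restrict_mem hKc.measurableSet] with x hx
  rw [indicator_of_mem (hKb x hx), radialField, norm_smul_inv_norm_smul _ (hK hx)]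

/-- The weak gradient of a radial function with profile `tailPrim w.σ G`. -/
theorem IsRadialFor.hasWeakGradient (hw : w.IsRadialFor N A V) (hA : ∀ r, 0 < r → 0 < A r) :
    HasWeakGradient (w.radialFun N G) (w.radialField N G) := by
  refine ⟨locallyIntegrableOn_radialFun hG, locallyIntegrableOn_radialField hG,
    fun φ hφ hc h0 i => ?_⟩
  obtain ⟨ρ, P, hρ, hP, hb⟩ := exists_annulus hc h0
  obtain ⟨M, hM⟩ := hc.exists_bound_of_continuous hφ.continuous
  have hM0 : 0 ≤ M := (norm_nonneg _).trans (hM 0)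
  set D : EuclideanSpace ℝ (Fin N) → ℝ := fun x => fderiv ℝ φ x (EuclideanSpace.single i 1)
    with hD
  have hDc : Continuous D := (hφ.continuous_fderiv (by simp)).clm_apply continuous_const
  have hDs : HasCompactSupport D := hc.fderiv_apply (𝕜 := ℝ) _
  have hDi : Integrable D := hDc.integrable_of_hasCompactSupport hDs
  have hD0 : ∀ x, D x ≠ 0 → ρ ≤ ‖x‖ := fun x hx => by
    refine (hb x ?_).1
    refine support_fderiv_subset ℝ (f := φ) fun h => hx ?_
    simp [hD, h]
  have hφ0 : ∀ x, φ x ≠ 0 → ‖x‖ ∈ Icc ρ P := fun x hx => hb x (subset_tsupport φ hx)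
  -- `T` is the defect in the integration by parts formula, linear and `L^p`-continuous in the
  -- profile's derivative. It vanishes on slopes of smooth test functions, which are dense, hence
  -- everywhere.
  set T : (ℝ → ℝ) → ℝ := fun H => (∫ x, w.radialFun N H x * D x) +
    ∫ x, w.radialField N H x i * φ x with hT
  obtain ⟨C, hC0, hC⟩ : ∃ C, 0 ≤ C ∧ ∀ H, MemLp H (ENNReal.ofReal p) halfLine →
      |T H| ≤ C * (∫ r in Ioi 0, |H r| ^ p) ^ (1 / p) := by
    have hP' : 0 ≤ P ^ ((N : ℝ) - 1) := by positivity
    have hs := (sphereArea_pos (N := N)).le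
    have h1 := w.normOn_nonneg (Ioi ρ)
    have h2 := w.normOn_nonneg (Ioi (ρ / 2))
    have h3 : 0 ≤ ∫ x, |D x| := integral_nonneg fun _ => abs_nonneg _
    refine ⟨w.normOn (Ioi ρ) * (∫ x, |D x|) +
      M * (sphereArea N * P ^ ((N : ℝ) - 1) * w.normOn (Ioi (ρ / 2))), by positivity,
      fun H hH => ?_⟩
    rw [add_mul]
    exact (abs_add_le _ _).trans (add_le_add (integrable_radialFun_mul hH hρ hDi hD0).2
      (integrable_radialField_mul hH hρ hP hM0 hφ.continuous hφ0 hM i).2)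
  have hTsub : ∀ H, MemLp H (ENNReal.ofReal p) halfLine → T (G - H) = T G - T H := by
    intro H hH
    have e1 : ∫ x, w.radialFun N (G - H) x * D x =
        (∫ x, w.radialFun N G x * D x) - ∫ x, w.radialFun N H x * D x := by
      rw [← integral_sub (integrable_radialFun_mul hG hρ hDi hD0).1
        (integrable_radialFun_mul hH hρ hDi hD0).1]
      refine integral_congr_ae ?_
      filter_upwards [ae_ne_zero] with x hx
      rw [radialFun_sub hG hH hx, sub_mul]
    have e2 : ∫ x, w.radialField N (G - H) x i * φ x =
        (∫ x, w.radialField N G x i * φ x) - ∫ x, w.radialField N H x i * φ x := by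
      rw [← integral_sub (integrable_radialField_mul hG hρ hP hM0 hφ.continuous hφ0 hM i).1
        (integrable_radialField_mul hH hρ hP hM0 hφ.continuous hφ0 hM i).1]
      refine integral_congr_ae (.of_forall fun x => ?_)
      simp only [radialField, Pi.sub_apply, PiLp.smul_apply, smul_eq_mul]
      ring
    simp only [hT, e1, e2]
    ring
  have hTsmooth : ∀ ψ ∈ SA N p A, T (w.slope ψ) = 0 := by
    intro ψ hψ
    have e1 : ∫ x, w.radialFun N (w.slope ψ) x * D x = ∫ x, ψ x * D x := by
      refine integral_congr_ae ?_
      filter_upwards [ae_ne_zero] with x hx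
      rw [radialFun_slope hψ.1 hψ.2.1 hψ.2.2.1 hx]
    have e2 : ∫ x, w.radialField N (w.slope ψ) x i * φ x =
        ∫ x, fderiv ℝ ψ x (EuclideanSpace.single i 1) * φ x := by
      refine integral_congr_ae ?_
      filter_upwards [ae_ne_zero] with x hx
      rw [← gradient_eq_radialField hψ.1 hψ.2.2.1 hx, ← inner_gradient_left,
        EuclideanSpace.inner_single_right]
      simp only [one_mul, conj_trivial]
    have hψd : Continuous fun x => fderiv ℝ ψ x (EuclideanSpace.single i 1) :=
      (hψ.1.continuous_fderiv (by simp)).clm_apply continuous_const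
    simp only [hT, e1, e2]
    rw [integral_mul_fderiv_eq_neg_fderiv_mul_of_integrable, neg_add_cancel]
    · exact (hψd.mul hφ.continuous).integrable_of_hasCompactSupport hc.mul_left
    · exact (hψ.1.continuous.mul hDc).integrable_of_hasCompactSupport hDs.mul_left
    · exact (hψ.1.continuous.mul hφ.continuous).integrable_of_hasCompactSupport hc.mul_left
    · exact fun x _ => (hψ.1.differentiable (by simp)).differentiableAt
    · exact fun x _ => (hφ.differentiable (by simp)).differentiableAt
  have hTG : |T G| ≤ 0 := by
    refine le_of_forall_pos_le_add fun ε hε => ?_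
    obtain ⟨ψ, hψ, hL, hle⟩ := hw.exists_mem_SA_approx hA hG (ε := ε / (C + 1)) (by positivity)
    have h1 := hTsub _ hL
    rw [hTsmooth ψ hψ, sub_zero] at h1
    have h2 := hC _ (hG.sub hL)
    have h3 : (∫ r in Ioi 0, |(G - w.slope ψ) r| ^ p) ^ (1 / p) = ‖hG.toLp - hL.toLp‖ := by
      rw [← MemLp.toLp_sub, Lp.norm_eq_integral]
      congr 1
      refine integral_congr_ae ?_
      filter_upwards [(hG.sub hL).coeFn_toLp] with r hr
      rw [hr]
    rw [h1, h3, norm_sub_rev] at h2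
    rw [zero_add]
    calc |T G| ≤ C * ‖hL.toLp - hG.toLp‖ := h2
      _ ≤ (C + 1) * (ε / (C + 1)) := by gcongr; linarith
      _ = ε := by field_simp
  exact eq_neg_of_add_eq_zero_left (abs_eq_zero.1 (le_antisymm hTG (abs_nonneg _)))

end RadialWeight

/-! ### Truncated nonlinearity and return to `ℝ^N`. -/

namespace RadialQuasilinear

/-- The truncation makes the nonlinearity vanish on the negative axis, where the hypotheses say
nothing about `f`. This is also what forces the critical point to be nonnegative. -/
theorem isDoublePower_comp_max {f : ℝ → ℝ} {M q₁ q₂ : ℝ} (hf0 : HypF0 f) (hM : 0 ≤ M)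
    (hf : ∀ t, 0 ≤ t → 0 ≤ f t ∧ f t ≤ M * min (t ^ (q₁ - 1)) (t ^ (q₂ - 1)))
    (h₁ : 1 < q₁) (h₂ : 1 < q₂) : IsDoublePower (fun t => f (max t 0)) M q₁ q₂ where
  continuous := hf0.1.comp (continuous_id.max continuous_const)
  eq_zero t ht := by simp [max_eq_right ht, hf0.2]
  nonneg t := (hf _ (le_max_right _ _)).1
  le t := by
    rcases le_total t 0 with ht | ht
    · rw [max_eq_right ht, hf0.2]
      positivity
    · rw [max_eq_left ht, abs_of_nonneg ht]
      exact (hf t ht).2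
  M_nonneg := hM
  lt₁ := h₁
  lt₂ := h₂

theorem primitive_comp_max {f : ℝ → ℝ} {t : ℝ} (ht : 0 ≤ t) :
    primitive (fun t => f (max t 0)) t = primitive f t := by
  refine intervalIntegral.integral_congr fun s hs => ?_
  rw [uIcc_of_le ht] at hs
  simp only [max_eq_left hs.1]

theorem primitive_comp_max_of_nonpos {f : ℝ → ℝ} (hf : f 0 = 0) {t : ℝ} (ht : t ≤ 0) :
    primitive (fun t => f (max t 0)) t = 0 := by
  refine intervalIntegral.integral_zero_ae (.of_forall fun s hs => ?_)
  rw [uIoc_of_ge ht] at hs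
  rw [max_eq_right hs.2, hf]

theorem mul_primitive_comp_max_le {f : ℝ → ℝ} {θ : ℝ} (hf : f 0 = 0)
    (h : ∀ t, 0 ≤ t → θ * primitive f t ≤ f t * t) (t : ℝ) :
    θ * primitive (fun t => f (max t 0)) t ≤ f (max t 0) * t := by
  rcases le_total t 0 with ht | ht
  · rw [primitive_comp_max_of_nonpos hf ht, max_eq_right ht, hf, mul_zero, zero_mul]
  · rw [primitive_comp_max ht, max_eq_left ht]
    exact h t ht

end RadialQuasilinear

namespace RadialWeight

open RadialQuasilinear

variable {p : ℝ} [hp : Fact (1 < p)] {N : ℕ} [NeZero N] {A V K : ℝ → ℝ} {w : RadialWeight p}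
  (hw : w.IsRadialFor N A V)

include hw

theorem IsRadialFor.radialFun_mem_spaceX (hA : ∀ r, 0 < r → 0 < A r) (hV : ∀ r, 0 < r → 0 ≤ V r)
    (u : w.space) : w.radialFun N u.1.1 ∈ spaceX N p A V := by
  refine ⟨hw.radialFun_mem_DA hA (Lp.memLp u.1.1), ?_⟩
  refine (integrable_comp_norm (f := fun r => V r * |w.eval u r| ^ p)).2 ?_
  refine (integrable_eval u).1.congr_fun (fun r (hr : 0 < r) => ?_) measurableSet_Ioi
  dsimp only
  rw [hw.rpow_κ hV hr]
  ring

/-- The weak formulation quantifies over all of `X`, so each of its elements has to be represented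
in `w.space`, not only the solution. -/
theorem IsRadialFor.exists_of_mem_spaceX (hA : ∀ r, 0 < r → 0 < A r)
    (hV : ∀ r, 0 < r → 0 ≤ V r) {h : EuclideanSpace ℝ (Fin N) → ℝ} (hh : h ∈ spaceX N p A V) :
    ∃ z : w.space, h =ᵐ[volume] w.radialFun N z.1.1 := by
  obtain ⟨G, hG, hhG⟩ := hw.exists_of_mem_DA hA hh.1
  have h1 : Integrable fun x : EuclideanSpace ℝ (Fin N) =>
      V ‖x‖ * |tailPrim w.σ G ‖x‖| ^ p := by
    refine hh.2.congr ?_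
    filter_upwards [hhG] with x hx
    rw [hx, radialFun]
  have h2 := (integrable_comp_norm (f := fun r => V r * |tailPrim w.σ G r| ^ p)).1 h1
  have hmeas : AEStronglyMeasurable (fun r => w.κ r * tailPrim w.σ G r) halfLine :=
    (w.aemeasurable_κ.mul
      ((continuousOn_tailPrim hG).aemeasurable measurableSet_Ioi)).aestronglyMeasurable
  have hW : MemLp (fun r => w.κ r * tailPrim w.σ G r) (ENNReal.ofReal p) halfLine := by
    rw [← integrable_abs_rpow_iff hp.out hmeas]
    refine h2.congr_fun (fun r (hr : 0 < r) => ?_) measurableSet_Ioi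
    have hκ := w.κ_nonneg r hr
    dsimp only
    rw [abs_mul, abs_of_nonneg hκ, Real.mul_rpow hκ (abs_nonneg _), hw.rpow_κ hV hr]
    ring
  obtain ⟨z, -, hz, -⟩ := exists_eval_eq hG hW
  refine ⟨z, ?_⟩
  filter_upwards [hhG, ae_ne_zero] with x hx hx0
  rw [hx]
  exact (hz _ (norm_pos_iff.2 hx0)).symm

variable {u h : EuclideanSpace ℝ (Fin N) → ℝ} (y z : w.space)
  (hu : u =ᵐ[volume] w.radialFun N y.1.1) (hh : h =ᵐ[volume] w.radialFun N z.1.1)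

include hu hh

/-- Both fields are radial multiples of `x / |x|`, so their inner product is a product of scalars
and the weights cancel by `mul_rpow_σ`. The same area factor appears in all three terms of the
equation. -/
theorem IsRadialFor.gradient_term (hA : ∀ r, 0 < r → 0 < A r) :
    Integrable (fun x => A ‖x‖ * ‖weakGrad u x‖ ^ (p - 2) *
      inner ℝ (weakGrad u x) (weakGrad h x)) ∧
    ∫ x, A ‖x‖ * ‖weakGrad u x‖ ^ (p - 2) * inner ℝ (weakGrad u x) (weakGrad h x) =
      sphereArea N * ∫ r in Ioi 0, |y.1.1 r| ^ (p - 2) * y.1.1 r * z.1.1 r := by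
  have hy := ((hw.hasWeakGradient (Lp.memLp y.1.1) hA).congr hu).weakGrad_ae_eq
  have hz := ((hw.hasWeakGradient (Lp.memLp z.1.1) hA).congr hh).weakGrad_ae_eq
  have hae : (fun x => A ‖x‖ * ‖weakGrad u x‖ ^ (p - 2) *
      inner ℝ (weakGrad u x) (weakGrad h x)) =ᵐ[volume] fun x => (fun r => A r *
        (w.σ r * |y.1.1 r|) ^ (p - 2) * (w.σ r * y.1.1 r * (w.σ r * z.1.1 r))) ‖x‖ := by
    filter_upwards [hy, hz, ae_ne_zero] with x h1 h2 h0
    rw [h1, h2, norm_radialField _ _ h0, radialField, radialField, real_inner_smul_left,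
      real_inner_smul_right, real_inner_self_eq_norm_sq, norm_smul, norm_inv, norm_norm,
      inv_mul_cancel₀ (norm_ne_zero_iff.2 h0)]
    ring
  have hon : EqOn (fun r => r ^ ((N : ℝ) - 1) * (A r * (w.σ r * |y.1.1 r|) ^ (p - 2) *
      (w.σ r * y.1.1 r * (w.σ r * z.1.1 r))))
      (fun r => |y.1.1 r| ^ (p - 2) * y.1.1 r * z.1.1 r) (Ioi 0) := by
    intro r (hr : 0 < r)
    have hσ := w.σ_pos r hr
    have e := hw.mul_rpow_σ hA hr
    have e2 : w.σ r ^ p = w.σ r ^ (p - 2) * (w.σ r * w.σ r) := by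
      rw [← sq, ← Real.rpow_natCast, ← Real.rpow_add hσ]
      norm_num
    dsimp only
    rw [Real.mul_rpow hσ.le (abs_nonneg _)]
    calc _ = r ^ ((N : ℝ) - 1) * A r * (w.σ r ^ (p - 2) * (w.σ r * w.σ r)) *
          (|y.1.1 r| ^ (p - 2) * y.1.1 r * z.1.1 r) := by ring
      _ = _ := by rw [← e2, e, one_mul]
  rw [integrable_congr hae, integral_congr_ae hae,
    integrable_comp_norm (f := fun r => A r *
        (w.σ r * |y.1.1 r|) ^ (p - 2) * (w.σ r * y.1.1 r * (w.σ r * z.1.1 r))),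
    integral_comp_norm fun r => A r *
        (w.σ r * |y.1.1 r|) ^ (p - 2) * (w.σ r * y.1.1 r * (w.σ r * z.1.1 r)),
    integrableOn_congr_fun hon measurableSet_Ioi, setIntegral_congr_fun measurableSet_Ioi hon]
  exact ⟨integrable_abs_rpow_sub_one_mul hp.out (Lp.memLp y.1.1) (Lp.memLp z.1.1), rfl⟩

theorem IsRadialFor.potential_term (hV : ∀ r, 0 < r → 0 ≤ V r) :
    Integrable (fun x => V ‖x‖ * |u x| ^ (p - 2) * u x * h x) ∧
    ∫ x, V ‖x‖ * |u x| ^ (p - 2) * u x * h x =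
      sphereArea N * ∫ r in Ioi 0, |y.1.2 r| ^ (p - 2) * y.1.2 r * z.1.2 r := by
  have hae : (fun x => V ‖x‖ * |u x| ^ (p - 2) * u x * h x) =ᵐ[volume]
      fun x => (fun r => V r * |w.eval y r| ^ (p - 2) * w.eval y r * w.eval z r) ‖x‖ := by
    filter_upwards [hu, hh] with x h1 h2
    rw [h1, h2]
    rfl
  have hon : (fun r => r ^ ((N : ℝ) - 1) * (V r * |w.eval y r| ^ (p - 2) * w.eval y r *
      w.eval z r)) =ᵐ[halfLine] fun r => |y.1.2 r| ^ (p - 2) * y.1.2 r * z.1.2 r := by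
    filter_upwards [snd_ae_eq y, snd_ae_eq z, ae_restrict_mem measurableSet_Ioi]
      with r h1 h2 (hr : 0 < r)
    have hκ := w.κ_nonneg r hr
    have hp0 : 0 < p := by linarith [hp.out]
    have e2 : w.κ r ^ p = w.κ r ^ (p - 2) * (w.κ r * w.κ r) := by
      rcases hκ.eq_or_lt with h0 | h0
      · rw [← h0, Real.zero_rpow hp0.ne', mul_zero, mul_zero]
      · rw [← sq, ← Real.rpow_natCast, ← Real.rpow_add h0]
        norm_num
    rw [h1, h2, abs_mul, abs_of_nonneg hκ, Real.mul_rpow hκ (abs_nonneg _)]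
    calc _ = V r * r ^ ((N : ℝ) - 1) *
          (|w.eval y r| ^ (p - 2) * w.eval y r * w.eval z r) := by ring
      _ = _ := by rw [← hw.rpow_κ hV hr, e2]; ring
  rw [integrable_congr hae, integral_congr_ae hae,
    integrable_comp_norm (f := fun r => V r * |w.eval y r| ^ (p - 2) * w.eval y r * w.eval z r),
    integral_comp_norm fun r => V r * |w.eval y r| ^ (p - 2) * w.eval y r * w.eval z r,
    IntegrableOn, integrable_congr hon, integral_congr_ae hon]
  exact ⟨integrable_abs_rpow_sub_one_mul hp.out (Lp.memLp y.1.2) (Lp.memLp z.1.2), rfl⟩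

omit hw in
theorem IsSubcritical.nonlinear_term {f : ℝ → ℝ} {b : ℝ → ℝ} {M q₁ q₂ : ℝ}
    (hs : w.IsSubcritical (fun r => K r * r ^ ((N : ℝ) - 1)) b q₁ q₂)
    (hf : IsDoublePower f M q₁ q₂) :
    Integrable (fun x => K ‖x‖ * f (u x) * h x) ∧
    ∫ x, K ‖x‖ * f (u x) * h x =
      sphereArea N * ∫ r in Ioi 0, K r * r ^ ((N : ℝ) - 1) * (f (w.eval y r) * w.eval z r) := by
  have hae : (fun x => K ‖x‖ * f (u x) * h x) =ᵐ[volume]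
      fun x => (fun r => K r * f (w.eval y r) * w.eval z r) ‖x‖ := by
    filter_upwards [hu, hh] with x h1 h2
    rw [h1, h2]
    rfl
  have hon : (fun r => r ^ ((N : ℝ) - 1) * (K r * f (w.eval y r) * w.eval z r)) =
      fun r => K r * r ^ ((N : ℝ) - 1) * (f (w.eval y r) * w.eval z r) := by
    funext r
    ring
  rw [integrable_congr hae, integral_congr_ae hae,
    integrable_comp_norm (f := fun r => K r * f (w.eval y r) * w.eval z r),
    integral_comp_norm fun r => K r * f (w.eval y r) * w.eval z r, hon]
  exact ⟨integrableOn_mul_nonlinearity hs hf y z, rfl⟩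

omit hw hu hh h in
-- Away from the origin the function is continuous, so one nonzero value persists on a nonempty open
-- set, which has positive measure.
theorem not_ae_eq_zero_of_eval_ne_zero {r : ℝ} (hr : 0 < r) (hy : w.eval y r ≠ 0) :
    ¬ ∀ᵐ x, w.radialFun N y.1.1 x = 0 := by
  intro h0
  have hc : ContinuousOn (w.radialFun N y.1.1) {0}ᶜ :=
    (continuousOn_eval y).comp continuous_norm.continuousOn fun x hx => norm_pos_iff.2 hx
  have hopen := hc.isOpen_inter_preimage isOpen_compl_singleton (isOpen_compl_singleton (x := 0))
  have hz : volume ({0}ᶜ ∩ w.radialFun N y.1.1 ⁻¹' {0}ᶜ) = 0 :=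
    measure_mono_null (fun x hx => hx.2) (ae_iff.1 h0)
  rw [hopen.measure_eq_zero_iff volume] at hz
  have hn : ‖r • EuclideanSpace.single (0 : Fin N) (1 : ℝ)‖ = r := by
    simp [norm_smul, abs_of_pos hr]
  have hmem : r • EuclideanSpace.single (0 : Fin N) (1 : ℝ) ∈
      ({0}ᶜ ∩ w.radialFun N y.1.1 ⁻¹' {0}ᶜ : Set (EuclideanSpace ℝ (Fin N))) := by
    refine ⟨fun h => ?_, ?_⟩
    · rw [mem_singleton_iff, ← norm_eq_zero, hn] at h
      exact hr.ne' h
    · change tailPrim _ _ _ ≠ 0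
      rw [hn]
      exact hy
  rw [hz] at hmem
  exact hmem

end RadialWeight

theorem theorem5p2 (N : ℕ) (hN : 3 ≤ N) (p : ℝ) (hp : 1 < p) (hpN : p < N)
    (A V K f : ℝ → ℝ) (a₀ aInf : ℝ)
    (hA : RadialQuasilinear.HypA N p A a₀ aInf)
    (hV : RadialQuasilinear.HypV V) (hK : RadialQuasilinear.HypK K)
    (hf0 : RadialQuasilinear.HypF0 f) (hf1 : RadialQuasilinear.HypF1 p f)
    (hf2 : RadialQuasilinear.HypF2 f)
    (R₁ R₂ : ℝ) (hR₁ : 0 < R₁) (hR₂ : 0 < R₂)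
    (α₀ β₀ γ₀ : ℝ) (hβ₀ : β₀ ∈ Set.Icc (0 : ℝ) 1) (hγ₀ : p - a₀ ≤ γ₀)
    (hK₀ : RadialQuasilinear.RatioBound K V α₀ β₀ (Set.Ioo 0 R₁))
    (hV₀ : RadialQuasilinear.LowerBound V γ₀ (Set.Ioo 0 R₁))
    (αInf βInf γInf : ℝ) (hβInf : βInf ∈ Set.Icc (0 : ℝ) 1) (hγInf : γInf ≤ p - aInf)
    (hKInf : RadialQuasilinear.RatioBound K V αInf βInf (Set.Ioi R₂))
    (hVInf : RadialQuasilinear.LowerBound V γInf (Set.Ioi R₂))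
    (q₁ q₂ : ℝ) (hq₁ : p < q₁) (hq₂ : p < q₂)
    (hq₁A : (α₀, q₁) ∈ RadialQuasilinear.regionA N p a₀ β₀ γ₀)
    (hq₂max : max (max (max 1 (p * βInf)) (RadialQuasilinear.qStar N p αInf βInf γInf))
      (RadialQuasilinear.qStarStar N p aInf αInf βInf γInf) < q₂)
    (hfq : RadialQuasilinear.HypFq f q₁ q₂) :
    ∃ u : EuclideanSpace ℝ (Fin N) → ℝ,
      RadialQuasilinear.IsWeakSolution N p A V K f u ∧
      (∀ᵐ x, 0 ≤ u x) ∧ ¬ (∀ᵐ x, u x = 0) := by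
  have : Fact (1 < p) := ⟨hp⟩
  have : NeZero N := ⟨by omega⟩
  obtain ⟨w, hw⟩ := RadialQuasilinear.exists_isRadialFor hA hV
  obtain ⟨b, hs⟩ := hw.exists_isSubcritical hA hK hR₁ hR₂ hβ₀.2 hγ₀ hK₀ hV₀ hβInf.2 hγInf hKInf
    hVInf hq₁ hq₂ hq₁A ((le_max_right _ _).trans_lt hq₂max)
  obtain ⟨M, hM, hfM⟩ := hfq
  obtain ⟨θ, hθ, hAR⟩ := hf1
  obtain ⟨t₀, ht₀, hpos⟩ := hf2
  have hf := RadialQuasilinear.isDoublePower_comp_max hf0 hM.le hfM (hp.trans hq₁) (hp.trans hq₂)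
  obtain ⟨u, hu0, ⟨r, hr, hur⟩, hsol⟩ := RadialWeight.exists_solution hs hf hθ
    (RadialQuasilinear.mul_primitive_comp_max_le hf0.2 hAR) ht₀
    (by rwa [RadialQuasilinear.primitive_comp_max ht₀.le])
  have hA0 := hA.2.1
  have hV0 := hV.1
  have hnn : ∀ᵐ x, 0 ≤ w.radialFun N u.1.1 x := by
    filter_upwards [RadialQuasilinear.ae_ne_zero] with x hx
    exact hu0 _ (norm_pos_iff.2 hx)
  refine ⟨w.radialFun N u.1.1, ⟨hw.radialFun_mem_spaceX hA0 hV0 u, fun h hh => ?_⟩, hnn,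
    RadialWeight.not_ae_eq_zero_of_eval_ne_zero u hr hur⟩
  obtain ⟨z, hz⟩ := hw.exists_of_mem_spaceX hA0 hV0 hh
  obtain ⟨i₁, e₁⟩ := hw.gradient_term u z EventuallyEq.rfl hz hA0
  obtain ⟨i₂, e₂⟩ := hw.potential_term u z EventuallyEq.rfl hz hV0
  obtain ⟨i₃, e₃⟩ := hs.nonlinear_term u z EventuallyEq.rfl hz hf
  -- Nonnegativity of the solution removes the truncation of `f`.
  have hfu : (fun x => K ‖x‖ * f (max (w.radialFun N u.1.1 x) 0) * h x) =ᵐ[volume]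
      fun x => K ‖x‖ * f (w.radialFun N u.1.1 x) * h x := by
    filter_upwards [hnn] with x hx
    rw [max_eq_left hx]
  rw [integrable_congr hfu] at i₃
  rw [integral_congr_ae hfu] at e₃
  refine ⟨i₁, i₂, i₃, ?_⟩
  rw [e₁, e₂, e₃, ← mul_add, hsol z]
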